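/- Let $\tau\in\mathbb C$ with $\operatorname{Im}\tau>0$, $p^\lambda=e^{\mathrm i\pi\tau\lambda}$, $p=p^1$, $x_j=e^{\mathrm i\pi z_j}$, $(a;q)_\infty=\prod_{j\ge 0}(1-aq^j)$, $\theta(x;q)=(x;q)_\infty(q/x;q)_\infty$ and $\theta(x,y,w;q)=\theta(x;q)\theta(y;q)\theta(w;q)$. For a positive integer $n$ and $\sigma\in\{0,1,2,3,4,6,\hat 0,\hat 1,\hat 2,\hat 3,\hat 4,\hat 6\}$ let $$P_n^{(\sigma)}(z_1,\dots,z_{2n};\tau)=\prod_{1\le i<j\le 2n}m_{ij}d_{ij}\ \mathop{\mathrm{pfaff}}_{1\le i,j\le 2n}\left(\frac{a_{ij}}{d_{ij}}\right),\qquad \mathop{\mathrm{pfaff}}_{1\le i,j\le 2n}(c_{ij})=\frac1{2^nn!}\sum_{\pi\in S_{2n}}\operatorname{sgn}(\pi)\prod_{k=1}^n c_{\pi(2k-1)\pi(2k)},$$ where, with $r=x_i^2/x_j^2$, $\varepsilon=1$ for unhatted and $\varepsilon=-1$ for hatted labels, - $\sigma=0,\hat 0$: $a_{ij}=\frac{x_j^2}{x_i^2}\theta(r,-r,\varepsilon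 pr;p^2)$, $d_{ij}=\theta(\varepsilon p^{1/3}r;p^{2/3})$, $m_{ij}=1$; - $\sigma=1,\hat 1$: $a_{ij}=\frac{x_i}{x_j}\theta(r,-r,\varepsilon pr;p^2)$, $d_{ij}=\theta(-r^3;p^6)$, $m_{ij}=x_j^3/x_i^3$; - $\sigma=2,\hat 2$: $a_{ij}=\frac{x_j}{x_i}\theta(r,pr,-pr;p^2)$, $d_{ij}=\theta(\varepsilon p^3r^3;p^6)$, $m_{ij}=1$; - $\sigma=3,\hat 3$: $a_{ij}=\frac{x_j}{x_i}\theta(r,-r,\varepsilon pr;p^2)$, $d_{ij}=\theta(-r;p^{2/3})$, $m_{ij}=x_j/x_i$; - $\sigma=4,\hat 4$: $a_{ij}=\frac{x_j^2}{x_i^2}\theta(r,-r,\varepsilon pr;p^2)$, $d_{ij}=\theta(\varepsilon p^3r^3;p^6)$, $m_{ij}=1$; - $\sigma=6,\hat 6$: $a_{ij}=\frac{x_j}{x_i}\theta(r,pr,-pr;p^2)$, $d_{ij}=\theta(\varepsilon p^{1/3}r;p^{2/3})$, $m_{ij}=1$. Since $m_{ij}d_{ij}=m_{ji}d_{ji}$,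 the denominators in each term of the pfaffian cancel against factors of the product, and $P_n^{(\sigma)}$ is thereby defined for all $(z_1,\dots,z_{2n})\in\mathbb C^{2n}$. Then, for all $n\ge 1$ and all $z_1,\dots,z_{2n}\in\mathbb C$, $$P_n^{(\sigma)}\left(z_1+\tfrac12,z_2,\dots,z_{2n};\tau\right)=A_\sigma B_\sigma^{n-1}P_n^{(\rho)}(z_1,\dots,z_{2n};\tau),\qquad \{\sigma,\rho\}=\{1,\hat 1\},\{3,\hat 3\},$$ $$P_n^{(\sigma)}\left(z_1+\tfrac\tau2,z_2,\dots,z_{2n};\tau\right)=A_\sigma B_\sigma^{n-1}\frac{x_2^3\cdots x_{2n}^3}{x_1^{6n-3}}P_n^{(\rho)}(z_1,\dots,z_{2n};\tau),\qquad \{\sigma,\rho\}=\{0,6\},\{2,4\},$$ $$P_n^{(\sigma)}\left(z_1+\tfrac{\tau+1}2,z_2,\dots,z_{2n};\tau\right)=A_\sigma B_\sigma^{n-1}\frac{x_2^3\cdots x_{2n}^3}{x_1^{6n-3}}P_n^{(\rho)}(z_1,\dots,z_{2n};\tau),\qquad \{\sigma,\rho\}=\{\hat 0,\hat 6\},\{\hat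 2,\hat 4\}$$ (each unordered pair gives two identities, for the two ways of naming its elements $\sigma$ and $\rho$), where $$A_\sigma=\begin{cases}-1,&\sigma=1,\hat1,3,\hat3,\\-p^{-1},&\sigma=0,4,\\p^{-1},&\sigma=\hat0,\hat4,\\-p^{-1/2},&\sigma=2,6,\\\mathrm i p^{-1/2},&\sigma=\hat2,\hat6,\end{cases}$$ $$B_\sigma=\begin{cases} -p^{-5/3}\theta(-p^{1/3};p^2)/\theta(-p^{2/3};p^2),&\sigma=0,\\ p^{-5/3}\theta(p^{1/3};p^2)/\theta(-p^{2/3};p^2),&\sigma=\hat 0,\\ -\theta(p;p^6)/\theta(-p;p^6),&\sigma=1,\\ -\theta(-p;p^6)/\theta(p;p^6),&\sigma=\hat 1,\\ p^{-1}\theta(-p;p^6)/\theta(-p^2;p^6),&\sigma=2,\\ -p^{-1}\theta(p;p^6)/\theta(-p^2;p^6),&\sigma=\hat 2,\\ \theta(-p^{1/3};p^2)/\theta(p^{1/3};p^2),&\sigma=3,\\ \theta(p^{1/3};p^2)/\theta(-p^{1/3};p^2),&\sigma=\hat 3,\\ p^{-2}\theta(-p^2;p^6)/\theta(-p;p^6),&\sigma=4,\\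 p^{-2}\theta(-p^2;p^6)/\theta(p;p^6),&\sigma=\hat 4,\\ -p^{-4/3}\theta(-p^{2/3};p^2)/\theta(-p^{1/3};p^2),&\sigma=6,\\ -p^{-4/3}\theta(-p^{2/3};p^2)/\theta(p^{1/3};p^2),&\sigma=\hat 6. \end{cases}$$ -/

import Mathlib

open Complex Finset

namespace EllipticPfaffian

noncomputable section

/-- The infinite product `(a; q)_∞ = ∏_{j ≥ 0} (1 - a q^j)`. -/
def qProd (a q : ℂ) : ℂ := ∏' j : ℕ, (1 - a * q ^ j)

/-- The multiplicative theta function `θ(x; q) = (x; q)_∞ (q / x; q)_∞`. -/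
def theta (x q : ℂ) : ℂ := qProd x q * qProd (q / x) q

/-- `θ(x, y, w; q) = θ(x; q) θ(y; q) θ(w; q)`. -/
def theta3 (x y w q : ℂ) : ℂ := theta x q * theta y q * theta w q

/-- The power `p ^ l = exp (π i τ l)` of the nome `p = exp (π i τ)`. -/
def nome (τ l : ℂ) : ℂ := cexp (Real.pi * I * τ * l)

/-- The multiplicative variable `x = exp (π i z)`. -/
def xvar (z : ℂ) : ℂ := cexp (Real.pi * I * z)

/-- The twelve labels `0, 1, 2, 3, 4, 6` and their hatted versions. -/
inductive Label
  | s0 | s1 | s2 | s3 | s4 | s6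
  | h0 | h1 | h2 | h3 | h4 | h6

/-- The sign that distinguishes a label from its hatted version: the factors
`θ(± p^l y; p^(2l))` of the unhatted functions become `θ(∓ p^l y; p^(2l))`. -/
def hatSign : Label → ℂ
  | .s0 | .s1 | .s2 | .s3 | .s4 | .s6 => 1
  | .h0 | .h1 | .h2 | .h3 | .h4 | .h6 => -1

/-- The numerator of the `(i, j)` entry of the pfaffian, as a function of `x = x_i`, `y = x_j`. -/
def entryNum (σ : Label) (τ x y : ℂ) : ℂ :=
  let p := nome τ 1
  let q := nome τ 2
  let e := hatSign σ
  let r := x ^ 2 / y ^ 2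
  match σ with
  | .s0 | .h0 => y ^ 2 / x ^ 2 * theta3 r (-r) (e * p * r) q
  | .s1 | .h1 => x / y * theta3 r (-r) (e * p * r) q
  | .s2 | .h2 => y / x * theta3 r (e * p * r) (-(e * p * r)) q
  | .s3 | .h3 => y / x * theta3 r (-r) (e * p * r) q
  | .s4 | .h4 => y ^ 2 / x ^ 2 * theta3 r (-r) (e * p * r) q
  | .s6 | .h6 => y / x * theta3 r (e * p * r) (-(e * p * r)) q

/-- The theta function in the denominator of the `(i, j)` entry of the pfaffian. -/
def entryDen (σ : Label) (τ x y : ℂ) : ℂ :=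
  let e := hatSign σ
  match σ with
  | .s0 | .h0 | .s6 | .h6 => theta (e * nome τ (1 / 3) * (x ^ 2 / y ^ 2)) (nome τ (2 / 3))
  | .s1 | .h1 => theta (-(x ^ 6 / y ^ 6)) (nome τ 6)
  | .s2 | .h2 | .s4 | .h4 => theta (e * nome τ 3 * (x ^ 6 / y ^ 6)) (nome τ 6)
  | .s3 | .h3 => theta (-(x ^ 2 / y ^ 2)) (nome τ (2 / 3))

/-- The monomial in front of the theta function in the product over `i < j`. -/
def monom (σ : Label) (x y : ℂ) : ℂ :=
  match σ with
  | .s1 | .h1 => y ^ 3 / x ^ 3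
  | .s3 | .h3 => y / x
  | .s0 | .h0 | .s2 | .h2 | .s4 | .h4 | .s6 | .h6 => 1

/-- The first index `2k - 1` of the `k`-th consecutive pair (here with indices starting from `0`). -/
def fstIdx {n : ℕ} (k : Fin n) : Fin (2 * n) := ⟨2 * k.1, by omega⟩

/-- The second index `2k` of the `k`-th consecutive pair (here with indices starting from `0`). -/
def sndIdx {n : ℕ} (k : Fin n) : Fin (2 * n) := ⟨2 * k.1 + 1, by omega⟩

/-- The pfaffian of a skew-symmetric matrix of even size. -/
def pfaffian {n : ℕ} (M : Matrix (Fin (2 * n)) (Fin (2 * n)) ℂ) : ℂ :=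
  1 / ((2 : ℂ) ^ n * (n.factorial : ℂ)) *
    ∑ π : Equiv.Perm (Fin (2 * n)), ((Equiv.Perm.sign π : ℤ) : ℂ) *
      ∏ k : Fin n, M (π (fstIdx k)) (π (sndIdx k))

/-- The index pairs `(i, j)` with `i < j`. -/
def upperPairs (m : ℕ) : Finset (Fin m × Fin m) := univ.filter fun e => e.1 < e.2

/-- The product of `b i j` over `i < j` times the pfaffian of `a i j / d i j`; it is meaningful
where no `d i j` vanishes. -/
def PQuot {n : ℕ} (σ : Label) (z : Fin (2 * n) → ℂ) (τ : ℂ) : ℂ :=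
  (∏ e ∈ upperPairs (2 * n), monom σ (xvar (z e.1)) (xvar (z e.2)) *
      entryDen σ τ (xvar (z e.1)) (xvar (z e.2))) *
    pfaffian (Matrix.of fun i j =>
      entryNum σ τ (xvar (z i)) (xvar (z j)) / entryDen σ τ (xvar (z i)) (xvar (z j)))

/-- The index pairs `i < j` that are not matched by the pairing
`{π 1, π 2}, …, {π (2n-1), π (2n)}`. -/
def unpaired {n : ℕ} (π : Equiv.Perm (Fin (2 * n))) : Finset (Fin (2 * n) × Fin (2 * n)) :=
  (upperPairs (2 * n)).filter fun e =>
    ∀ k : Fin n, s(π (fstIdx k), π (sndIdx k)) ≠ s(e.1, e.2)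

/-- The multivariable theta function `P_n^{(σ)}(z_1, …, z_{2n}; τ)`, defined for all values of the
variables: in each term of the pfaffian, the denominators are cancelled against the corresponding
factors of the product over `i < j`. It equals `PQuot` wherever no denominator vanishes, see
`P_eq_PQuot` below. -/
def P {n : ℕ} (σ : Label) (z : Fin (2 * n) → ℂ) (τ : ℂ) : ℂ :=
  1 / ((2 : ℂ) ^ n * (n.factorial : ℂ)) *
    ∑ π : Equiv.Perm (Fin (2 * n)), ((Equiv.Perm.sign π : ℤ) : ℂ) *
      (∏ k : Fin n,
        monom σ (xvar (z (π (fstIdx k)))) (xvar (z (π (sndIdx k)))) *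
          entryNum σ τ (xvar (z (π (fstIdx k)))) (xvar (z (π (sndIdx k))))) *
      ∏ e ∈ unpaired π, monom σ (xvar (z e.1)) (xvar (z e.2)) *
        entryDen σ τ (xvar (z e.1)) (xvar (z e.2))

/-- The constant `A_σ`. -/
def constA (σ : Label) (τ : ℂ) : ℂ :=
  match σ with
  | .s1 | .h1 | .s3 | .h3 => -1
  | .s0 | .s4 => -nome τ (-1)
  | .h0 | .h4 => nome τ (-1)
  | .s2 | .s6 => -nome τ (-1 / 2)
  | .h2 | .h6 => I * nome τ (-1 / 2)

/-- The constant `B_σ`. -/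
def constB (σ : Label) (τ : ℂ) : ℂ :=
  match σ with
  | .s0 => -nome τ (-5 / 3) * theta (-nome τ (1 / 3)) (nome τ 2) /
      theta (-nome τ (2 / 3)) (nome τ 2)
  | .h0 => nome τ (-5 / 3) * theta (nome τ (1 / 3)) (nome τ 2) /
      theta (-nome τ (2 / 3)) (nome τ 2)
  | .s1 => -theta (nome τ 1) (nome τ 6) / theta (-nome τ 1) (nome τ 6)
  | .h1 => -theta (-nome τ 1) (nome τ 6) / theta (nome τ 1) (nome τ 6)
  | .s2 => nome τ (-1) * theta (-nome τ 1) (nome τ 6) / theta (-nome τ 2) (nome τ 6)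
  | .h2 => -nome τ (-1) * theta (nome τ 1) (nome τ 6) / theta (-nome τ 2) (nome τ 6)
  | .s3 => theta (-nome τ (1 / 3)) (nome τ 2) / theta (nome τ (1 / 3)) (nome τ 2)
  | .h3 => theta (nome τ (1 / 3)) (nome τ 2) / theta (-nome τ (1 / 3)) (nome τ 2)
  | .s4 => nome τ (-2) * theta (-nome τ 2) (nome τ 6) / theta (-nome τ 1) (nome τ 6)
  | .h4 => nome τ (-2) * theta (-nome τ 2) (nome τ 6) / theta (nome τ 1) (nome τ 6)
  | .s6 => -nome τ (-4 / 3) * theta (-nome τ (2 / 3)) (nome τ 2) /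
      theta (-nome τ (1 / 3)) (nome τ 2)
  | .h6 => -nome τ (-4 / 3) * theta (-nome τ (2 / 3)) (nome τ 2) /
      theta (nome τ (1 / 3)) (nome τ 2)

/-- The index of the first variable `z_1`. -/
def firstIdx (n : ℕ) (hn : 0 < n) : Fin (2 * n) := ⟨0, by omega⟩

/-- The vector `(z_1 + s, z_2, …, z_{2n})`. -/
def shiftFirst {n : ℕ} (hn : 0 < n) (z : Fin (2 * n) → ℂ) (s : ℂ) : Fin (2 * n) → ℂ :=
  Function.update z (firstIdx n hn) (z (firstIdx n hn) + s)

/-- The monomial `x_2^3 ⋯ x_{2n}^3 / x_1^(6n-3)`. -/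
def shiftMonom {n : ℕ} (hn : 0 < n) (z : Fin (2 * n) → ℂ) : ℂ :=
  (∏ j ∈ univ.erase (firstIdx n hn), xvar (z j) ^ 3) / xvar (z (firstIdx n hn)) ^ (6 * n - 3)

/-! Consistency of the definitions: `P` is the product times the pfaffian. -/

theorem xvar_ne (z : ℂ) : xvar z ≠ 0 := exp_ne_zero _

theorem nome_ne (τ l : ℂ) : nome τ l ≠ 0 := exp_ne_zero _

theorem norm_nome_lt (τ : ℂ) (hτ : 0 < τ.im) (l : ℝ) (hl : 0 < l) : ‖nome τ l‖ < 1 := by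
  rw [nome, norm_exp, Real.exp_lt_one_iff]
  have : (Real.pi * I * τ * (l : ℂ)).re = -(Real.pi * τ.im * l) := by
    simp [mul_re, mul_im]
  rw [this]
  have := Real.pi_pos
  have : 0 < Real.pi * τ.im * l := by positivity
  linarith

theorem theta_refl (x q : ℂ) (hq : q ≠ 0) : theta (q / x) q = theta x q := by
  unfold theta
  rw [div_div_cancel₀ hq, mul_comm]

theorem qProd_step (a q : ℂ) (hq : ‖q‖ < 1) : qProd a q = (1 - a) * qProd (a * q) q := by
  have hs : Summable fun j : ℕ => ‖-(a * q ^ (j + 1))‖ := by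
    have h := (summable_geometric_of_lt_one (norm_nonneg q) hq).mul_left (‖a‖ * ‖q‖)
    refine h.congr fun j => ?_
    rw [norm_neg, norm_mul, norm_pow, pow_succ]
    ring
  have hm : Multipliable fun j : ℕ => (1 + -(a * q ^ (j + 1))) :=
    multipliable_one_add_of_summable hs
  have hm' : Multipliable fun j : ℕ => (1 - a * q ^ (j + 1)) :=
    hm.congr fun j => (sub_eq_add_neg _ _).symm
  have h1 := tprod_eq_zero_mul' (f := fun j : ℕ => (1 - a * q ^ j)) hm'
  have h2 : ∏' j : ℕ, (1 - a * q ^ (j + 1)) = ∏' j : ℕ, (1 - a * q * q ^ j) :=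
    tprod_congr fun j => by rw [pow_succ]; ring
  unfold qProd
  rw [h1, h2, pow_zero, mul_one]

theorem theta_inv (x q : ℂ) (hx : x ≠ 0) (hq : ‖q‖ < 1) :
    theta x⁻¹ q = -x⁻¹ * theta x q := by
  unfold theta
  rw [qProd_step x⁻¹ q hq, qProd_step x q hq]
  have h1 : q / x⁻¹ = x * q := by rw [div_inv_eq_mul, mul_comm]
  have h2 : q / x = x⁻¹ * q := by rw [div_eq_mul_inv, mul_comm]
  rw [h1, h2]
  field_simp
  ring

theorem nome_double (τ l : ℂ) : nome τ l * nome τ l = nome τ (2 * l) := by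
  unfold nome
  rw [← exp_add]
  congr 1
  ring

theorem hatSign_sq (σ : Label) : hatSign σ * hatSign σ = 1 := by
  cases σ <;> simp [hatSign]

/-- The factors of the product over `i < j` are symmetric in `i` and `j`. -/
theorem factor_symm (σ : Label) (τ x y : ℂ) (hτ : 0 < τ.im) (hx : x ≠ 0) (hy : y ≠ 0) :
    monom σ x y * entryDen σ τ x y = monom σ y x * entryDen σ τ y x := by
  have key : ∀ (e l r : ℂ), e * e = 1 → r ≠ 0 →
      theta (e * nome τ l * r) (nome τ (2 * l)) =
        theta (e * nome τ l * r⁻¹) (nome τ (2 * l)) := by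
    intro e l r he hr
    have he0 : e ≠ 0 := fun h => by simp [h] at he
    rw [← theta_refl (e * nome τ l * r) _ (nome_ne _ _), ← nome_double]
    congr 1
    have := nome_ne τ l
    field_simp
    rw [pow_two, he]
  have key2 : ∀ (l : ℝ) (r : ℂ), 0 < l → r ≠ 0 →
      theta (-r⁻¹) (nome τ l) = r⁻¹ * theta (-r) (nome τ l) := by
    intro l r hl hr
    have := theta_inv (-r) (nome τ l) (neg_ne_zero.mpr hr) (norm_nome_lt τ hτ l hl)
    rw [inv_neg, neg_neg] at this
    exact this
  have h13 : nome τ (2 / 3) = nome τ (2 * (1 / 3)) := by norm_num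
  have h3 : nome τ 6 = nome τ (2 * 3) := by norm_num
  have r2 : x ^ 2 / y ^ 2 ≠ 0 := by positivity
  have r6 : x ^ 6 / y ^ 6 ≠ 0 := by positivity
  have i2 : y ^ 2 / x ^ 2 = (x ^ 2 / y ^ 2)⁻¹ := by rw [inv_div]
  have i6 : y ^ 6 / x ^ 6 = (x ^ 6 / y ^ 6)⁻¹ := by rw [inv_div]
  have a6 := key2 6 _ (by norm_num) r6
  have a2 := key2 (2 / 3) _ (by norm_num) r2
  push_cast at a6 a2
  cases σ <;> simp only [monom, entryDen, one_mul, i2, i6]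
  all_goals first
    | (rw [h13]; exact key _ _ _ (hatSign_sq _) r2)
    | (rw [h3]; exact key _ _ _ (hatSign_sq _) r6)
    | (rw [a6]; field_simp)
    | (rw [a2]; field_simp)

/-- A product over `i < j` of a symmetric function splits into matched and unmatched pairs. -/
theorem prod_split {n : ℕ} (π : Equiv.Perm (Fin (2 * n)))
    (b : Fin (2 * n) → Fin (2 * n) → ℂ) (hb : ∀ i j, b i j = b j i) :
    ∏ e ∈ upperPairs (2 * n), b e.1 e.2 =
      (∏ k : Fin n, b (π (fstIdx k)) (π (sndIdx k))) * ∏ e ∈ unpaired π, b e.1 e.2 := by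
  rw [← Finset.prod_filter_mul_prod_filter_not (upperPairs (2 * n))
    (fun e => ∀ k : Fin n, s(π (fstIdx k), π (sndIdx k)) ≠ s(e.1, e.2)), mul_comm]
  congr 1
  symm
  have hne : ∀ k : Fin n, π (fstIdx k) ≠ π (sndIdx k) := by
    intro k h
    have := congrArg Fin.val (π.injective h)
    simp [fstIdx, sndIdx] at this
  refine Finset.prod_bij (fun k _ => if π (fstIdx k) < π (sndIdx k) then
    (π (fstIdx k), π (sndIdx k)) else (π (sndIdx k), π (fstIdx k))) ?_ ?_ ?_ ?_
  · intro k _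
    simp only [mem_filter, upperPairs, mem_univ, true_and, not_forall, not_not]
    split_ifs with h
    · exact ⟨h, k, rfl⟩
    · exact ⟨lt_of_le_of_ne (not_lt.mp h) (hne k).symm, k, Sym2.eq_swap⟩
  · intro k _ l _ h
    have hs : s(π (fstIdx k), π (sndIdx k)) = s(π (fstIdx l), π (sndIdx l)) := by
      have := congrArg (fun e : Fin (2 * n) × Fin (2 * n) => s(e.1, e.2)) h
      split_ifs at this <;> simp_all [Sym2.eq_swap]
    rw [Sym2.eq_iff] at hs
    rcases hs with ⟨h1, _⟩ | ⟨h1, _⟩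
    · have := congrArg Fin.val (π.injective h1)
      simp [fstIdx] at this
      ext; omega
    · have := congrArg Fin.val (π.injective h1)
      simp [fstIdx, sndIdx] at this
      omega
  · intro e he
    simp only [mem_filter, upperPairs, mem_univ, true_and, not_forall, not_not] at he
    obtain ⟨hlt, k, hk⟩ := he
    refine ⟨k, mem_univ _, ?_⟩
    rw [Sym2.eq_iff] at hk
    rcases hk with ⟨h1, h2⟩ | ⟨h1, h2⟩
    · rw [h1, h2, if_pos hlt]
    · rw [h1, h2, if_neg (not_lt.mpr hlt.le)]
  · intro k _
    split_ifs
    · rfl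
    · exact hb _ _

/-- Where no denominator vanishes, `P` is the product over `i < j` times the pfaffian. -/
theorem P_eq_PQuot {n : ℕ} (σ : Label) (z : Fin (2 * n) → ℂ) (τ : ℂ) (hτ : 0 < τ.im)
    (hd : ∀ i j, i ≠ j → entryDen σ τ (xvar (z i)) (xvar (z j)) ≠ 0) :
    P σ z τ = PQuot σ z τ := by
  have hne : ∀ (π : Equiv.Perm (Fin (2 * n))) (k : Fin n), π (fstIdx k) ≠ π (sndIdx k) := by
    intro π k h
    have := congrArg Fin.val (π.injective h)
    simp [fstIdx, sndIdx] at this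
  unfold P PQuot pfaffian
  rw [mul_left_comm]
  congr 1
  rw [Finset.mul_sum]
  refine Finset.sum_congr rfl fun π _ => ?_
  rw [prod_split π (fun i j => monom σ (xvar (z i)) (xvar (z j)) *
    entryDen σ τ (xvar (z i)) (xvar (z j)))
    (fun i j => factor_symm σ τ _ _ hτ (xvar_ne _) (xvar_ne _))]
  have : ∏ k : Fin n, monom σ (xvar (z (π (fstIdx k)))) (xvar (z (π (sndIdx k)))) *
          entryNum σ τ (xvar (z (π (fstIdx k)))) (xvar (z (π (sndIdx k)))) =
      (∏ k : Fin n, monom σ (xvar (z (π (fstIdx k)))) (xvar (z (π (sndIdx k)))) *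
          entryDen σ τ (xvar (z (π (fstIdx k)))) (xvar (z (π (sndIdx k))))) *
      ∏ k : Fin n, entryNum σ τ (xvar (z (π (fstIdx k)))) (xvar (z (π (sndIdx k)))) /
          entryDen σ τ (xvar (z (π (fstIdx k)))) (xvar (z (π (sndIdx k)))) := by
    rw [← Finset.prod_mul_distrib]
    refine Finset.prod_congr rfl fun k _ => ?_
    have := hd _ _ (hne π k)
    field_simp
  rw [this]
  simp only [Matrix.of_apply]
  ring

end

end EllipticPfaffian

open EllipticPfaffian

/-! Put b = m·d and c = m·a, as functions of z_i - z_j. Then b is even of degree three: a Jacobi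
theta function either in the cubes of the variables or with a third of the period. The odd function
c is a product of three Jacobi theta functions of period τ. The half period s in question carries b
to an odd function β and c to the numerator c' of the partner label, up to exponential factors.
There is a ξ of order three modulo the periods (2/3 or 2τ/3) such that b and β are eigenfunctions of
the shift by ξ, with a common factor μ. The sum over the three ξ-translates, weighted by μ,
annihilates c and c' (`ThetaFrame.three_term`).

By expansion along the first row, the pfaffian as a function of t = z_1 is a combination of products
with one factor c(t - z_p) and all others b(t - z_k), so it inherits the three-term relation. Such a
function D is rigid (`eq_zero_of_three_term`): if it vanishes at v_i and v_i + ξ, the relation makes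
it vanish at all v_i + kξ. If these are, modulo the periods, all the zeros of an eigenfunction Φ
with the same multipliers, then D = KΦ by Liouville, and the relation becomes 3K = 0.

This is applied to the difference of the two sides, with Φ = ∏ β(t - z_i). At t = z_i both sides
vanish. At t = z_i + ξ the shifted pfaffian loses a pair of variables, because b(s + ξ) = 0. The
unshifted one is governed by `PairData.diffPf_add_ξ`, an evaluation at z_1 = z_2 + ξ that turns a
pfaffian of c' into a pfaffian of c in two variables fewer; it is proved by induction, with the same
rigidity in a third variable. Agreement of the two values forces B = B₀ B₁ A c'(ξ) / (A' c(ξ)), and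
what remains is to evaluate Jacobi theta functions at ξ. Vanishing denominators and special
positions of the variables are reached by continuity. -/

namespace EllipticPfaffian

noncomputable section

/-! ### Expansion of pfaffians along the first row -/

/-- The pfaffian of `C / B` times the product of `B` over `i < j`, with cancelled denominators. -/
def pfProd (n : ℕ) (B C : Fin (2 * n) → Fin (2 * n) → ℂ) : ℂ :=
  1 / ((2 : ℂ) ^ n * (n.factorial : ℂ)) *
    ∑ π : Equiv.Perm (Fin (2 * n)), ((Equiv.Perm.sign π : ℤ) : ℂ) *
      (∏ k : Fin n, C (π (fstIdx k)) (π (sndIdx k))) * ∏ e ∈ unpaired π, B e.1 e.2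

/-- The increasing enumeration, up to a transposition, of the indices other than `0` and `p + 1`. -/
def skipIdx {n : ℕ} (p : Fin (2 * n + 1)) (k : Fin (2 * n)) : Fin (2 * (n + 1)) :=
  Fin.succ (Equiv.swap 0 p k.succ)

/-- The summand of the pfaffian that belongs to a permutation. -/
def pfTerm {n : ℕ} (M : Fin (2 * n) → Fin (2 * n) → ℂ) (π : Equiv.Perm (Fin (2 * n))) : ℂ :=
  ((Equiv.Perm.sign π : ℤ) : ℂ) * ∏ k : Fin n, M (π (fstIdx k)) (π (sndIdx k))

theorem fstIdx_injective {n : ℕ} : Function.Injective (fstIdx (n := n)) := by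
  intro k l h
  have := congrArg Fin.val h
  simp only [fstIdx] at this
  ext; omega

theorem sndIdx_injective {n : ℕ} : Function.Injective (sndIdx (n := n)) := by
  intro k l h
  have := congrArg Fin.val h
  simp only [sndIdx] at this
  ext; omega

theorem fstIdx_ne_sndIdx {n : ℕ} (k l : Fin n) : fstIdx k ≠ sndIdx l := by
  intro h
  have := congrArg Fin.val h
  simp only [fstIdx, sndIdx] at this
  omega

/-- The permutation that exchanges the pairs `k` and `l`. -/
def pairSwap {n : ℕ} (k l : Fin n) : Equiv.Perm (Fin (2 * n)) :=
  Equiv.swap (fstIdx k) (fstIdx l) * Equiv.swap (sndIdx k) (sndIdx l)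

theorem pairSwap_fst {n : ℕ} (k l m : Fin n) :
    pairSwap k l (fstIdx m) = fstIdx (Equiv.swap k l m) := by
  rw [pairSwap, Equiv.Perm.mul_apply, Equiv.swap_apply_of_ne_of_ne (fstIdx_ne_sndIdx _ _)
    (fstIdx_ne_sndIdx _ _), fstIdx_injective.swap_apply]

theorem pairSwap_snd {n : ℕ} (k l m : Fin n) :
    pairSwap k l (sndIdx m) = sndIdx (Equiv.swap k l m) := by
  rw [pairSwap, Equiv.Perm.mul_apply, sndIdx_injective.swap_apply,
    Equiv.swap_apply_of_ne_of_ne (fstIdx_ne_sndIdx _ _).symm (fstIdx_ne_sndIdx _ _).symm]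

theorem sign_pairSwap {n : ℕ} (k l : Fin n) : Equiv.Perm.sign (pairSwap k l) = 1 := by
  by_cases h : k = l
  · subst h
    simp [pairSwap]
  · rw [pairSwap, Equiv.Perm.sign_mul, Equiv.Perm.sign_swap (fstIdx_injective.ne h),
      Equiv.Perm.sign_swap (sndIdx_injective.ne h)]
    rfl

theorem pfTerm_mul_pairSwap {n : ℕ} (M : Fin (2 * n) → Fin (2 * n) → ℂ)
    (π : Equiv.Perm (Fin (2 * n))) (k l : Fin n) :
    pfTerm M (π * pairSwap k l) = pfTerm M π := by
  unfold pfTerm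
  rw [Equiv.Perm.sign_mul, sign_pairSwap, mul_one]
  congr 1
  simp only [Equiv.Perm.mul_apply, pairSwap_fst, pairSwap_snd]
  exact Equiv.prod_comp (Equiv.swap k l) fun m => M (π (fstIdx m)) (π (sndIdx m))

theorem pfTerm_mul_swap {n : ℕ} (M : Fin (2 * n) → Fin (2 * n) → ℂ)
    (hM : ∀ i j, M i j = -M j i) (π : Equiv.Perm (Fin (2 * n))) (k : Fin n) :
    pfTerm M (π * Equiv.swap (fstIdx k) (sndIdx k)) = pfTerm M π := by
  unfold pfTerm
  rw [Equiv.Perm.sign_mul, Equiv.Perm.sign_swap (fstIdx_ne_sndIdx k k)]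
  rw [← Finset.mul_prod_erase _ _ (mem_univ k), ← Finset.mul_prod_erase _ _ (mem_univ k)]
  have : ∏ x ∈ univ.erase k, M ((π * Equiv.swap (fstIdx k) (sndIdx k)) (fstIdx x))
        ((π * Equiv.swap (fstIdx k) (sndIdx k)) (sndIdx x)) =
      ∏ x ∈ univ.erase k, M (π (fstIdx x)) (π (sndIdx x)) := by
    refine Finset.prod_congr rfl fun x hx => ?_
    have hx := ne_of_mem_erase hx
    rw [Equiv.Perm.mul_apply, Equiv.Perm.mul_apply,
      Equiv.swap_apply_of_ne_of_ne (fstIdx_injective.ne hx) (fstIdx_ne_sndIdx _ _),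
      Equiv.swap_apply_of_ne_of_ne (fstIdx_ne_sndIdx _ _).symm (sndIdx_injective.ne hx)]
  rw [this, Equiv.Perm.mul_apply, Equiv.Perm.mul_apply, Equiv.swap_apply_left,
    Equiv.swap_apply_right, hM]
  push_cast
  ring

/-- Exchanging two pairs and flipping one pair both preserve the terms of the pfaffian, and together
they act transitively on positions. -/
theorem exists_pfTerm_invariant {n : ℕ} (M : Fin (2 * n) → Fin (2 * n) → ℂ)
    (hM : ∀ i j, M i j = -M j i) (k₀ : Fin n) (i : Fin (2 * n)) :
    ∃ γ : Equiv.Perm (Fin (2 * n)), γ (fstIdx k₀) = i ∧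
      ∀ π, pfTerm M (π * γ) = pfTerm M π := by
  have hi : i.1 / 2 < n := by omega
  rcases Nat.mod_two_eq_zero_or_one i.1 with h | h
  · have : i = fstIdx ⟨i.1 / 2, hi⟩ := by
      ext; simp only [fstIdx]; omega
    refine ⟨pairSwap k₀ ⟨i.1 / 2, hi⟩, ?_, fun π => pfTerm_mul_pairSwap M π _ _⟩
    rw [pairSwap_fst, Equiv.swap_apply_left, ← this]
  · have : i = sndIdx ⟨i.1 / 2, hi⟩ := by
      ext; simp only [sndIdx]; omega
    refine ⟨pairSwap k₀ ⟨i.1 / 2, hi⟩ * Equiv.swap (fstIdx k₀) (sndIdx k₀), ?_, fun π => ?_⟩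
    · rw [Equiv.Perm.mul_apply, Equiv.swap_apply_left, pairSwap_snd, Equiv.swap_apply_left, ← this]
    · rw [← mul_assoc, pfTerm_mul_swap M hM, pfTerm_mul_pairSwap]

/-- Sort the permutations by the position of the index `fstIdx k₀`. By `exists_pfTerm_invariant` all
2n classes contribute equally. -/
theorem sum_pfTerm_eq {n : ℕ} (M : Fin (2 * n) → Fin (2 * n) → ℂ)
    (hM : ∀ i j, M i j = -M j i) (k₀ : Fin n) :
    ∑ π, pfTerm M π = (2 * n : ℕ) * ∑ π, if π (fstIdx k₀) = fstIdx k₀ then pfTerm M π else 0 := by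
  have h1 : ∀ π : Equiv.Perm (Fin (2 * n)),
      pfTerm M π = ∑ i, if π i = fstIdx k₀ then pfTerm M π else 0 := by
    intro π
    rw [Finset.sum_eq_single (π.symm (fstIdx k₀))]
    · simp
    · intro i _ hi
      rw [if_neg]
      rintro h
      exact hi (by rw [← h]; simp)
    · simp
  rw [Finset.sum_congr rfl fun π _ => h1 π, Finset.sum_comm]
  have h2 : ∀ i : Fin (2 * n), (∑ π : Equiv.Perm (Fin (2 * n)),
      if π i = fstIdx k₀ then pfTerm M π else 0) =
      ∑ π, if π (fstIdx k₀) = fstIdx k₀ then pfTerm M π else 0 := by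
    intro i
    obtain ⟨γ, hγ, hinv⟩ := exists_pfTerm_invariant M hM k₀ i
    rw [← Equiv.sum_comp (Equiv.mulRight γ)
      (fun π => if π (fstIdx k₀) = fstIdx k₀ then pfTerm M π else 0)]
    refine Finset.sum_congr rfl fun π _ => ?_
    simp only [Equiv.coe_mulRight, Equiv.Perm.mul_apply, hγ, hinv]
  rw [Finset.sum_congr rfl fun i _ => h2 i]
  simp

theorem pfaffian_eq_sum_pfTerm {n : ℕ} (M : Fin (2 * n) → Fin (2 * n) → ℂ) :
    pfaffian (Matrix.of M) = 1 / ((2 : ℂ) ^ n * (n.factorial : ℂ)) * ∑ π, pfTerm M π := rfl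

/-- A permutation with 0 ↦ 0 and 1 ↦ p + 1 amounts to a permutation of the other 2n indices.
Enumerating these by `skipIdx` costs the sign of the transposition of 0 and p. -/
theorem pfTerm_decomposeFin {n : ℕ} (M : Fin (2 * (n + 1)) → Fin (2 * (n + 1)) → ℂ)
    (p : Fin (2 * n + 1)) (e : Equiv.Perm (Fin (2 * n))) :
    pfTerm M (Equiv.Perm.decomposeFin.symm
        ((0 : Fin (2 * n + 1 + 1)), Equiv.Perm.decomposeFin.symm (p, e))) =
      ((Equiv.Perm.sign (Equiv.swap 0 p) : ℤ) : ℂ) * M 0 p.succ *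
        pfTerm (fun i j => M (skipIdx p i) (skipIdx p j)) e := by
  unfold pfTerm
  rw [Fin.prod_univ_succ]
  have h0 : fstIdx (0 : Fin (n + 1)) = (0 : Fin (2 * n + 1 + 1)) := rfl
  have h1 : sndIdx (0 : Fin (n + 1)) = (0 : Fin (2 * n + 1)).succ := rfl
  have h2 : ∀ k : Fin n, fstIdx k.succ = ((fstIdx k).succ : Fin (2 * n + 1)).succ := fun k => by
    ext; simp [fstIdx]; ring
  have h3 : ∀ k : Fin n, sndIdx k.succ = ((sndIdx k).succ : Fin (2 * n + 1)).succ := fun k => by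
    ext; simp [sndIdx]; ring
  simp only [h0, h1, h2, h3]
  rw [show Equiv.Perm.sign (Equiv.Perm.decomposeFin.symm
      ((0 : Fin (2 * n + 1 + 1)), Equiv.Perm.decomposeFin.symm (p, e))) =
      Equiv.Perm.sign (Equiv.swap 0 p) * Equiv.Perm.sign e by
    rw [Equiv.Perm.decomposeFin.symm_sign, Equiv.Perm.decomposeFin.symm_sign, if_pos rfl, one_mul]
    congr 1
    split_ifs with h
    · simp [← h]
    · rw [Equiv.Perm.sign_swap (Ne.symm h)]]
  have hs : ∀ k : Fin (2 * n + 1), Equiv.Perm.decomposeFin.symm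
      ((0 : Fin (2 * n + 1 + 1)), Equiv.Perm.decomposeFin.symm (p, e)) k.succ =
      Fin.succ (Equiv.Perm.decomposeFin.symm (p, e) k) := fun k => by
    rw [Equiv.Perm.decomposeFin_symm_apply_succ, Equiv.swap_self, Equiv.refl_apply]
  have hp : ∀ k : Fin (2 * n), Fin.succ (Equiv.Perm.decomposeFin.symm (p, e) k.succ) =
      skipIdx p (e k) := fun k => by
    rw [Equiv.Perm.decomposeFin_symm_apply_succ]
    rfl
  rw [hs, Equiv.Perm.decomposeFin_symm_apply_zero, Equiv.Perm.decomposeFin_symm_apply_zero]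
  simp only [hs, hp]
  push_cast
  ring

theorem pfaffian_succ {n : ℕ} (M : Fin (2 * (n + 1)) → Fin (2 * (n + 1)) → ℂ)
    (hM : ∀ i j, M i j = -M j i) :
    pfaffian (n := n + 1) (Matrix.of M) = ∑ p : Fin (2 * n + 1),
      ((Equiv.Perm.sign (Equiv.swap 0 p) : ℤ) : ℂ) * M 0 p.succ *
        pfaffian (n := n) (Matrix.of fun i j => M (skipIdx p i) (skipIdx p j)) := by
  simp only [pfaffian_eq_sum_pfTerm]
  rw [sum_pfTerm_eq M hM 0]
  have key : (∑ π : Equiv.Perm (Fin (2 * (n + 1))),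
      if π (fstIdx 0) = fstIdx 0 then pfTerm M π else 0) =
      ∑ p : Fin (2 * n + 1), ∑ e : Equiv.Perm (Fin (2 * n)),
        ((Equiv.Perm.sign (Equiv.swap 0 p) : ℤ) : ℂ) * M 0 p.succ *
        pfTerm (fun i j => M (skipIdx p i) (skipIdx p j)) e := by
    have e1 := Equiv.sum_comp (Equiv.Perm.decomposeFin (n := 2 * n + 1)).symm
      (fun π : Equiv.Perm (Fin (2 * (n + 1))) =>
        if π (fstIdx 0) = fstIdx 0 then pfTerm M π else 0)
    refine e1.symm.trans ?_
    -- The first component in `decomposeFin` is the image of 0, so the condition selects the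
    -- component 0.
    rw [Fintype.sum_prod_type, Finset.sum_eq_single 0]
    · rw [← Equiv.sum_comp (Equiv.Perm.decomposeFin (n := 2 * n)).symm, Fintype.sum_prod_type]
      refine Finset.sum_congr rfl fun p _ => Finset.sum_congr rfl fun e _ => ?_
      rw [if_pos, pfTerm_decomposeFin]
      exact Equiv.Perm.decomposeFin_symm_apply_zero _ _
    · intro q _ hq
      refine Finset.sum_eq_zero fun e _ => if_neg ?_
      intro h
      exact hq ((Equiv.Perm.decomposeFin_symm_apply_zero q e).symm.trans h)
    · simp
  rw [key, Finset.mul_sum, Finset.mul_sum]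
  refine Finset.sum_congr rfl fun p _ => ?_
  -- The factor 2(n + 1) from `sum_pfTerm_eq` reduces the prefactor for n + 1 to the one for n.
  rw [← Finset.mul_sum, Nat.factorial_succ]
  have : (n.factorial : ℂ) ≠ 0 := by exact_mod_cast n.factorial_ne_zero
  have : (n : ℂ) + 1 ≠ 0 := by exact_mod_cast n.succ_ne_zero
  push_cast
  field_simp
  ring

/-! ### Pfaffians with cancelled denominators -/

theorem prod_upperPairs_succ (m : ℕ) (b : Fin (m + 1) → Fin (m + 1) → ℂ) :
    ∏ e ∈ upperPairs (m + 1), b e.1 e.2 =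
      (∏ j : Fin m, b 0 j.succ) * ∏ e ∈ upperPairs m, b e.1.succ e.2.succ := by
  have h : ∀ (k : ℕ) (f : Fin k → Fin k → ℂ),
      ∏ e ∈ upperPairs k, f e.1 e.2 = ∏ i, ∏ j, if i < j then f i j else 1 := fun k f => by
    rw [upperPairs, Finset.prod_filter, Fintype.prod_prod_type]
  rw [h, h m fun i j => b i.succ j.succ, Fin.prod_univ_succ]
  congr 1
  · rw [Fin.prod_univ_succ]
    simp
  · refine Finset.prod_congr rfl fun i _ => ?_
    rw [Fin.prod_univ_succ]
    simp

theorem prod_upperPairs_comp {m : ℕ} (b : Fin m → Fin m → ℂ) (hb : ∀ i j, b i j = b j i)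
    (π : Equiv.Perm (Fin m)) :
    ∏ e ∈ upperPairs m, b (π e.1) (π e.2) = ∏ e ∈ upperPairs m, b e.1 e.2 := by
  have hmem : ∀ (σ : Equiv.Perm (Fin m)) (e : Fin m × Fin m), e ∈ upperPairs m →
      (if σ e.1 < σ e.2 then (σ e.1, σ e.2) else (σ e.2, σ e.1)) ∈ upperPairs m := by
    intro σ e he
    simp only [upperPairs, mem_filter, mem_univ, true_and] at he ⊢
    split_ifs with h
    · exact h
    · exact lt_of_le_of_ne (not_lt.mp h) (σ.injective.ne he.ne').symm.symm
  have hinv : ∀ (σ : Equiv.Perm (Fin m)) (e : Fin m × Fin m), e ∈ upperPairs m →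
      (fun e : Fin m × Fin m =>
        if σ.symm e.1 < σ.symm e.2 then (σ.symm e.1, σ.symm e.2) else (σ.symm e.2, σ.symm e.1))
      (if σ e.1 < σ e.2 then (σ e.1, σ e.2) else (σ e.2, σ e.1)) = e := by
    intro σ e he
    simp only [upperPairs, mem_filter, mem_univ, true_and] at he
    by_cases h : σ e.1 < σ e.2
    · simp [h, he]
    · simp [h, not_lt.mpr he.le]
  refine Finset.prod_bij' (fun e _ => if π e.1 < π e.2 then (π e.1, π e.2) else (π e.2, π e.1))
    (fun e _ => if π.symm e.1 < π.symm e.2 then (π.symm e.1, π.symm e.2)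
      else (π.symm e.2, π.symm e.1)) (hmem π) (hmem π.symm) (hinv π) (hinv π.symm) ?_
  intro e _
  split_ifs
  · rfl
  · exact hb _ _

theorem pfProd_eq_prod_mul_pfaffian {n : ℕ} (B C : Fin (2 * n) → Fin (2 * n) → ℂ)
    (hB : ∀ i j, B i j = B j i) (hd : ∀ i j, i ≠ j → B i j ≠ 0) :
    pfProd n B C = (∏ e ∈ upperPairs (2 * n), B e.1 e.2) *
      pfaffian (Matrix.of fun i j => C i j / B i j) := by
  unfold pfProd pfaffian
  rw [mul_left_comm]
  congr 1
  rw [Finset.mul_sum]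
  refine Finset.sum_congr rfl fun π _ => ?_
  rw [prod_split π B hB]
  have : ∏ k : Fin n, C (π (fstIdx k)) (π (sndIdx k)) =
      (∏ k : Fin n, B (π (fstIdx k)) (π (sndIdx k))) *
      ∏ k : Fin n, C (π (fstIdx k)) (π (sndIdx k)) / B (π (fstIdx k)) (π (sndIdx k)) := by
    rw [← Finset.prod_mul_distrib]
    refine Finset.prod_congr rfl fun k _ => ?_
    rw [mul_div_cancel₀ _ (hd _ _ (π.injective.ne (fstIdx_ne_sndIdx k k)))]
  rw [this]
  simp only [Matrix.of_apply]
  ring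

theorem continuous_pfProd {X : Type*} [TopologicalSpace X] {n : ℕ}
    {B C : X → Fin (2 * n) → Fin (2 * n) → ℂ} (hB : ∀ i j, Continuous fun t => B t i j)
    (hC : ∀ i j, Continuous fun t => C t i j) : Continuous fun t => pfProd n (B t) (C t) := by
  unfold pfProd
  refine continuous_const.mul (continuous_finsetSum _ fun π _ => ?_)
  exact (continuous_const.mul (continuous_finsetProd _ fun k _ => hC _ _)).mul
    (continuous_finsetProd _ fun e _ => hB _ _)

/-- An identity between continuous functions of a symmetric matrix holds as soon as it holds for
matrices without vanishing entries. -/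
theorem eq_of_eq_of_ne_zero {N : ℕ} {F G : (Fin N → Fin N → ℂ) → ℂ} (hF : Continuous F)
    (hG : Continuous G) (h : ∀ B : Fin N → Fin N → ℂ, (∀ i j, B i j = B j i) →
      (∀ i j, B i j ≠ 0) → F B = G B)
    (B : Fin N → Fin N → ℂ) (hB : ∀ i j, B i j = B j i) : F B = G B := by
  -- Adding one constant t to all entries keeps the symmetry, and only finitely many t create a zero
  -- entry. The case t = 0 is then a limit.
  have hc : Continuous fun t : ℂ => fun i j => B i j + t := by fun_prop
  have hfin : (Set.range fun e : Fin N × Fin N => -B e.1 e.2).Countable :=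
    (Set.finite_range _).countable
  have key := Continuous.ext_on (hfin.dense_compl ℂ) (hF.comp hc) (hG.comp hc) fun t ht => by
    refine h _ (fun i j => congrArg (· + t) (hB i j)) fun i j h0 => ht ⟨(i, j), ?_⟩
    simp only
    linear_combination -h0
  simpa using congrFun key 0

theorem pfaffian_comp {n : ℕ} (M : Fin (2 * n) → Fin (2 * n) → ℂ)
    (σ : Equiv.Perm (Fin (2 * n))) :
    pfaffian (Matrix.of fun i j => M (σ i) (σ j)) =
      ((Equiv.Perm.sign σ : ℤ) : ℂ) * pfaffian (Matrix.of M) := by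
  rw [pfaffian_eq_sum_pfTerm, pfaffian_eq_sum_pfTerm, mul_left_comm,
    Finset.mul_sum (f := fun π => pfTerm M π) (a := ((Equiv.Perm.sign σ : ℤ) : ℂ)),
    ← Equiv.sum_comp (Equiv.mulLeft σ) (fun π => ((Equiv.Perm.sign σ : ℤ) : ℂ) * pfTerm M π)]
  congr 1
  refine Finset.sum_congr rfl fun π _ => ?_
  simp only [pfTerm, Equiv.coe_mulLeft, Equiv.Perm.sign_mul, Equiv.Perm.mul_apply]
  have : ((Equiv.Perm.sign σ : ℤ) : ℂ) * ((Equiv.Perm.sign σ : ℤ) : ℂ) = 1 := by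
    rw [← Int.cast_mul, Int.units_coe_mul_self, Int.cast_one]
  push_cast
  linear_combination -(((Equiv.Perm.sign π : ℤ) : ℂ) *
    ∏ k : Fin n, M (σ (π (fstIdx k))) (σ (π (sndIdx k)))) * this

/-- Without zeros in B this combines the invariance of the product with the antisymmetry of the
pfaffian; density gives the rest and avoids tracking `unpaired` under σ. -/
theorem pfProd_comp {n : ℕ} (B C : Fin (2 * n) → Fin (2 * n) → ℂ)
    (hB : ∀ i j, B i j = B j i) (σ : Equiv.Perm (Fin (2 * n))) :
    pfProd n (fun i j => B (σ i) (σ j)) (fun i j => C (σ i) (σ j)) =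
      ((Equiv.Perm.sign σ : ℤ) : ℂ) * pfProd n B C := by
  refine eq_of_eq_of_ne_zero (F := fun B => pfProd n (fun i j => B (σ i) (σ j))
    (fun i j => C (σ i) (σ j))) (G := fun B => ((Equiv.Perm.sign σ : ℤ) : ℂ) * pfProd n B C)
    ?_ ?_ ?_ B hB
  · exact continuous_pfProd (fun i j => by fun_prop) fun i j => by fun_prop
  · exact continuous_const.mul (continuous_pfProd (fun i j => by fun_prop) fun i j => by fun_prop)
  · intro B hB h0
    rw [pfProd_eq_prod_mul_pfaffian _ _ (fun i j => hB _ _) (fun i j _ => h0 _ _),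
      pfProd_eq_prod_mul_pfaffian _ _ hB (fun i j _ => h0 _ _), prod_upperPairs_comp B hB,
      pfaffian_comp (fun i j => C i j / B i j)]
    ring

/-- The pairs are sorted by how many of 0 and p + 1 they contain: both, one or none. The first
factor is the denominator that cancels in the p-th term of the expansion. -/
theorem prod_upperPairs_eq_skipIdx {n : ℕ} (b : Fin (2 * (n + 1)) → Fin (2 * (n + 1)) → ℂ)
    (hb : ∀ i j, b i j = b j i) (p : Fin (2 * n + 1)) :
    ∏ e ∈ upperPairs (2 * (n + 1)), b e.1 e.2 =
      b 0 p.succ * (∏ k, b 0 (skipIdx p k) * b p.succ (skipIdx p k)) *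
        ∏ e ∈ upperPairs (2 * n), b (skipIdx p e.1) (skipIdx p e.2) := by
  have h1 := prod_upperPairs_succ (2 * n + 1) b
  have h2 := prod_upperPairs_comp (fun i j : Fin (2 * n + 1) => b i.succ j.succ)
    (fun i j => hb _ _) (Equiv.swap 0 p)
  have h3 := prod_upperPairs_succ (2 * n)
    (fun i j => b (Equiv.swap 0 p i).succ (Equiv.swap 0 p j).succ)
  have h4 := Equiv.prod_comp (Equiv.swap 0 p) fun j : Fin (2 * n + 1) => b 0 j.succ
  rw [Fin.prod_univ_succ] at h4
  refine h1.trans ?_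
  rw [← h4, ← h2]
  refine (congrArg _ h3).trans ?_
  rw [Equiv.swap_apply_left, Finset.prod_mul_distrib]
  simp only [skipIdx]
  ring

theorem pfProd_succ {n : ℕ} (B C : Fin (2 * (n + 1)) → Fin (2 * (n + 1)) → ℂ)
    (hB : ∀ i j, B i j = B j i) (hC : ∀ i j, C i j = -C j i) :
    pfProd (n + 1) B C = ∑ p : Fin (2 * n + 1),
      ((Equiv.Perm.sign (Equiv.swap 0 p) : ℤ) : ℂ) * C 0 p.succ *
        (∏ k, B 0 (skipIdx p k) * B p.succ (skipIdx p k)) *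
        pfProd n (fun i j => B (skipIdx p i) (skipIdx p j))
          (fun i j => C (skipIdx p i) (skipIdx p j)) := by
  refine eq_of_eq_of_ne_zero (F := fun B => pfProd (n + 1) B C)
    (G := fun B => ∑ p : Fin (2 * n + 1),
      ((Equiv.Perm.sign (Equiv.swap 0 p) : ℤ) : ℂ) * C 0 p.succ *
        (∏ k, B 0 (skipIdx p k) * B p.succ (skipIdx p k)) *
        pfProd n (fun i j => B (skipIdx p i) (skipIdx p j))
          (fun i j => C (skipIdx p i) (skipIdx p j))) ?_ ?_ ?_ B hB
  · exact continuous_pfProd (fun i j => by fun_prop) fun i j => by fun_prop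
  · refine continuous_finsetSum _ fun p _ => Continuous.mul (by fun_prop) ?_
    exact continuous_pfProd (fun i j => by fun_prop) fun i j => by fun_prop
  · intro B hB h0
    rw [pfProd_eq_prod_mul_pfaffian _ _ hB (fun i j _ => h0 _ _), pfaffian_succ, Finset.mul_sum]
    · refine Finset.sum_congr rfl fun p _ => ?_
      rw [pfProd_eq_prod_mul_pfaffian _ _ (fun i j => hB _ _) (fun i j _ => h0 _ _),
        prod_upperPairs_eq_skipIdx B hB p]
      have := h0 0 p.succ
      field_simp
    · intro i j
      rw [hC, hB, neg_div]

/-! ### Entire functions with theta multipliers -/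

open Filter Topology in
/-- A quotient of entire functions is entire if the denominator has simple zeros only and the
numerator vanishes there. -/
theorem exists_differentiable_quotient {f g : ℂ → ℂ} (hf : Differentiable ℂ f)
    (hg : Differentiable ℂ g) (hs : ∀ z, g z = 0 → deriv g z ≠ 0) (hz : ∀ z, g z = 0 → f z = 0) :
    ∃ h : ℂ → ℂ, Differentiable ℂ h ∧ ∀ z, f z = h z * g z := by
  classical
  -- At a zero of g the quotient receives its limit f'/g'. Near such a point it equals the quotient
  -- of the two divided differences.
  refine ⟨fun z => if g z = 0 then deriv f z / deriv g z else f z / g z, fun w => ?_, fun z => ?_⟩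
  · by_cases hw : g w = 0
    · have hdf : Differentiable ℂ (dslope f w) := differentiableOn_univ.mp
        ((Complex.differentiableOn_dslope univ_mem).mpr hf.differentiableOn)
      have hdg : Differentiable ℂ (dslope g w) := differentiableOn_univ.mp
        ((Complex.differentiableOn_dslope univ_mem).mpr hg.differentiableOn)
      have h0 : dslope g w w ≠ 0 := by rw [dslope_same]; exact hs w hw
      have hev : ∀ᶠ z in 𝓝 w, dslope g w z ≠ 0 := hdg.continuous.continuousAt.eventually_ne h0
      refine DifferentiableAt.congr_of_eventuallyEq ((hdf w).div (hdg w) h0) ?_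
      filter_upwards [hev] with z hzne
      by_cases hzw : z = w
      · subst hzw
        simp [hw, dslope_same]
      · have hsub : z - w ≠ 0 := sub_ne_zero.mpr hzw
        have e1 : dslope f w z = f z / (z - w) := by
          rw [dslope_of_ne _ hzw, slope_def_field, hz w hw, sub_zero]
        have e2 : dslope g w z = g z / (z - w) := by
          rw [dslope_of_ne _ hzw, slope_def_field, hw, sub_zero]
        have hgz : g z ≠ 0 := fun h => hzne (by rw [e2, h, zero_div])
        simp only [Pi.div_apply]
        rw [if_neg hgz, e1, e2]
        field_simp
    · have hev : ∀ᶠ z in 𝓝 w, g z ≠ 0 := hg.continuous.continuousAt.eventually_ne hw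
      refine DifferentiableAt.congr_of_eventuallyEq ((hf w).div (hg w) hw) ?_
      filter_upwards [hev] with z hzne
      simp [hzne]
  · by_cases h : g z = 0
    · simp [h, hz z h]
    · simp [h]

/-- An entire function whose absolute value is doubly periodic is constant. -/
theorem eq_const_of_norm_periodic {h : ℂ → ℂ} (hh : Differentiable ℂ h) {τ : ℂ} (hτ : 0 < τ.im)
    (h1 : Function.Periodic (fun z => ‖h z‖) 1) (h2 : Function.Periodic (fun z => ‖h z‖) τ)
    (z w : ℂ) : h z = h w := by
  refine hh.apply_eq_apply_of_bounded ?_ z w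
  -- Liouville: the values on the compact period parallelogram bound the function everywhere.
  have hK : IsCompact ((fun a : ℝ × ℝ => (a.1 : ℂ) + a.2 * τ) ''
      (Set.Icc (0 : ℝ) 1 ×ˢ Set.Icc (0 : ℝ) 1)) :=
    (isCompact_Icc.prod isCompact_Icc).image (by fun_prop)
  obtain ⟨C, hC⟩ := hK.exists_bound_of_continuousOn hh.continuous.continuousOn
  refine isBounded_iff_forall_norm_le.mpr ⟨C, ?_⟩
  rintro _ ⟨z, rfl⟩
  set b : ℝ := z.im / τ.im
  set a : ℝ := z.re - b * τ.re
  have hz : z = (Int.fract a + Int.fract b * τ) + (⌊a⌋ : ℤ) * 1 + (⌊b⌋ : ℤ) * τ := by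
    have ha : (a : ℂ) = ((⌊a⌋ : ℤ) : ℂ) + (Int.fract a : ℝ) := by
      exact_mod_cast (Int.floor_add_fract a).symm
    have hb : (b : ℂ) = ((⌊b⌋ : ℤ) : ℂ) + (Int.fract b : ℝ) := by
      exact_mod_cast (Int.floor_add_fract b).symm
    have : z = a + b * τ := by
      apply Complex.ext
      · simp [a]
      · simp [b, hτ.ne']
    rw [this, ha, hb]
    ring
  have e2 := (h2.int_mul ⌊b⌋) ((Int.fract a + Int.fract b * τ) + (⌊a⌋ : ℤ) * 1)
  have e1 := (h1.int_mul ⌊a⌋) (Int.fract a + Int.fract b * τ)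
  rw [hz]
  refine (e2.trans e1).trans_le (hC _ ⟨(Int.fract a, Int.fract b), ?_, rfl⟩)
  exact ⟨⟨Int.fract_nonneg _, (Int.fract_lt_one _).le⟩,
    ⟨Int.fract_nonneg _, (Int.fract_lt_one _).le⟩⟩

open Filter Topology in
/-- Two entire functions with the same multipliers, up to constants of modulus one, for the periods
`1` and `τ` are proportional if the zeros of the second are simple and zeros of the first. -/
theorem exists_eq_const_mul {f g N₁ N₂ : ℂ → ℂ} {τ a₁ a₂ b₁ b₂ : ℂ} (hτ : 0 < τ.im)
    (hf : Differentiable ℂ f) (hg : Differentiable ℂ g) (hs : ∀ z, g z = 0 → deriv g z ≠ 0)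
    (hz : ∀ z, g z = 0 → f z = 0) (hN₁ : ∀ z, N₁ z ≠ 0) (hN₂ : ∀ z, N₂ z ≠ 0)
    (ha₁ : ‖a₁‖ = 1) (ha₂ : ‖a₂‖ = 1) (hb₁ : ‖b₁‖ = 1) (hb₂ : ‖b₂‖ = 1)
    (hf₁ : ∀ z, f (z + 1) = a₁ * N₁ z * f z) (hf₂ : ∀ z, f (z + τ) = a₂ * N₂ z * f z)
    (hg₁ : ∀ z, g (z + 1) = b₁ * N₁ z * g z) (hg₂ : ∀ z, g (z + τ) = b₂ * N₂ z * g z) :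
    ∃ K : ℂ, ∀ z, f z = K * g z := by
  obtain ⟨h, hh, hfg⟩ := exists_differentiable_quotient hf hg hs hz
  -- Simple zeros are isolated, so relations for the quotient h may be checked off the zeros of g.
  have hdense : Dense {z | g z ≠ 0} := by
    intro z
    by_cases h0 : g z = 0
    · have hev : ∀ᶠ w in 𝓝[≠] z, g w ≠ 0 :=
        (hg z).hasDerivAt.eventually_ne (hs z h0)
      exact mem_closure_of_frequently_of_tendsto hev.frequently
        (tendsto_id.mono_left nhdsWithin_le_nhds)
    · exact subset_closure h0
  -- The multipliers of f and g differ by a constant of modulus one, so that |h| is periodic even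
  -- where h is not.
  have hper : ∀ (ω a b : ℂ) (N : ℂ → ℂ), ‖a‖ = 1 → ‖b‖ = 1 → (∀ z, N z ≠ 0) →
      (∀ z, f (z + ω) = a * N z * f z) → (∀ z, g (z + ω) = b * N z * g z) →
      Function.Periodic (fun z => ‖h z‖) ω := by
    intro ω a b N ha hb hN hfω hgω
    have hc := hh.continuous
    have := Continuous.ext_on hdense (f := fun z => ‖h (z + ω)‖) (g := fun z => ‖h z‖)
      (by fun_prop) (by fun_prop) fun z hgz => by
        have e1 : h (z + ω) * (b * N z * g z) = a * N z * (h z * g z) := by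
          rw [← hgω, ← hfg, hfω, hfg z]
        have e2 : h (z + ω) * b = a * h z := by
          have h3 : N z * g z ≠ 0 := mul_ne_zero (hN z) hgz
          refine mul_right_cancel₀ h3 ?_
          linear_combination e1
        have e3 := congrArg norm e2
        rw [norm_mul, norm_mul, ha, hb, mul_one, one_mul] at e3
        exact e3
    exact fun z => congrFun this z
  refine ⟨h 0, fun z => ?_⟩
  rw [hfg z, eq_const_of_norm_periodic hh hτ (hper 1 a₁ b₁ N₁ ha₁ hb₁ hN₁ hf₁ hg₁)
    (hper τ a₂ b₂ N₂ ha₂ hb₂ hN₂ hf₂ hg₂) z 0]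

/-- At a zero exactly one factor vanishes, and the product rule leaves its derivative times nonzero
factors. -/
theorem deriv_prod_ne_zero {ι : Type*} (s : Finset ι) {φ : ι → ℂ → ℂ}
    (hd : ∀ i ∈ s, Differentiable ℂ (φ i)) (hs : ∀ i ∈ s, ∀ z, φ i z = 0 → deriv (φ i) z ≠ 0)
    (hdisj : ∀ i ∈ s, ∀ j ∈ s, i ≠ j → ∀ z, φ i z = 0 → φ j z ≠ 0) (z : ℂ)
    (hz : ∏ i ∈ s, φ i z = 0) : deriv (fun z => ∏ i ∈ s, φ i z) z ≠ 0 := by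
  classical
  obtain ⟨i, hi, h0⟩ := Finset.prod_eq_zero_iff.mp hz
  have e : (fun z => ∏ i ∈ s, φ i z) = fun z => φ i z * ∏ j ∈ s.erase i, φ j z :=
    funext fun z => (Finset.mul_prod_erase s (fun i => φ i z) hi).symm
  have hd' : DifferentiableAt ℂ (fun z => ∏ j ∈ s.erase i, φ j z) z :=
    DifferentiableAt.fun_finsetProd fun j hj => hd j (mem_of_mem_erase hj) z
  rw [e, deriv_fun_mul (hd i hi z) hd', h0, zero_mul, add_zero]
  exact mul_ne_zero (hs i hi z h0) (Finset.prod_ne_zero_iff.mpr fun j hj =>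
    hdisj i hi j (mem_of_mem_erase hj) (ne_of_mem_erase hj).symm z h0)

/-- A theta function that satisfies a three-term relation, and vanishes at half as many generic
points as it has zeros, vanishes identically. -/
theorem eq_zero_of_three_term {ι : Type*} [Fintype ι] {φ : ι → ℂ → ℂ} {v : ι → ℂ}
    {D M N₁ N₂ : ℂ → ℂ} {τ ξ a₁ a₂ b₁ b₂ : ℂ} (hτ : 0 < τ.im) (hD : Differentiable ℂ D)
    (hd : ∀ i, Differentiable ℂ (φ i)) (hs : ∀ i z, φ i z = 0 → deriv (φ i) z ≠ 0)
    (hdisj : ∀ i j, i ≠ j → ∀ z, φ i z = 0 → φ j z ≠ 0)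
    (hzero : ∀ i z, φ i z = 0 → ∃ k m l : ℤ, z = v i + k * ξ + m + l * τ)
    (hN₁ : ∀ z, N₁ z ≠ 0) (hN₂ : ∀ z, N₂ z ≠ 0) (hM : ∀ z, M z ≠ 0)
    (ha₁ : ‖a₁‖ = 1) (ha₂ : ‖a₂‖ = 1) (hb₁ : ‖b₁‖ = 1) (hb₂ : ‖b₂‖ = 1)
    (hD₁ : ∀ z, D (z + 1) = a₁ * N₁ z * D z) (hD₂ : ∀ z, D (z + τ) = a₂ * N₂ z * D z)
    (hφ₁ : ∀ z, ∏ i, φ i (z + 1) = b₁ * N₁ z * ∏ i, φ i z)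
    (hφ₂ : ∀ z, ∏ i, φ i (z + τ) = b₂ * N₂ z * ∏ i, φ i z)
    (hφξ : ∀ z, ∏ i, φ i (z + ξ) = M z * ∏ i, φ i z)
    (hDξ : ∀ z, D z * M z * M (z + ξ) + D (z + ξ) * M (z + ξ) + D (z + ξ + ξ) = 0)
    (h0 : ∀ i, D (v i) = 0) (h1 : ∀ i, D (v i + ξ) = 0) (z : ℂ) : D z = 0 := by
  have p1 : Function.Periodic (fun z => D z = 0) 1 := fun z => by
    have : a₁ ≠ 0 := fun h => by simp [h] at ha₁
    simp [hD₁, hN₁, this]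
  have p2 : Function.Periodic (fun z => D z = 0) τ := fun z => by
    have : a₂ ≠ 0 := fun h => by simp [h] at ha₂
    simp [hD₂, hN₂, this]
  -- Since M has no zeros, the three-term relation propagates two consecutive zeros in both
  -- directions along ξ.
  have p3 : Function.Periodic (fun z => D z = 0 ∧ D (z + ξ) = 0) ξ := fun z => by
    have e := hDξ z
    refine propext ⟨fun h => ⟨?_, h.1⟩, fun h => ⟨h.2, ?_⟩⟩
    · rw [h.1, h.2] at e
      simpa [hM] using e
    · rw [h.1, h.2] at e
      simpa using e
  obtain ⟨K, hK⟩ := exists_eq_const_mul (g := fun z => ∏ i, φ i z) hτ hD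
    (Differentiable.fun_finsetProd fun i _ => hd i)
    (deriv_prod_ne_zero univ (fun i _ => hd i) (fun i _ => hs i) fun i _ j _ => hdisj i j)
    (fun z hz => by
      obtain ⟨i, -, hi⟩ := Finset.prod_eq_zero_iff.mp hz
      obtain ⟨k, m, l, rfl⟩ := hzero i z hi
      have e1 := (p2.int_mul l) (v i + k * ξ + m)
      have e2 := (p1.int_mul m) (v i + k * ξ)
      have e3 := (p3.int_mul k) (v i)
      simp only [mul_one] at e2
      rw [e1, e2]
      exact (e3.mpr ⟨h0 i, h1 i⟩).1)
    hN₁ hN₂ ha₁ ha₂ hb₁ hb₂ hD₁ hD₂ hφ₁ hφ₂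
  -- For D = KΦ with Φ(z + ξ) = M(z)Φ(z) the three summands coincide, so 3KΦ(z)M(z)M(z + ξ) = 0.
  have e := hDξ z
  rw [hK z, hK (z + ξ), hK (z + ξ + ξ)] at e
  simp only [hφξ] at e
  rw [hK z]
  have h3 : 3 * M z * M (z + ξ) ≠ 0 := mul_ne_zero (mul_ne_zero (by norm_num) (hM _)) (hM _)
  refine (mul_eq_zero.mp (?_ : (3 * M z * M (z + ξ)) * _ = 0)).resolve_left h3
  linear_combination e

/-! ### Pfaffians in differences of the variables -/

/-- The product of `b (z i - z j)` over `i < j` times the pfaffian of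
`c (z i - z j) / b (z i - z j)`. -/
def diffPf (n : ℕ) (b c : ℂ → ℂ) (z : Fin (2 * n) → ℂ) : ℂ :=
  pfProd n (fun i j => b (z i - z j)) fun i j => c (z i - z j)

/-- Linear combinations of products with one factor `c (t - w p)` and all other factors
`b (t - w k)`. -/
def rowSum {ι : Type*} [Fintype ι] [DecidableEq ι] (b c : ℂ → ℂ) (w R : ι → ℂ) (t : ℂ) : ℂ :=
  ∑ p, R p * (c (t - w p) * ∏ k ∈ univ.erase p, b (t - w k))

section rowSum

variable {ι : Type*} [Fintype ι] [DecidableEq ι] {b c : ℂ → ℂ} (w R : ι → ℂ)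

theorem differentiable_rowSum (hb : Differentiable ℂ b) (hc : Differentiable ℂ c) :
    Differentiable ℂ (rowSum b c w R) := by
  unfold rowSum
  refine Differentiable.fun_sum fun p _ => ?_
  have h1 : ∀ k, Differentiable ℂ fun t => b (t - w k) := fun k => by fun_prop
  have h2 : Differentiable ℂ fun t => ∏ k ∈ univ.erase p, b (t - w k) :=
    Differentiable.fun_finsetProd fun k _ => h1 k
  fun_prop

/-- Every summand has one factor c and the same number of factors b, so all summands acquire the
same multiplier. -/
theorem rowSum_add {b' c' N : ℂ → ℂ} {s e a : ℂ} (hb : ∀ z, b (z + s) = e * N z * b' z)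
    (hc : ∀ z, c (z + s) = a * N z * c' z) (t : ℂ) :
    rowSum b c w R (t + s) =
      a * e ^ (Fintype.card ι - 1) * (∏ k, N (t - w k)) * rowSum b' c' w R t := by
  unfold rowSum
  rw [Finset.mul_sum]
  refine Finset.sum_congr rfl fun p _ => ?_
  have h : ∀ k, t + s - w k = t - w k + s := fun k => by ring
  simp only [h, hb, hc]
  rw [Finset.prod_mul_distrib, Finset.prod_mul_distrib, Finset.prod_const,
    card_erase_of_mem (mem_univ p), card_univ, ← Finset.mul_prod_erase univ _ (mem_univ p)]
  ring

/-- The factors b are eigenfunctions of the shift, so in each summand the relation is that of its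
single factor c. -/
theorem rowSum_three_term {μ : ℂ → ℂ} {ξ : ℂ} (hb : ∀ z, b (z + ξ) = μ z * b z)
    (hc : ∀ z, c z * μ z * μ (z + ξ) + c (z + ξ) * μ (z + ξ) + c (z + ξ + ξ) = 0) (t : ℂ) :
    rowSum b c w R t * (∏ k, μ (t - w k)) * (∏ k, μ (t + ξ - w k)) +
      rowSum b c w R (t + ξ) * (∏ k, μ (t + ξ - w k)) + rowSum b c w R (t + ξ + ξ) = 0 := by
  unfold rowSum
  rw [Finset.sum_mul, Finset.sum_mul, Finset.sum_mul, ← Finset.sum_add_distrib,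
    ← Finset.sum_add_distrib]
  refine Finset.sum_eq_zero fun p _ => ?_
  have h : ∀ k x, x + ξ - w k = x - w k + ξ := fun k x => by ring
  simp only [h, hb]
  simp only [Finset.prod_mul_distrib]
  rw [← Finset.mul_prod_erase univ (fun k => μ (t - w k)) (mem_univ p),
    ← Finset.mul_prod_erase univ (fun k => μ (t - w k + ξ)) (mem_univ p)]
  linear_combination (R p * (∏ k ∈ univ.erase p, b (t - w k)) *
    (∏ k ∈ univ.erase p, μ (t - w k)) * ∏ k ∈ univ.erase p, μ (t - w k + ξ)) * hc (t - w p)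

end rowSum

section diffPf

variable {b c : ℂ → ℂ}

theorem continuous_diffPf (hb : Continuous b) (hc : Continuous c) (n : ℕ) :
    Continuous (diffPf n b c) :=
  continuous_pfProd (fun i j => by fun_prop) fun i j => by fun_prop

theorem diffPf_comp (hb : ∀ z, b (-z) = b z) {n : ℕ} (z : Fin (2 * n) → ℂ)
    (σ : Equiv.Perm (Fin (2 * n))) :
    diffPf n b c (z ∘ σ) = ((Equiv.Perm.sign σ : ℤ) : ℂ) * diffPf n b c z :=
  pfProd_comp (fun i j => b (z i - z j)) (fun i j => c (z i - z j))
    (fun i j => by rw [← hb, neg_sub]) σ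

theorem diffPf_swap (hb : ∀ z, b (-z) = b z) {n : ℕ} (z : Fin (2 * n) → ℂ) {i j : Fin (2 * n)}
    (hij : i ≠ j) : diffPf n b c (z ∘ Equiv.swap i j) = -diffPf n b c z := by
  rw [diffPf_comp hb, Equiv.Perm.sign_swap hij]
  simp

theorem diffPf_eq_zero_of_eq (hb : ∀ z, b (-z) = b z) {n : ℕ} (z : Fin (2 * n) → ℂ)
    {i j : Fin (2 * n)} (hij : i ≠ j) (h : z i = z j) : diffPf n b c z = 0 := by
  have e : z ∘ Equiv.swap i j = z := by
    funext k
    simp only [Function.comp_apply, Equiv.swap_apply_def]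
    split_ifs with h1 h2
    · rw [h1, h]
    · rw [h2, h]
    · rfl
  have := diffPf_swap (c := c) hb z hij
  rw [e] at this
  linear_combination this / 2

/-- Each term contains c(z_i - z_j) up to sign if i and j are matched, and b(z_i - z_j) if they are
not. -/
theorem diffPf_eq_zero (hb : ∀ z, b (-z) = b z) (hc : ∀ z, c (-z) = -c z) {n : ℕ}
    (z : Fin (2 * n) → ℂ) {i j : Fin (2 * n)} (hij : i ≠ j) (hb0 : b (z i - z j) = 0)
    (hc0 : c (z i - z j) = 0) : diffPf n b c z = 0 := by
  have hb0' : b (z j - z i) = 0 := by rw [← hb, neg_sub, hb0]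
  have hc0' : c (z j - z i) = 0 := by rw [← neg_sub, hc, hc0, neg_zero]
  unfold diffPf pfProd
  rw [Finset.sum_eq_zero, mul_zero]
  intro π _
  by_cases h : ∃ k : Fin n, s(π (fstIdx k), π (sndIdx k)) = s(i, j)
  · obtain ⟨k, hk⟩ := h
    rw [Finset.prod_eq_zero (mem_univ k), mul_zero, zero_mul]
    rw [Sym2.eq_iff] at hk
    rcases hk with ⟨h1, h2⟩ | ⟨h1, h2⟩ <;> rw [h1, h2] <;> assumption
  · push Not at h
    rcases lt_or_gt_of_ne hij with hlt | hlt
    · rw [Finset.prod_eq_zero (i := (i, j)) _ hb0, mul_zero]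
      simp only [unpaired, upperPairs, mem_filter, mem_univ, true_and]
      exact ⟨hlt, h⟩
    · rw [Finset.prod_eq_zero (i := (j, i)) _ hb0', mul_zero]
      simp only [unpaired, upperPairs, mem_filter, mem_univ, true_and]
      exact ⟨hlt, fun k => by rw [Sym2.eq_swap (a := j)]; exact h k⟩

/-- The vector with first entry `t` and the other entries `w`. -/
abbrev consVec {m : ℕ} (t : ℂ) (w : Fin m → ℂ) : Fin (m + 1) → ℂ := Fin.cons t w

theorem diffPf_cons (hb : ∀ z, b (-z) = b z) (hc : ∀ z, c (-z) = -c z) {n : ℕ} (t : ℂ)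
    (w : Fin (2 * n + 1) → ℂ) :
    diffPf (n + 1) b c (consVec t w) = ∑ p : Fin (2 * n + 1),
      ((Equiv.Perm.sign (Equiv.swap 0 p) : ℤ) : ℂ) * c (t - w p) *
        (∏ k : Fin (2 * n), b (t - w (Equiv.swap 0 p k.succ)) *
          b (w p - w (Equiv.swap 0 p k.succ))) *
        diffPf n b c fun k => w (Equiv.swap 0 p k.succ) :=
  pfProd_succ (fun i j => b (consVec t w i - consVec t w j))
    (fun i j => c (consVec t w i - consVec t w j)) (fun i j => by rw [← hb, neg_sub])
    fun i j => by rw [← hc, neg_sub]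

/-- Only the independence of the coefficients from t matters: it makes the pfaffian a `rowSum` in
its first variable. -/
theorem exists_diffPf_eq_rowSum (hb : ∀ z, b (-z) = b z) (hc : ∀ z, c (-z) = -c z) {n : ℕ}
    (w : Fin (2 * n + 1) → ℂ) :
    ∃ R, ∀ t, diffPf (n + 1) b c (consVec t w) = rowSum b c w R t := by
  refine ⟨fun p => ((Equiv.Perm.sign (Equiv.swap 0 p) : ℤ) : ℂ) *
    (∏ k : Fin (2 * n), b (w p - w (Equiv.swap 0 p k.succ))) *
    diffPf n b c fun k => w (Equiv.swap 0 p k.succ), fun t => ?_⟩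
  rw [diffPf_cons hb hc]
  refine Finset.sum_congr rfl fun p _ => ?_
  -- The map k ↦ `swap 0 p k.succ` enumerates the indices other than p.
  have : ∏ k ∈ univ.erase p, b (t - w k) = ∏ k : Fin (2 * n), b (t - w (Equiv.swap 0 p k.succ)) := by
    symm
    refine Finset.prod_bij (fun k _ => Equiv.swap 0 p k.succ) ?_ ?_ ?_ ?_
    · intro k _
      refine mem_erase.mpr ⟨fun h => ?_, mem_univ _⟩
      have := congrArg (Equiv.swap 0 p) h
      rw [Equiv.swap_apply_self, Equiv.swap_apply_right] at this
      exact Fin.succ_ne_zero k this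
    · intro k _ l _ h
      exact Fin.succ_injective _ ((Equiv.swap 0 p).injective h)
    · intro k hk
      have : Equiv.swap 0 p k ≠ 0 := fun h => by
        have := congrArg (Equiv.swap 0 p) h
        rw [Equiv.swap_apply_self, Equiv.swap_apply_left] at this
        exact ne_of_mem_erase hk this
      obtain ⟨l, hl⟩ := Fin.exists_succ_eq_of_ne_zero this
      exact ⟨l, mem_univ _, by rw [hl, Equiv.swap_apply_self]⟩
    · intro k _
      rfl
  rw [this, Finset.prod_mul_distrib]
  ring

/-- In the expansion along the row of t, every term that does not match t with v contains b(t - v) =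
0. -/
theorem diffPf_cons_cons (hb : ∀ z, b (-z) = b z) (hc : ∀ z, c (-z) = -c z) {n : ℕ} {t v : ℂ}
    (h0 : b (t - v) = 0) (w : Fin (2 * n) → ℂ) :
    diffPf (n + 1) b c (consVec t (consVec v w)) =
      c (t - v) * (∏ k, b (t - w k) * b (v - w k)) * diffPf n b c w := by
  rw [diffPf_cons hb hc, Finset.sum_eq_single 0]
  · simp
  · intro p _ hp
    obtain ⟨k, rfl⟩ := Fin.exists_succ_eq_of_ne_zero hp
    rw [Finset.prod_eq_zero (mem_univ k), mul_zero, zero_mul]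
    rw [Equiv.swap_apply_right, show consVec v w 0 = v from rfl, h0, zero_mul]
  · simp

theorem diffPf_zero (z : Fin (2 * 0) → ℂ) : diffPf 0 b c z = 1 := by
  have : unpaired (n := 0) 1 = ∅ := by
    ext e
    exact e.1.elim0
  simp [diffPf, pfProd, this]

/-- The extension of a permutation by a fixed point `0`. -/
def liftPerm {m : ℕ} (σ : Equiv.Perm (Fin m)) : Equiv.Perm (Fin (m + 1)) :=
  Equiv.Perm.decomposeFin.symm (0, σ)

theorem sign_liftPerm {m : ℕ} (σ : Equiv.Perm (Fin m)) :
    Equiv.Perm.sign (liftPerm σ) = Equiv.Perm.sign σ := by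
  rw [liftPerm, Equiv.Perm.decomposeFin.symm_sign, if_pos rfl, one_mul]

theorem consVec_comp_liftPerm {m : ℕ} (t : ℂ) (w : Fin m → ℂ) (σ : Equiv.Perm (Fin m)) :
    consVec t w ∘ liftPerm σ = consVec t (w ∘ σ) := by
  funext i
  refine Fin.cases ?_ (fun k => ?_) i
  · simp [liftPerm]
  · simp [liftPerm]

theorem consVec_swap {m : ℕ} (s t : ℂ) (w : Fin m → ℂ) :
    consVec s (consVec t w) ∘ Equiv.swap 0 1 = consVec t (consVec s w) := by
  funext i
  refine Fin.cases ?_ (fun k => Fin.cases ?_ (fun l => ?_) k) i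
  · simp
  · simp
  · have h : Equiv.swap (0 : Fin (m + 1 + 1)) 1 l.succ.succ = l.succ.succ :=
      Equiv.swap_apply_of_ne_of_ne (Fin.succ_ne_zero _)
        fun h => Fin.succ_ne_zero l (Fin.succ_injective _ h)
    rw [Function.comp_apply, h]
    simp

theorem diffPf_cons_swap (hb : ∀ z, b (-z) = b z) {n : ℕ} (s t : ℂ) (w : Fin (2 * n) → ℂ) :
    diffPf (n + 1) b c (consVec s (consVec t w)) =
      -diffPf (n + 1) b c (consVec t (consVec s w)) := by
  rw [← consVec_swap]
  exact diffPf_swap (n := n + 1) hb _ (i := (0 : Fin (2 * n + 1 + 1))) (Fin.zero_ne_one)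

theorem diffPf_cons_cons_swap (hb : ∀ z, b (-z) = b z) {n : ℕ} (r s t : ℂ)
    (w : Fin (2 * n + 1) → ℂ) :
    diffPf (n + 2) b c (consVec r (consVec s (consVec t w))) =
      -diffPf (n + 2) b c (consVec r (consVec t (consVec s w))) := by
  rw [← consVec_swap t s, ← consVec_comp_liftPerm]
  refine (diffPf_comp (n := n + 2) hb _ _).trans ?_
  rw [sign_liftPerm, Equiv.Perm.sign_swap (Fin.zero_ne_one)]
  simp

theorem diffPf_cons_cons_cons_swap (hb : ∀ z, b (-z) = b z) {n : ℕ} (q r s t : ℂ)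
    (w : Fin (2 * n) → ℂ) :
    diffPf (n + 2) b c (consVec q (consVec r (consVec s (consVec t w)))) =
      -diffPf (n + 2) b c (consVec q (consVec r (consVec t (consVec s w)))) := by
  rw [← consVec_swap t s, ← consVec_comp_liftPerm, ← consVec_comp_liftPerm]
  refine (diffPf_comp (n := n + 2) hb _ _).trans ?_
  rw [sign_liftPerm, sign_liftPerm, Equiv.Perm.sign_swap (Fin.zero_ne_one)]
  simp

end diffPf

/-! ### Generic variables and the axioms for a pair of labels -/

section generic

/-- The differences of arguments that are excluded in a generic configuration. -/
def badSet (τ ξ s : ℂ) : Set ℂ :=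
  Set.range fun k : ℤ × ℤ × ℤ × ℤ => k.1 * ξ + k.2.1 + k.2.2.1 * τ + k.2.2.2 * s

/-- Along the line w_i + t·i each difference moves with the nonzero speed i - j, so only countably
many t meet the countable set `badSet`. -/
theorem eq_of_eq_on_generic {N : ℕ} {τ ξ s : ℂ} {F G : (Fin N → ℂ) → ℂ} (hF : Continuous F)
    (hG : Continuous G)
    (h : ∀ w : Fin N → ℂ, (∀ i j, i ≠ j → w i - w j ∉ badSet τ ξ s) → F w = G w)
    (w : Fin N → ℂ) : F w = G w := by
  have hc : Continuous fun t : ℂ => fun i : Fin N => w i + t * (i : ℕ) := by fun_prop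
  have hbad : (⋃ e : Fin N × Fin N, ⋃ k : ℤ × ℤ × ℤ × ℤ,
      {((k.1 * ξ + k.2.1 + k.2.2.1 * τ + k.2.2.2 * s) - (w e.1 - w e.2)) /
        ((e.1 : ℕ) - (e.2 : ℕ) : ℂ)}).Countable :=
    Set.countable_iUnion fun e => Set.countable_iUnion fun k => Set.countable_singleton _
  have key := Continuous.ext_on (hbad.dense_compl ℂ) (hF.comp hc) (hG.comp hc) fun t ht => by
    refine h _ fun i j hij => ?_
    rintro ⟨k, hk⟩
    refine ht (Set.mem_iUnion.mpr ⟨(i, j), Set.mem_iUnion.mpr ⟨k, ?_⟩⟩)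
    have hne : ((i : ℕ) - (j : ℕ) : ℂ) ≠ 0 := by
      rw [sub_ne_zero]
      exact_mod_cast fun h => hij (Fin.ext h)
    rw [Set.mem_singleton_iff, eq_div_iff hne]
    simp only at hk ⊢
    linear_combination -hk
  simpa using congrFun key 0

end generic

/-- The multipliers of four functions with respect to a period agree up to signs. -/
structure SignMult (ω : ℂ) (N b β c c' : ℂ → ℂ) (eb eβ ec ec' : ℂ) : Prop where
  N_ne : ∀ z, N z ≠ 0
  eb_sq : eb ^ 2 = 1
  eβ_sq : eβ ^ 2 = 1
  ec_sq : ec ^ 2 = 1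
  -- This makes a row of c', and b·β times a row of c with two entries fewer, have the same
  -- multiplier.
  compat : ec' = eb * eβ * ec
  b_add : ∀ z, b (z + ω) = eb * N z * b z
  β_add : ∀ z, β (z + ω) = eβ * N z * β z
  c_add : ∀ z, c (z + ω) = ec * N z * c z
  c'_add : ∀ z, c' (z + ω) = ec' * N z * c' z

/-- The properties of the denominator `b`, its shift `β` by the half period `s`, and the two
numerators `c`, `c'` exchanged by this shift that imply the transformation formula. -/
structure PairData (τ s ξ A A' B₀ B₁ : ℂ) (b β c c' u μ : ℂ → ℂ) : Prop where
  b_diff : Differentiable ℂ b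
  β_diff : Differentiable ℂ β
  c_diff : Differentiable ℂ c
  c'_diff : Differentiable ℂ c'
  b_neg : ∀ z, b (-z) = b z
  β_neg : ∀ z, β (-z) = -β z
  c_neg : ∀ z, c (-z) = -c z
  c'_neg : ∀ z, c' (-z) = -c' z
  u_ne : ∀ z, u z ≠ 0
  u_add : ∀ z w, u (z + w) = u z * u w
  u_cont : Continuous u
  b_add_s : ∀ z, b (z + s) = B₀ * u z * β z
  β_add_s : ∀ z, β (z + s) = B₁ * u z * b z
  c_add_s : ∀ z, c (z + s) = A * u z * c' z
  c'_add_s : ∀ z, c' (z + s) = A' * u z * c z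
  A_ne : A ≠ 0
  A'_ne : A' ≠ 0
  B₀_ne : B₀ ≠ 0
  B₁_ne : B₁ ≠ 0
  μ_ne : ∀ z, μ z ≠ 0
  b_add_ξ : ∀ z, b (z + ξ) = μ z * b z
  β_add_ξ : ∀ z, β (z + ξ) = μ z * β z
  c_three : ∀ z, c z * μ z * μ (z + ξ) + c (z + ξ) * μ (z + ξ) + c (z + ξ + ξ) = 0
  c'_three : ∀ z, c' z * μ z * μ (z + ξ) + c' (z + ξ) * μ (z + ξ) + c' (z + ξ + ξ) = 0
  c_ξ_ne : c ξ ≠ 0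
  c'_ξ_ne : c' ξ ≠ 0
  b_zero : ∀ z, b z = 0 → ∃ k m l : ℤ, z = s + k * ξ + m + l * τ
  β_zero : ∀ z, β z = 0 → ∃ k m l : ℤ, z = k * ξ + m + l * τ
  b_simple : ∀ z, b z = 0 → deriv b z ≠ 0
  β_simple : ∀ z, β z = 0 → deriv β z ≠ 0
  disjoint : ∀ z, b z = 0 → β z ≠ 0
  mult_one : ∃ N eb eβ ec ec', SignMult 1 N b β c c' eb eβ ec ec'
  mult_τ : ∃ N eb eβ ec ec', SignMult τ N b β c c' eb eβ ec ec'

theorem norm_eq_one_of_sq {e : ℂ} (h : e ^ 2 = 1) : ‖e‖ = 1 :=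
  norm_eq_one_of_pow_eq_one h two_ne_zero

theorem SignMult.swap {ω : ℂ} {N b β c c' : ℂ → ℂ} {eb eβ ec ec' : ℂ}
    (h : SignMult ω N b β c c' eb eβ ec ec') : SignMult ω N b β c' c eb eβ ec' ec where
  N_ne := h.N_ne
  eb_sq := h.eb_sq
  eβ_sq := h.eβ_sq
  ec_sq := by rw [h.compat, mul_pow, mul_pow, h.eb_sq, h.eβ_sq, h.ec_sq]; norm_num
  compat := by
    rw [h.compat]
    linear_combination (-ec * eβ ^ 2) * h.eb_sq - ec * h.eβ_sq
  b_add := h.b_add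
  β_add := h.β_add
  c_add := h.c'_add
  c'_add := h.c_add

namespace PairData

variable {τ s ξ A A' B₀ B₁ : ℂ} {b β c c' u μ : ℂ → ℂ}

/-- The axioms are symmetric in c and c'; this yields the second identity of each pair of labels. -/
theorem symm (h : PairData τ s ξ A A' B₀ B₁ b β c c' u μ) :
    PairData τ s ξ A' A B₀ B₁ b β c' c u μ where
  b_diff := h.b_diff
  β_diff := h.β_diff
  c_diff := h.c'_diff
  c'_diff := h.c_diff
  b_neg := h.b_neg
  β_neg := h.β_neg
  c_neg := h.c'_neg
  c'_neg := h.c_neg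
  u_ne := h.u_ne
  u_add := h.u_add
  u_cont := h.u_cont
  b_add_s := h.b_add_s
  β_add_s := h.β_add_s
  c_add_s := h.c'_add_s
  c'_add_s := h.c_add_s
  A_ne := h.A'_ne
  A'_ne := h.A_ne
  B₀_ne := h.B₀_ne
  B₁_ne := h.B₁_ne
  μ_ne := h.μ_ne
  b_add_ξ := h.b_add_ξ
  β_add_ξ := h.β_add_ξ
  c_three := h.c'_three
  c'_three := h.c_three
  c_ξ_ne := h.c'_ξ_ne
  c'_ξ_ne := h.c_ξ_ne
  b_zero := h.b_zero
  β_zero := h.β_zero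
  b_simple := h.b_simple
  β_simple := h.β_simple
  disjoint := h.disjoint
  mult_one := by
    obtain ⟨N, eb, eβ, ec, ec', hm⟩ := h.mult_one
    exact ⟨N, eb, eβ, ec', ec, hm.swap⟩
  mult_τ := by
    obtain ⟨N, eb, eβ, ec, ec', hm⟩ := h.mult_τ
    exact ⟨N, eb, eβ, ec', ec, hm.swap⟩

variable (h : PairData τ s ξ A A' B₀ B₁ b β c c' u μ)
include h

theorem β_at_zero : β 0 = 0 := by
  have := h.β_neg 0
  rw [neg_zero] at this
  linear_combination this / 2

theorem c_at_zero : c 0 = 0 := by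
  have := h.c_neg 0
  rw [neg_zero] at this
  linear_combination this / 2

theorem β_at_ξ : β ξ = 0 := by
  have := h.β_add_ξ 0
  rwa [h.β_at_zero, mul_zero, zero_add] at this

theorem b_at_s : b s = 0 := by
  have := h.b_add_s 0
  rwa [h.β_at_zero, mul_zero, zero_add] at this

theorem c'_at_s : c' s = 0 := by
  have := h.c'_add_s 0
  rwa [h.c_at_zero, mul_zero, zero_add] at this

theorem b_at_s_add_ξ : b (s + ξ) = 0 := by rw [h.b_add_ξ, h.b_at_s, mul_zero]

theorem b_at_s_sub_ξ : b (s - ξ) = 0 := by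
  have := h.b_add_ξ (s - ξ)
  rw [sub_add_cancel, h.b_at_s] at this
  exact (mul_eq_zero.mp this.symm).resolve_left (h.μ_ne _)

/-- Used contrapositively: for generic variables the factors of the comparison function have no
common zeros. -/
theorem sub_mem_badSet_bb {p q t : ℂ} (hp : b (t - p) = 0) (hq : b (t - q) = 0) :
    p - q ∈ badSet τ ξ s := by
  obtain ⟨k, m, l, e⟩ := h.b_zero _ hp
  obtain ⟨k', m', l', e'⟩ := h.b_zero _ hq
  refine ⟨(k' - k, m' - m, l' - l, 0), ?_⟩
  push_cast
  linear_combination e - e'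

theorem sub_mem_badSet_βb {p q t : ℂ} (hp : β (t - p) = 0) (hq : b (t - q) = 0) :
    p - q ∈ badSet τ ξ s := by
  obtain ⟨k, m, l, e⟩ := h.β_zero _ hp
  obtain ⟨k', m', l', e'⟩ := h.b_zero _ hq
  refine ⟨(k' - k, m' - m, l' - l, 1), ?_⟩
  push_cast
  linear_combination e - e'

theorem sub_mem_badSet_ββ {p q t : ℂ} (hp : β (t - p) = 0) (hq : β (t - q) = 0) :
    p - q ∈ badSet τ ξ s := by
  obtain ⟨k, m, l, e⟩ := h.β_zero _ hp
  obtain ⟨k', m', l', e'⟩ := h.β_zero _ hq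
  refine ⟨(k' - k, m' - m, l' - l, 0), ?_⟩
  push_cast
  linear_combination e - e'

omit h in
theorem mem_badSet_of_add {x : ℂ} (hx : x + ξ ∈ badSet τ ξ s) : x ∈ badSet τ ξ s := by
  obtain ⟨k, hk⟩ := hx
  refine ⟨(k.1 - 1, k.2.1, k.2.2.1, k.2.2.2), ?_⟩
  simp only at hk ⊢
  push_cast
  linear_combination hk

omit h in
theorem neg_mem_badSet {x : ℂ} (hx : x ∈ badSet τ ξ s) : -x ∈ badSet τ ξ s := by
  obtain ⟨k, hk⟩ := hx
  refine ⟨(-k.1, -k.2.1, -k.2.2.1, -k.2.2.2), ?_⟩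
  simp only at hk ⊢
  push_cast
  linear_combination -hk

end PairData

/-! ### Rigidity for the recursion in the number of variables -/

namespace PairData

variable {τ s ξ A A' B₀ B₁ : ℂ} {b β c c' u μ : ℂ → ℂ}

/-- The factors `b (t - (y + ξ))`, `β (t - y)` and `b (t - w j)`. -/
def factors {m : ℕ} (b β : ℂ → ℂ) (ξ y : ℂ) (w : Fin m → ℂ) : Fin (m + 1 + 1) → ℂ → ℂ :=
  Fin.cons (fun t => b (t - (y + ξ))) (Fin.cons (fun t => β (t - y)) fun j t => b (t - w j))

theorem prod_factors_add {m : ℕ} {y : ℂ} {w : Fin m → ℂ} {ω e eβ : ℂ} {N : ℂ → ℂ}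
    (hb : ∀ z, b (z + ω) = e * N z * b z) (hβ : ∀ z, β (z + ω) = eβ * N z * β z) (t : ℂ) :
    ∏ i, factors b β ξ y w i (t + ω) = e * eβ * e ^ m *
      (∏ k, N (t - consVec (y + ξ) (consVec y w) k)) * ∏ i, factors b β ξ y w i t := by
  have hsub : ∀ x, t + ω - x = t - x + ω := fun x => by ring
  simp only [factors, Fin.prod_univ_succ, Fin.cons_zero, Fin.cons_succ, hsub, hb, hβ,
    Finset.prod_mul_distrib, Finset.prod_const, card_univ, Fintype.card_fin]
  ring

/-- The difference of the two sides of the recursion, as a function of one variable. -/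
def recDiff {m : ℕ} (b β c c' : ℂ → ℂ) (ξ y : ℂ) (w : Fin m → ℂ) (R₁ : Fin (m + 1 + 1) → ℂ)
    (R₂ : Fin m → ℂ) (K t : ℂ) : ℂ :=
  rowSum b c' (consVec (y + ξ) (consVec y w)) R₁ t -
    K * (b (t - (y + ξ)) * β (t - y) * rowSum b c w R₂ t)

/-- The factors b of the rows contribute even powers of the sign `eb`, which disappear; the
remaining signs agree by `compat`. -/
theorem recDiff_add {n : ℕ} {y : ℂ} {w : Fin (2 * n + 1) → ℂ} {R₁ : Fin (2 * n + 1 + 1 + 1) → ℂ}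
    {R₂ : Fin (2 * n + 1) → ℂ} {K ω eb eβ ec ec' : ℂ} {N : ℂ → ℂ}
    (hm : SignMult ω N b β c c' eb eβ ec ec') (t : ℂ) :
    recDiff b β c c' ξ y w R₁ R₂ K (t + ω) = ec' *
      (∏ k, N (t - consVec (y + ξ) (consVec y w) k)) * recDiff b β c c' ξ y w R₁ R₂ K t := by
  have hsub : ∀ x, t + ω - x = t - x + ω := fun x => by ring
  have e1 : eb ^ (2 * n) = 1 := by rw [pow_mul, hm.eb_sq, one_pow]
  have e2 : eb ^ (2 * n + 1 + 1 + 1 - 1) = 1 := by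
    rw [show 2 * n + 1 + 1 + 1 - 1 = 2 * n + 2 by omega, pow_add, e1, hm.eb_sq, one_mul]
  unfold recDiff
  rw [rowSum_add _ _ hm.b_add hm.c'_add, rowSum_add _ _ hm.b_add hm.c_add, hsub, hsub, hm.b_add,
    hm.β_add, Fintype.card_fin, Fintype.card_fin, e2, Nat.add_sub_cancel, e1]
  simp only [Fin.prod_univ_succ (n := 2 * n + 1 + 1), Fin.prod_univ_succ (n := 2 * n + 1),
    Fin.cons_zero, Fin.cons_succ]
  rw [hm.compat]
  ring

/-- The prefactor b(t - (y + ξ)) β(t - y) is an eigenfunction, and its factor supplies exactly the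
two values of μ that the shorter row lacks. -/
theorem recDiff_three_term (h : PairData τ s ξ A A' B₀ B₁ b β c c' u μ) {m : ℕ} {y : ℂ}
    {w : Fin m → ℂ} {R₁ : Fin (m + 1 + 1) → ℂ} {R₂ : Fin m → ℂ} {K : ℂ} (t : ℂ) :
    recDiff b β c c' ξ y w R₁ R₂ K t * (∏ k, μ (t - consVec (y + ξ) (consVec y w) k)) *
        (∏ k, μ (t + ξ - consVec (y + ξ) (consVec y w) k)) +
      recDiff b β c c' ξ y w R₁ R₂ K (t + ξ) *
        (∏ k, μ (t + ξ - consVec (y + ξ) (consVec y w) k)) +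
      recDiff b β c c' ξ y w R₁ R₂ K (t + ξ + ξ) = 0 := by
  have h1 := rowSum_three_term (consVec (y + ξ) (consVec y w)) R₁ h.b_add_ξ h.c'_three t
  have h2 := rowSum_three_term w R₂ h.b_add_ξ h.c_three t
  have e1 : b (t + ξ - (y + ξ)) = μ (t - (y + ξ)) * b (t - (y + ξ)) := by rw [← h.b_add_ξ]; ring_nf
  have e2 : b (t + ξ + ξ - (y + ξ)) =
      μ (t + ξ - (y + ξ)) * (μ (t - (y + ξ)) * b (t - (y + ξ))) := by
    rw [← h.b_add_ξ, show t - (y + ξ) + ξ = t + ξ - (y + ξ) by ring, ← h.b_add_ξ]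
    ring_nf
  have e3 : β (t + ξ - y) = μ (t - y) * β (t - y) := by rw [← h.β_add_ξ]; ring_nf
  have e4 : β (t + ξ + ξ - y) = μ (t + ξ - y) * (μ (t - y) * β (t - y)) := by
    rw [← h.β_add_ξ, show t - y + ξ = t + ξ - y by ring, ← h.β_add_ξ]
    ring_nf
  unfold recDiff
  rw [e1, e2, e3, e4]
  simp only [Fin.prod_univ_succ (n := m + 1), Fin.prod_univ_succ (n := m),
    Fin.cons_zero, Fin.cons_succ] at h1 ⊢
  linear_combination h1 - K * b (t - (y + ξ)) * β (t - y) * μ (t - (y + ξ)) * μ (t - y) *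
    μ (t + ξ - (y + ξ)) * μ (t + ξ - y) * h2

/-- This is `eq_zero_of_three_term` for the comparison function b(t - (y + ξ)) β(t - y) ∏ b(t -
w_j). The test points y + s, y and w_j + s represent the zeros of its factors modulo ξ and the
periods. -/
theorem recDiff_eq_zero (hτ : 0 < τ.im) (h : PairData τ s ξ A A' B₀ B₁ b β c c' u μ) {n : ℕ}
    {y : ℂ} {w : Fin (2 * n + 1) → ℂ} {R₁ : Fin (2 * n + 1 + 1 + 1) → ℂ}
    {R₂ : Fin (2 * n + 1) → ℂ} {K : ℂ}
    (hyw : ∀ i, y - w i ∉ badSet τ ξ s) (hww : ∀ i j, i ≠ j → w i - w j ∉ badSet τ ξ s)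
    (h0 : ∀ i, recDiff b β c c' ξ y w R₁ R₂ K
      (consVec (y + s) (consVec y fun j => w j + s) i) = 0)
    (h1 : ∀ i, recDiff b β c c' ξ y w R₁ R₂ K
      (consVec (y + s) (consVec y fun j => w j + s) i + ξ) = 0) (t : ℂ) :
    recDiff b β c c' ξ y w R₁ R₂ K t = 0 := by
  obtain ⟨N₁, eb, eβ, ec, ec', h₁⟩ := h.mult_one
  obtain ⟨N₂, fb, fβ, fc, fc', h₂⟩ := h.mult_τ
  have bd := h.b_diff
  have βd := h.β_diff
  refine eq_zero_of_three_term (φ := factors b β ξ y w) hτ ?_ ?_ ?_ ?_ ?_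
    (fun z => Finset.prod_ne_zero_iff.mpr fun k _ => h₁.N_ne _)
    (fun z => Finset.prod_ne_zero_iff.mpr fun k _ => h₂.N_ne _)
    (fun z => Finset.prod_ne_zero_iff.mpr fun k _ => h.μ_ne _)
    (norm_eq_one_of_sq h₁.swap.ec_sq) (norm_eq_one_of_sq h₂.swap.ec_sq)
    (b₁ := eb * eβ * eb ^ (2 * n + 1)) (b₂ := fb * fβ * fb ^ (2 * n + 1)) ?_ ?_
    (recDiff_add h₁) (recDiff_add h₂) (prod_factors_add h₁.b_add h₁.β_add)
    (prod_factors_add h₂.b_add h₂.β_add) ?_ (recDiff_three_term h) h0 h1 t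
  · have d1 := differentiable_rowSum (consVec (y + ξ) (consVec y w)) R₁ h.b_diff h.c'_diff
    have d2 := differentiable_rowSum w R₂ h.b_diff h.c_diff
    unfold recDiff
    fun_prop
  · refine Fin.cases ?_ fun i => Fin.cases ?_ (fun j => ?_) i
    · simp only [factors, Fin.cons_zero]; fun_prop
    · simp only [factors, Fin.cons_zero, Fin.cons_succ]; fun_prop
    · simp only [factors, Fin.cons_succ]; fun_prop
  · refine Fin.cases ?_ fun i => Fin.cases ?_ (fun j => ?_) i
    · intro z hz
      simp only [factors, Fin.cons_zero] at hz ⊢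
      rw [deriv_comp_sub_const]
      exact h.b_simple _ hz
    · intro z hz
      simp only [factors, Fin.cons_zero, Fin.cons_succ] at hz ⊢
      rw [deriv_comp_sub_const]
      exact h.β_simple _ hz
    · intro z hz
      simp only [factors, Fin.cons_succ] at hz ⊢
      rw [deriv_comp_sub_const]
      exact h.b_simple _ hz
  · have sym : ∀ x x' : ℂ, x - x' ∈ badSet τ ξ s → x' - x ∈ badSet τ ξ s := fun x x' hx => by
      have := neg_mem_badSet hx
      rwa [neg_sub] at this
    have add : ∀ i, y + ξ - w i ∉ badSet τ ξ s := fun i hi => hyw i (mem_badSet_of_add (by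
      rwa [show y - w i + ξ = y + ξ - w i by ring]))
    have hbβ : ∀ t, b (t - (y + ξ)) = 0 → β (t - y) ≠ 0 := fun t hb => by
      refine h.disjoint _ ?_
      rw [show t - y = t - (y + ξ) + ξ by ring, h.b_add_ξ, hb, mul_zero]
    refine Fin.cases ?_ fun i => Fin.cases ?_ (fun j => ?_) i <;>
      refine Fin.cases ?_ fun i' => Fin.cases ?_ (fun j' => ?_) i' <;>
      simp only [factors, Fin.cons_zero, Fin.cons_succ] <;> intro hne t hz hz'
    · exact hne rfl
    · exact hbβ t hz hz'
    · exact add _ (h.sub_mem_badSet_bb hz hz')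
    · exact hbβ t hz' hz
    · exact hne rfl
    · exact hyw _ (h.sub_mem_badSet_βb hz hz')
    · exact add _ (h.sub_mem_badSet_bb hz' hz)
    · exact hyw _ (h.sub_mem_badSet_βb hz' hz)
    · exact hww j j' (fun e => hne (by rw [e])) (h.sub_mem_badSet_bb hz hz')
  · refine Fin.cases ?_ fun i => Fin.cases ?_ (fun j => ?_) i <;>
      simp only [factors, Fin.cons_zero, Fin.cons_succ] <;> intro z hz
    · obtain ⟨k, m, l, e⟩ := h.b_zero _ hz
      exact ⟨k + 1, m, l, by push_cast; linear_combination e⟩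
    · obtain ⟨k, m, l, e⟩ := h.β_zero _ hz
      exact ⟨k, m, l, by linear_combination e⟩
    · obtain ⟨k, m, l, e⟩ := h.b_zero _ hz
      exact ⟨k, m, l, by linear_combination e⟩
  · refine norm_eq_one_of_sq ?_
    rw [mul_pow, mul_pow, ← pow_mul, mul_comm (2 * n + 1), pow_mul, h₁.eb_sq, h₁.eβ_sq]
    simp
  · refine norm_eq_one_of_sq ?_
    rw [mul_pow, mul_pow, ← pow_mul, mul_comm (2 * n + 1), pow_mul, h₂.eb_sq, h₂.eβ_sq]
    simp
  · intro z
    rw [prod_factors_add (e := 1) (eβ := 1) (N := μ) (fun z => by rw [h.b_add_ξ, one_mul])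
      (fun z => by rw [h.β_add_ξ, one_mul])]
    simp

end PairData

/-! ### Evaluation of the pfaffian at z₁ = z₂ + ξ -/

namespace PairData

variable {τ s ξ A A' B₀ B₁ : ℂ} {b β c c' u μ : ℂ → ℂ}

/-- The constant in the evaluation of the pfaffian at `z₁ = z₂ + ξ`. -/
def recConst (s ξ B₀ B₁ : ℂ) (c c' : ℂ → ℂ) (n : ℕ) : ℂ :=
  c' ξ * (c' (s + ξ) * B₀ / (c (s + ξ) * B₁)) ^ n

/-- The difference of the two sides of the evaluation at `z₁ = z₂ + ξ`. -/
def evalDiff (n : ℕ) (b β c c' : ℂ → ℂ) (ξ y K : ℂ) (w : Fin (2 * n + 1) → ℂ) (t : ℂ) : ℂ :=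
  diffPf (n + 2) b c' (consVec t (consVec (y + ξ) (consVec y w))) +
    K * (∏ j, b (y + ξ - w j) * β (y - w j)) *
      (b (t - (y + ξ)) * β (t - y) * diffPf (n + 1) b c (consVec t w))

/-- The antisymmetry in w reduces the test at w_j + s + ξ to the case j = 0. -/
theorem evalDiff_comp (h : PairData τ s ξ A A' B₀ B₁ b β c c' u μ) {n : ℕ} (y K : ℂ)
    (w : Fin (2 * n + 1) → ℂ) (t : ℂ) (σ : Equiv.Perm (Fin (2 * n + 1))) :
    evalDiff n b β c c' ξ y K (w ∘ σ) t =
      ((Equiv.Perm.sign σ : ℤ) : ℂ) * evalDiff n b β c c' ξ y K w t := by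
  unfold evalDiff
  have e1 : diffPf (n + 2) b c' (consVec t (consVec (y + ξ) (consVec y (w ∘ σ)))) =
      ((Equiv.Perm.sign σ : ℤ) : ℂ) *
        diffPf (n + 2) b c' (consVec t (consVec (y + ξ) (consVec y w))) := by
    rw [← consVec_comp_liftPerm, ← consVec_comp_liftPerm, ← consVec_comp_liftPerm]
    refine (diffPf_comp (n := n + 2) h.b_neg _ _).trans ?_
    rw [sign_liftPerm, sign_liftPerm, sign_liftPerm]
  have e2 : diffPf (n + 1) b c (consVec t (w ∘ σ)) =
      ((Equiv.Perm.sign σ : ℤ) : ℂ) * diffPf (n + 1) b c (consVec t w) := by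
    rw [← consVec_comp_liftPerm]
    refine (diffPf_comp (n := n + 1) h.b_neg _ _).trans ?_
    rw [sign_liftPerm]
  have e3 := Equiv.prod_comp σ fun j => b (y + ξ - w j) * β (y - w j)
  rw [e1, e2]
  simp only [Function.comp_apply]
  rw [e3]
  ring

theorem c_s_add_ξ (h : PairData τ s ξ A A' B₀ B₁ b β c c' u μ) : c (s + ξ) = A * u ξ * c' ξ := by
  rw [add_comm, h.c_add_s]

theorem c'_s_add_ξ (h : PairData τ s ξ A A' B₀ B₁ b β c c' u μ) :
    c' (s + ξ) = A' * u ξ * c ξ := h.symm.c_s_add_ξ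

theorem c_s_add_ξ_ne (h : PairData τ s ξ A A' B₀ B₁ b β c c' u μ) : c (s + ξ) ≠ 0 := by
  rw [h.c_s_add_ξ]
  exact mul_ne_zero (mul_ne_zero h.A_ne (h.u_ne _)) h.c'_ξ_ne

/-- This is the relation between consecutive constants imposed by the comparison at t = w_j + s + ξ.
-/
theorem recConst_succ (h : PairData τ s ξ A A' B₀ B₁ b β c c' u μ) (n : ℕ) :
    recConst s ξ B₀ B₁ c c' (n + 1) * (c (s + ξ) * B₁) =
      recConst s ξ B₀ B₁ c c' n * (c' (s + ξ) * B₀) := by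
  have := h.c_s_add_ξ_ne
  have := h.B₁_ne
  unfold recConst
  rw [pow_succ]
  field_simp

/-- At t = v + s + ξ one has b(t - v) = 0, so both pfaffians lose t and v, and the evaluation for
fewer variables applies. The leftover factors match because the shift by s exchanges b and β. -/
theorem evalDiff_cons_eq_zero (h : PairData τ s ξ A A' B₀ B₁ b β c c' u μ) {n : ℕ} {y v : ℂ}
    {x : Fin (2 * n) → ℂ}
    (ih : diffPf (n + 1) b c' (consVec (y + ξ) (consVec y x)) =
      recConst s ξ B₀ B₁ c c' n * (∏ j, b (y + ξ - x j) * β (y - x j)) * diffPf n b c x) :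
    evalDiff n b β c c' ξ y (recConst s ξ B₀ B₁ c c' (n + 1)) (consVec v x) (v + s + ξ) = 0 := by
  have hb0 : b (v + s + ξ - v) = 0 := by rw [show v + s + ξ - v = s + ξ by ring, h.b_at_s_add_ξ]
  unfold evalDiff
  rw [diffPf_cons_cons_cons_swap h.b_neg,
    diffPf_cons_cons_swap h.b_neg (n := n), neg_neg]
  have e1 := diffPf_cons_cons (n := n + 1) h.b_neg h.c'_neg hb0
    (consVec (y + ξ) (consVec y x))
  rw [diffPf_cons_cons h.b_neg h.c_neg hb0]
  refine (congrArg (· + _) (e1.trans (congrArg _ ih))).trans ?_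
  have e2 : ∏ k : Fin (2 * (n + 1)), b (v + s + ξ - consVec (y + ξ) (consVec y x) k) *
        b (v - consVec (y + ξ) (consVec y x) k) =
      b (v + s + ξ - (y + ξ)) * b (v - (y + ξ)) * (b (v + s + ξ - y) * b (v - y) *
        ∏ k, b (v + s + ξ - x k) * b (v - x k)) := by
    refine (Fin.prod_univ_succ (n := 2 * n + 1) _).trans ?_
    rw [Fin.prod_univ_succ]
    simp only [Fin.cons_zero, Fin.cons_succ]
  rw [e2, Fin.prod_univ_succ]
  simp only [Fin.cons_zero, Fin.cons_succ]
  rw [show v + s + ξ - v = s + ξ by ring]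
  have r1 : b (y + ξ - v) = b (v - (y + ξ)) := by rw [← h.b_neg]; ring_nf
  have r2 : β (y - v) = -β (v - y) := by rw [← h.β_neg]; ring_nf
  have r3 : b (v + s + ξ - y) = μ (v - y + s) * (B₀ * u (v - y) * β (v - y)) := by
    rw [← h.b_add_s, ← h.b_add_ξ]; ring_nf
  have r4 : β (v + s + ξ - y) = μ (v - y + s) * (B₁ * u (v - y) * b (v - y)) := by
    rw [← h.β_add_s, ← h.β_add_ξ]; ring_nf
  rw [r1, r2, r3, r4]
  linear_combination (-(b (v + s + ξ - (y + ξ)) * b (v - (y + ξ)) * μ (v - y + s) * u (v - y) *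
    β (v - y) * b (v - y) * (∏ k, b (v + s + ξ - x k) * b (v - x k)) *
    (∏ k, b (y + ξ - x k) * β (y - x k)) * diffPf n b c x)) * h.recConst_succ n

theorem diffPf_consVec_eq_zero (hb : ∀ z, b (-z) = b z) (hc : ∀ z, c (-z) = -c z) {n : ℕ} {t : ℂ}
    {w : Fin (2 * n + 1) → ℂ} (p : Fin (2 * n + 1)) (hb0 : b (t - w p) = 0)
    (hc0 : c (t - w p) = 0) : diffPf (n + 1) b c (consVec t w) = 0 :=
  diffPf_eq_zero (n := n + 1) hb hc (consVec t w) (i := (0 : Fin (2 * n + 1 + 1)))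
    (j := p.succ) (Fin.succ_ne_zero p).symm hb0 hc0

theorem diffPf_consVec_eq_zero_of_eq (hb : ∀ z, b (-z) = b z) {n : ℕ} {t : ℂ}
    {w : Fin (2 * n + 1) → ℂ} (p : Fin (2 * n + 1)) (h : t = w p) :
    diffPf (n + 1) b c (consVec t w) = 0 :=
  diffPf_eq_zero_of_eq (n := n + 1) hb (consVec t w) (i := (0 : Fin (2 * n + 1 + 1)))
    (j := p.succ) (Fin.succ_ne_zero p).symm h

/-- At all test points except w_j + s + ξ both summands vanish separately: the pfaffians have two
equal arguments or arguments that differ by s, where b, c and c' all vanish, and the prefactor of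
the second summand has b(s - ξ), b(s), β(0) or β(ξ) as a factor. -/
theorem evalDiff_eq_zero (hτ : 0 < τ.im) (h : PairData τ s ξ A A' B₀ B₁ b β c c' u μ) {n : ℕ}
    (ih : ∀ y (x : Fin (2 * n) → ℂ), diffPf (n + 1) b c' (consVec (y + ξ) (consVec y x)) =
      recConst s ξ B₀ B₁ c c' n * (∏ j, b (y + ξ - x j) * β (y - x j)) * diffPf n b c x)
    {y : ℂ} {w : Fin (2 * n + 1) → ℂ} (hyw : ∀ i, y - w i ∉ badSet τ ξ s)
    (hww : ∀ i j, i ≠ j → w i - w j ∉ badSet τ ξ s) (t : ℂ) :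
    evalDiff n b β c c' ξ y (recConst s ξ B₀ B₁ c c' (n + 1)) w t = 0 := by
  obtain ⟨R₁, hR₁⟩ := exists_diffPf_eq_rowSum (n := n + 1) h.b_neg h.c'_neg
    (consVec (y + ξ) (consVec y w))
  obtain ⟨R₂, hR₂⟩ := exists_diffPf_eq_rowSum h.b_neg h.c_neg w
  have e : ∀ t, evalDiff n b β c c' ξ y (recConst s ξ B₀ B₁ c c' (n + 1)) w t =
      recDiff b β c c' ξ y w R₁ R₂ (-(recConst s ξ B₀ B₁ c c' (n + 1) *
        ∏ j, b (y + ξ - w j) * β (y - w j))) t := fun t => by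
    unfold evalDiff recDiff
    rw [hR₂]
    refine (congrArg (· + _) (hR₁ t)).trans ?_
    ring
  rw [e]
  refine recDiff_eq_zero hτ h hyw hww ?_ ?_ t <;> intro i <;> rw [← e] <;> revert i
  · refine Fin.cases ?_ fun i => Fin.cases ?_ (fun j => ?_) i <;>
      simp only [Fin.cons_zero, Fin.cons_succ] <;> unfold evalDiff
    · rw [diffPf_consVec_eq_zero (n := n + 1) h.b_neg h.c'_neg (Fin.succ 0)
        (by simp [h.b_at_s]) (by simp [h.c'_at_s]),
        show y + s - (y + ξ) = s - ξ by ring, h.b_at_s_sub_ξ]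
      ring
    · rw [diffPf_consVec_eq_zero_of_eq (n := n + 1) h.b_neg (Fin.succ 0) (by simp), sub_self,
        h.β_at_zero]
      ring
    · rw [diffPf_consVec_eq_zero (n := n + 1) h.b_neg h.c'_neg j.succ.succ
        (by simp [h.b_at_s]) (by simp [h.c'_at_s]),
        diffPf_consVec_eq_zero h.b_neg h.c_neg j (by simp [h.b_at_s]) (by simp [h.symm.c'_at_s])]
      ring
  · refine Fin.cases ?_ fun i => Fin.cases ?_ (fun j => ?_) i <;>
      simp only [Fin.cons_zero, Fin.cons_succ]
    · have e0 : y + s + ξ - (y + ξ) = s := by ring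
      unfold evalDiff
      rw [diffPf_consVec_eq_zero (n := n + 1) h.b_neg h.c'_neg 0
        (by simp [e0, h.b_at_s]) (by simp [e0, h.c'_at_s]), e0, h.b_at_s]
      ring
    · unfold evalDiff
      rw [diffPf_consVec_eq_zero_of_eq (n := n + 1) h.b_neg 0 (by simp),
        show y + ξ - y = ξ by ring, h.β_at_ξ]
      ring
    · have e1 := evalDiff_comp h y (recConst s ξ B₀ B₁ c c' (n + 1)) w (w j + s + ξ)
        (Equiv.swap 0 j)
      have e2 : w ∘ Equiv.swap 0 j = consVec (w j) (fun i => w (Equiv.swap 0 j i.succ)) := by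
        funext i
        refine Fin.cases ?_ (fun i => ?_) i <;> simp
      rw [e2, evalDiff_cons_eq_zero h (ih y _)] at e1
      refine (mul_eq_zero.mp e1.symm).resolve_left ?_
      exact_mod_cast (Equiv.Perm.sign (Equiv.swap 0 j)).ne_zero

/-- The evaluation of the pfaffian at `z₁ = z₂ + ξ`. -/
theorem diffPf_add_ξ (hτ : 0 < τ.im) (h : PairData τ s ξ A A' B₀ B₁ b β c c' u μ) (n : ℕ) :
    ∀ y (x : Fin (2 * n) → ℂ), diffPf (n + 1) b c' (consVec (y + ξ) (consVec y x)) =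
      recConst s ξ B₀ B₁ c c' n * (∏ j, b (y + ξ - x j) * β (y - x j)) * diffPf n b c x := by
  induction n with
  | zero =>
    intro y x
    rw [diffPf_cons h.b_neg h.c'_neg]
    simp [diffPf_zero, recConst]
  | succ n ih =>
    intro y x
    -- W collects y and w, so that continuity removes the genericity assumption on all of them at
    -- once.
    have key : ∀ (t : ℂ) (W : Fin (2 * n + 2) → ℂ),
        evalDiff n b β c c' ξ (W 0) (recConst s ξ B₀ B₁ c c' (n + 1)) (fun i => W i.succ) t = 0 := by
      intro t
      have hbc := h.b_diff.continuous
      have hβc := h.β_diff.continuous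
      have hcons : ∀ {m : ℕ} {f : (Fin (2 * n + 2) → ℂ) → ℂ}
          {g : (Fin (2 * n + 2) → ℂ) → Fin m → ℂ}, Continuous f → Continuous g →
          Continuous fun W => consVec (f W) (g W) := fun hf hg =>
        continuous_pi (Fin.cases (by simpa using hf) fun i => 
          (continuous_apply i).comp hg)
      refine eq_of_eq_on_generic (τ := τ) (ξ := ξ) (s := s) (F := fun W : Fin (2 * n + 2) → ℂ =>
        evalDiff n b β c c' ξ (W 0) (recConst s ξ B₀ B₁ c c' (n + 1)) (fun i => W i.succ) t)
        (G := fun _ => 0) ?_ continuous_const fun W hW => ?_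
      · unfold evalDiff
        have c1 : Continuous fun W : Fin (2 * n + 2) → ℂ => diffPf (n + 2) b c'
            (consVec t (consVec (W 0 + ξ) (consVec (W 0) fun i => W i.succ))) :=
          (continuous_diffPf hbc h.c'_diff.continuous (n + 2)).comp
            (hcons (by fun_prop) (hcons (by fun_prop) (hcons (by fun_prop) (by fun_prop))))
        have c2 : Continuous fun W : Fin (2 * n + 2) → ℂ => diffPf (n + 1) b c
            (consVec t fun i => W i.succ) :=
          (continuous_diffPf hbc h.c_diff.continuous (n + 1)).comp
            (hcons (by fun_prop) (by fun_prop))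
        fun_prop
      · exact evalDiff_eq_zero hτ h ih (fun i => hW _ _ (Fin.succ_ne_zero i).symm)
          (fun i j hij => hW _ _ ((Fin.succ_injective _).ne hij)) t
    obtain ⟨t, w, rfl⟩ : ∃ (t : ℂ) (w : Fin (2 * n + 1) → ℂ), x = consVec t w :=
      ⟨x 0, fun i => x i.succ, by funext i; refine Fin.cases ?_ (fun i => ?_) i <;> simp⟩
    have e := key t (consVec y w)
    simp only [Fin.cons_zero, Fin.cons_succ] at e
    unfold evalDiff at e
    have e1 := diffPf_cons_cons_swap (c := c') h.b_neg (n := n) (y + ξ) y t w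
    have e2 := diffPf_cons_swap (c := c') h.b_neg (n := n + 1) (y + ξ) t (consVec y w)
    have e3 := Fin.prod_univ_succ (n := 2 * n + 1)
      fun j => b (y + ξ - consVec t w j) * β (y - consVec t w j)
    simp only [Fin.cons_zero, Fin.cons_succ] at e3
    -- Moving t to the front takes two transpositions and costs no sign. The oddness of β does,
    -- which is why `evalDiff` is a sum.
    have r1 : b (y + ξ - t) = b (t - (y + ξ)) := by rw [← h.b_neg]; ring_nf
    have r2 : β (y - t) = -β (t - y) := by rw [← h.β_neg]; ring_nf
    rw [r1, r2] at e3
    refine (e1.trans (congrArg Neg.neg e2)).trans ?_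
    rw [neg_neg]
    refine Eq.trans ?_ (congrArg (fun x => recConst s ξ B₀ B₁ c c' (n + 1) * x *
      diffPf (n + 1) b c (consVec t w)) e3.symm)
    linear_combination e

end PairData

/-! ### The shift of the first variable by s -/

namespace PairData

variable {τ s ξ A A' B₀ B₁ : ℂ} {b β c c' u μ : ℂ → ℂ}

/-- Here the constant of the theorem is determined: it must compensate `recConst` when both sides
are compared at t = w_j + ξ. -/
theorem const_mul_recConst (h : PairData τ s ξ A A' B₀ B₁ b β c c' u μ) (n : ℕ) :
    A * (B₀ * B₁ * (A * c' ξ) / (A' * c ξ)) ^ n * recConst s ξ B₀ B₁ c c' n =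
      A * c' ξ * B₀ ^ (2 * n) := by
  unfold recConst
  rw [h.c_s_add_ξ, h.c'_s_add_ξ]
  have := h.A_ne
  have := h.A'_ne
  have := h.B₁_ne
  have := h.c_ξ_ne
  have := h.c'_ξ_ne
  have := h.u_ne ξ
  have e : B₀ * B₁ * (A * c' ξ) / (A' * c ξ) *
      (A' * u ξ * c ξ * B₀ / (A * u ξ * c' ξ * B₁)) = B₀ ^ 2 := by
    field_simp
  rw [pow_mul, ← e, mul_pow]
  ring

/-- The difference of the two sides of the transformation formula. -/
def shiftDiff (n : ℕ) (b c c' u : ℂ → ℂ) (s K : ℂ) (w : Fin (2 * n + 1) → ℂ) (t : ℂ) : ℂ :=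
  diffPf (n + 1) b c (consVec (t + s) w) -
    K * (∏ j, u (t - w j)) * diffPf (n + 1) b c' (consVec t w)

theorem shiftDiff_comp (h : PairData τ s ξ A A' B₀ B₁ b β c c' u μ) {n : ℕ} (K : ℂ)
    (w : Fin (2 * n + 1) → ℂ) (t : ℂ) (σ : Equiv.Perm (Fin (2 * n + 1))) :
    shiftDiff n b c c' u s K (w ∘ σ) t =
      ((Equiv.Perm.sign σ : ℤ) : ℂ) * shiftDiff n b c c' u s K w t := by
  unfold shiftDiff
  have e : ∀ (c : ℂ → ℂ) (t : ℂ), diffPf (n + 1) b c (consVec t (w ∘ σ)) =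
      ((Equiv.Perm.sign σ : ℤ) : ℂ) * diffPf (n + 1) b c (consVec t w) := by
    intro c t
    rw [← consVec_comp_liftPerm]
    refine (diffPf_comp (n := n + 1) h.b_neg _ _).trans ?_
    rw [sign_liftPerm]
  have e3 := Equiv.prod_comp σ fun j => u (t - w j)
  rw [e, e]
  simp only [Function.comp_apply]
  rw [e3]
  ring

/-- The shifted pfaffian collapses because b(s + ξ) = 0, and the other one is evaluated by
`diffPf_add_ξ`. Both become multiples of the pfaffian of c in the variables x. -/
theorem shiftDiff_cons_eq_zero (hτ : 0 < τ.im) (h : PairData τ s ξ A A' B₀ B₁ b β c c' u μ)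
    {n : ℕ} {v : ℂ} {x : Fin (2 * n) → ℂ} :
    shiftDiff n b c c' u s (A * (B₀ * B₁ * (A * c' ξ) / (A' * c ξ)) ^ n) (consVec v x)
      (v + ξ) = 0 := by
  have hb0 : b (v + ξ + s - v) = 0 := by rw [show v + ξ + s - v = s + ξ by ring, h.b_at_s_add_ξ]
  unfold shiftDiff
  rw [diffPf_cons_cons h.b_neg h.c_neg hb0, h.diffPf_add_ξ hτ, Fin.prod_univ_succ]
  simp only [Fin.cons_zero, Fin.cons_succ]
  rw [show v + ξ + s - v = s + ξ by ring, add_sub_cancel_left, h.c_s_add_ξ]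
  have e : ∏ k, b (v + ξ + s - x k) * b (v - x k) =
      B₀ ^ (2 * n) * ((∏ k, u (v + ξ - x k)) * ∏ k, b (v + ξ - x k) * β (v - x k)) := by
    rw [← Finset.prod_mul_distrib]
    have : B₀ ^ (2 * n) = ∏ _k : Fin (2 * n), B₀ := by simp
    rw [this, ← Finset.prod_mul_distrib]
    refine Finset.prod_congr rfl fun k _ => ?_
    have e1 : b (v + ξ + s - x k) = B₀ * u (v + ξ - x k) * β (v + ξ - x k) := by
      rw [← h.b_add_s]; ring_nf
    have e2 : β (v + ξ - x k) = μ (v - x k) * β (v - x k) := by rw [← h.β_add_ξ]; ring_nf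
    have e3 : b (v + ξ - x k) = μ (v - x k) * b (v - x k) := by rw [← h.b_add_ξ]; ring_nf
    rw [e1, e2, e3]
    ring
  rw [e]
  linear_combination (-(u ξ * (∏ k, u (v + ξ - x k)) * (∏ k, b (v + ξ - x k) * β (v - x k)) *
    diffPf n b c x)) * h.const_mul_recConst n

/-- The difference of the two sides of the transformation formula, without monomials. -/
def rowDiff {m : ℕ} (b β c' : ℂ → ℂ) (w R₁ R₂ : Fin m → ℂ) (K₁ K₂ t : ℂ) : ℂ :=
  K₁ * rowSum β c' w R₁ t - K₂ * rowSum b c' w R₂ t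

/-- The comparison function is ∏ β(t - w_i), whose zeros are the points w_i + kξ modulo periods. The
signs of b and β drop out, because they occur to the even power 2n. -/
theorem rowDiff_eq_zero (hτ : 0 < τ.im) (h : PairData τ s ξ A A' B₀ B₁ b β c c' u μ) {n : ℕ}
    {w R₁ R₂ : Fin (2 * n + 1) → ℂ} {K₁ K₂ : ℂ}
    (hww : ∀ i j, i ≠ j → w i - w j ∉ badSet τ ξ s)
    (h0 : ∀ i, rowDiff b β c' w R₁ R₂ K₁ K₂ (w i) = 0)
    (h1 : ∀ i, rowDiff b β c' w R₁ R₂ K₁ K₂ (w i + ξ) = 0) (t : ℂ) :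
    rowDiff b β c' w R₁ R₂ K₁ K₂ t = 0 := by
  obtain ⟨N₁, eb, eβ, ec, ec', h₁⟩ := h.mult_one
  obtain ⟨N₂, fb, fβ, fc, fc', h₂⟩ := h.mult_τ
  have βd := h.β_diff
  have hD : ∀ {ω : ℂ} {N : ℂ → ℂ} {eb eβ ec ec' : ℂ}, SignMult ω N b β c c' eb eβ ec ec' → ∀ t,
      rowDiff b β c' w R₁ R₂ K₁ K₂ (t + ω) =
        ec' * (∏ k, N (t - w k)) * rowDiff b β c' w R₁ R₂ K₁ K₂ t := by
    intro ω N eb eβ ec ec' hm t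
    have e1 : eb ^ (2 * n) = 1 := by rw [pow_mul, hm.eb_sq, one_pow]
    have e2 : eβ ^ (2 * n) = 1 := by rw [pow_mul, hm.eβ_sq, one_pow]
    unfold rowDiff
    rw [rowSum_add _ _ hm.b_add hm.c'_add, rowSum_add _ _ hm.β_add hm.c'_add, Fintype.card_fin,
      Nat.add_sub_cancel, e1, e2]
    ring
  have hφ : ∀ {ω e : ℂ} {N : ℂ → ℂ}, (∀ z, β (z + ω) = e * N z * β z) → ∀ z,
      ∏ i, β (z + ω - w i) = e ^ (2 * n + 1) * (∏ k, N (z - w k)) * ∏ i, β (z - w i) := by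
    intro ω e N hβ z
    have hsub : ∀ x, z + ω - x = z - x + ω := fun x => by ring
    simp only [hsub, hβ, Finset.prod_mul_distrib, Finset.prod_const, card_univ, Fintype.card_fin]
  refine eq_zero_of_three_term (φ := fun i t => β (t - w i)) (v := w)
    (M := fun z => ∏ k, μ (z - w k)) hτ ?_ (fun i => by fun_prop)
    (fun i z hz => ?_) (fun i j hij z hz hz' => hww i j hij (h.sub_mem_badSet_ββ hz hz'))
    (fun i z hz => ?_)
    (fun z => Finset.prod_ne_zero_iff.mpr fun k _ => h₁.N_ne _)
    (fun z => Finset.prod_ne_zero_iff.mpr fun k _ => h₂.N_ne _)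
    (fun z => Finset.prod_ne_zero_iff.mpr fun k _ => h.μ_ne _)
    (norm_eq_one_of_sq h₁.swap.ec_sq) (norm_eq_one_of_sq h₂.swap.ec_sq)
    (b₁ := eβ ^ (2 * n + 1)) (b₂ := fβ ^ (2 * n + 1)) ?_ ?_
    (hD h₁) (hD h₂) (hφ h₁.β_add) (hφ h₂.β_add) ?_ ?_ h0 h1 t
  · have d1 := differentiable_rowSum w R₁ h.β_diff h.c'_diff
    have d2 := differentiable_rowSum w R₂ h.b_diff h.c'_diff
    unfold rowDiff
    fun_prop
  · rw [deriv_comp_sub_const]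
    exact h.β_simple _ hz
  · obtain ⟨k, m, l, e⟩ := h.β_zero _ hz
    exact ⟨k, m, l, by linear_combination e⟩
  · rw [norm_pow, norm_eq_one_of_sq h₁.eβ_sq, one_pow]
  · rw [norm_pow, norm_eq_one_of_sq h₂.eβ_sq, one_pow]
  · intro z
    have := hφ (e := 1) (N := μ) (fun z => by rw [h.β_add_ξ, one_mul]) z
    rwa [one_pow, one_mul] at this
  · intro z
    have h1 := rowSum_three_term w R₁ h.β_add_ξ h.c'_three z
    have h2 := rowSum_three_term w R₂ h.b_add_ξ h.c'_three z
    unfold rowDiff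
    linear_combination K₁ * h1 - K₂ * h2

theorem shiftDiff_eq_zero (hτ : 0 < τ.im) (h : PairData τ s ξ A A' B₀ B₁ b β c c' u μ) {n : ℕ}
    {w : Fin (2 * n + 1) → ℂ} (hww : ∀ i j, i ≠ j → w i - w j ∉ badSet τ ξ s) (t : ℂ) :
    shiftDiff n b c c' u s (A * (B₀ * B₁ * (A * c' ξ) / (A' * c ξ)) ^ n) w t = 0 := by
  obtain ⟨R₁, hR₁⟩ := exists_diffPf_eq_rowSum h.b_neg h.c_neg w
  obtain ⟨R₂, hR₂⟩ := exists_diffPf_eq_rowSum h.b_neg h.c'_neg w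
  -- The shift by s turns a row of b and c into a row of β and c'; the nonvanishing factor u splits
  -- off.
  have e : ∀ t, shiftDiff n b c c' u s (A * (B₀ * B₁ * (A * c' ξ) / (A' * c ξ)) ^ n) w t =
      (∏ k, u (t - w k)) * rowDiff b β c' w R₁ R₂ (A * B₀ ^ (2 * n))
        (A * (B₀ * B₁ * (A * c' ξ) / (A' * c ξ)) ^ n) t := fun t => by
    unfold shiftDiff rowDiff
    rw [hR₁, hR₂, rowSum_add _ _ h.b_add_s h.c_add_s, Fintype.card_fin, Nat.add_sub_cancel]
    ring
  have hu : ∀ t, ∏ k, u (t - w k) ≠ 0 := fun t => Finset.prod_ne_zero_iff.mpr fun k _ => h.u_ne _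
  rw [e, rowDiff_eq_zero hτ h hww, mul_zero]
  -- At t = w_j the shifted pfaffian contains b(s) = c(s) = 0, and the other one has two equal
  -- arguments.
  · intro j
    refine (mul_eq_zero.mp ((e (w j)).symm.trans ?_)).resolve_left (hu _)
    unfold shiftDiff
    rw [diffPf_consVec_eq_zero h.b_neg h.c_neg j (by simp [h.b_at_s]) (by simp [h.symm.c'_at_s]),
      diffPf_consVec_eq_zero_of_eq h.b_neg j rfl]
    ring
  · intro j
    refine (mul_eq_zero.mp ((e (w j + ξ)).symm.trans ?_)).resolve_left (hu _)
    have e1 := shiftDiff_comp h (A * (B₀ * B₁ * (A * c' ξ) / (A' * c ξ)) ^ n) w (w j + ξ)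
      (Equiv.swap 0 j)
    have e2 : w ∘ Equiv.swap 0 j = consVec (w j) (fun i => w (Equiv.swap 0 j i.succ)) := by
      funext i
      refine Fin.cases ?_ (fun i => ?_) i <;> simp
    rw [e2, shiftDiff_cons_eq_zero hτ h] at e1
    refine (mul_eq_zero.mp e1.symm).resolve_left ?_
    exact_mod_cast (Equiv.Perm.sign (Equiv.swap 0 j)).ne_zero

/-- The transformation of the pfaffian under the shift of its first variable by `s`. -/
theorem diffPf_add_s (hτ : 0 < τ.im) (h : PairData τ s ξ A A' B₀ B₁ b β c c' u μ) (n : ℕ) (t : ℂ)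
    (w : Fin (2 * n + 1) → ℂ) :
    diffPf (n + 1) b c (consVec (t + s) w) = A * (B₀ * B₁ * (A * c' ξ) / (A' * c ξ)) ^ n *
      (∏ j, u (t - w j)) * diffPf (n + 1) b c' (consVec t w) := by
  have hbc := h.b_diff.continuous
  have huc := h.u_cont
  have hcons : ∀ t : ℂ, Continuous fun w : Fin (2 * n + 1) → ℂ => consVec t w := fun t =>
    continuous_pi (Fin.cases (by simpa using continuous_const) fun i => by
      simpa using continuous_apply i)
  refine eq_of_eq_on_generic (τ := τ) (ξ := ξ) (s := s)
    (F := fun w => diffPf (n + 1) b c (consVec (t + s) w))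
    (G := fun w => A * (B₀ * B₁ * (A * c' ξ) / (A' * c ξ)) ^ n *
      (∏ j, u (t - w j)) * diffPf (n + 1) b c' (consVec t w)) ?_ ?_ (fun w hw => ?_) w
  · exact (continuous_diffPf hbc h.c_diff.continuous (n + 1)).comp (hcons _)
  · exact Continuous.mul (by fun_prop)
      ((continuous_diffPf hbc h.c'_diff.continuous (n + 1)).comp (hcons _))
  · exact sub_eq_zero.mp (shiftDiff_eq_zero hτ h hw t)

end PairData

/-! ### Infinite products and exponentials -/

theorem summable_norm_mul_pow (a : ℂ) {q : ℂ} (hq : ‖q‖ < 1) :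
    Summable fun j : ℕ => ‖-(a * q ^ j)‖ := by
  refine ((summable_geometric_of_lt_one (norm_nonneg q) hq).mul_left ‖a‖).congr fun j => ?_
  rw [norm_neg, norm_mul, norm_pow]

theorem multipliable_qProd (a : ℂ) {q : ℂ} (hq : ‖q‖ < 1) :
    Multipliable fun j : ℕ => 1 - a * q ^ j :=
  (multipliable_one_add_of_summable (summable_norm_mul_pow a hq)).congr fun _ =>
    (sub_eq_add_neg _ _).symm

theorem qProd_ne_zero {a q : ℂ} (hq : ‖q‖ < 1) (h : ∀ j : ℕ, a * q ^ j ≠ 1) : qProd a q ≠ 0 := by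
  unfold qProd
  simp_rw [sub_eq_add_neg]
  refine tprod_one_add_ne_zero_of_summable (fun j hj => h j ?_) (summable_norm_mul_pow a hq)
  linear_combination -hj

theorem differentiable_qProd {q : ℂ} (hq : ‖q‖ < 1) : Differentiable ℂ fun a => qProd a q := by
  intro a
  have hK : IsOpen (Metric.ball (0 : ℂ) (‖a‖ + 1)) := Metric.isOpen_ball
  have h := Summable.hasProdLocallyUniformlyOn_nat_one_add (f := fun (j : ℕ) (a : ℂ) => -(a * q ^ j)) hK
    ((summable_geometric_of_lt_one (norm_nonneg q) hq).mul_left (‖a‖ + 1))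
    (.of_forall fun j x hx => by
      rw [norm_neg, norm_mul, norm_pow]
      rw [Metric.mem_ball, dist_zero_right] at hx
      gcongr) (fun j => by fun_prop)
  have hd : DifferentiableOn ℂ (fun a => ∏' j : ℕ, (1 + -(a * q ^ j)))
      (Metric.ball (0 : ℂ) (‖a‖ + 1)) :=
    h.differentiableOn (.of_forall fun s => by
      simpa [Finset.prod_fn] using DifferentiableOn.finsetProd (fun _ _ => by fun_prop)) hK
  have := hd.differentiableAt (x := a) (hK.mem_nhds (by simp))
  simpa only [qProd, sub_eq_add_neg] using this

theorem theta_mul_nome (x q : ℂ) (hx : x ≠ 0) (hq0 : q ≠ 0) (hq : ‖q‖ < 1) :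
    theta (q * x) q = -x⁻¹ * theta x q := by
  rw [← theta_inv x q hx hq, ← theta_refl x⁻¹ q hq0, div_inv_eq_mul]

theorem xvar_add (z w : ℂ) : xvar (z + w) = xvar z * xvar w := by
  rw [xvar, xvar, xvar, ← exp_add]
  ring_nf

theorem xvar_neg (z : ℂ) : xvar (-z) = (xvar z)⁻¹ := by
  rw [xvar, xvar, ← exp_neg]
  ring_nf

theorem xvar_sub (z w : ℂ) : xvar (z - w) = xvar z / xvar w := by
  rw [sub_eq_add_neg, xvar_add, xvar_neg, div_eq_mul_inv]

theorem nome_eq_xvar (τ l : ℂ) : nome τ l = xvar (τ * l) := by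
  rw [nome, xvar]
  ring_nf

theorem xvar_pow (z : ℂ) (n : ℕ) : xvar z ^ n = xvar (n * z) := by
  rw [xvar, xvar, ← exp_nat_mul]
  ring_nf

theorem xvar_zero : xvar 0 = 1 := by simp [xvar]

theorem xvar_half : xvar (1 / 2) = I := by
  rw [xvar, show (Real.pi : ℂ) * I * (1 / 2) = Real.pi / 2 * I by ring, exp_pi_div_two_mul_I]

theorem xvar_one : xvar 1 = -1 := by
  rw [xvar, mul_one, exp_pi_mul_I]

theorem differentiable_xvar : Differentiable ℂ xvar := by
  unfold xvar
  fun_prop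

theorem xvar_eq_one_iff (z : ℂ) : xvar z = 1 ↔ ∃ m : ℤ, z = 2 * m := by
  rw [xvar, exp_eq_one_iff]
  have : (Real.pi : ℂ) * I ≠ 0 := mul_ne_zero (by exact_mod_cast Real.pi_ne_zero) I_ne_zero
  refine exists_congr fun m => ⟨fun h => ?_, fun h => ?_⟩
  · refine mul_left_cancel₀ this ?_
    linear_combination h
  · rw [h]
    ring

/-! ### Jacobi theta functions: shifts, zeros and simplicity of zeros -/

section theta

variable (t : ℂ)

/-- The odd Jacobi theta function, up to normalization. -/
def th1 (z : ℂ) : ℂ := (xvar z)⁻¹ * theta (xvar z ^ 2) (nome t 2)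

/-- The second Jacobi theta function, up to normalization. -/
def th2 (z : ℂ) : ℂ := (xvar z)⁻¹ * theta (-xvar z ^ 2) (nome t 2)

/-- The third Jacobi theta function, up to normalization. -/
def th3 (z : ℂ) : ℂ := theta (-(nome t 1 * xvar z ^ 2)) (nome t 2)

/-- The fourth Jacobi theta function, up to normalization. -/
def th4 (z : ℂ) : ℂ := theta (nome t 1 * xvar z ^ 2) (nome t 2)

theorem th1_add_half (z : ℂ) : th1 t (z + 1 / 2) = -I * th2 t z := by
  rw [th1, th2, xvar_add, xvar_half, mul_pow, I_sq, mul_inv, inv_I]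
  ring_nf

theorem th2_add_half (z : ℂ) : th2 t (z + 1 / 2) = -I * th1 t z := by
  rw [th1, th2, xvar_add, xvar_half, mul_pow, I_sq, mul_inv, inv_I]
  ring_nf

theorem th3_add_half (z : ℂ) : th3 t (z + 1 / 2) = th4 t z := by
  rw [th3, th4, xvar_add, xvar_half, mul_pow, I_sq]
  ring_nf

theorem th4_add_half (z : ℂ) : th4 t (z + 1 / 2) = th3 t z := by
  rw [th3, th4, xvar_add, xvar_half, mul_pow, I_sq]
  ring_nf

theorem xvar_half_sq : xvar (t / 2) ^ 2 = nome t 1 := by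
  rw [xvar_pow, nome_eq_xvar]
  congr 1
  push_cast
  ring

theorem nome_one_sq : nome t 1 * nome t 1 = nome t 2 := by
  rw [nome_double]
  norm_num

theorem xvar_half_inv : (xvar (t / 2))⁻¹ = nome t (-1 / 2) := by
  rw [← xvar_neg, nome_eq_xvar]
  ring_nf

theorem th1_add_half_period (z : ℂ) :
    th1 t (z + t / 2) = nome t (-1 / 2) * (xvar z)⁻¹ * th4 t z := by
  rw [th1, th4, xvar_add, mul_pow, xvar_half_sq, mul_inv, xvar_half_inv]
  ring_nf

theorem th2_add_half_period (z : ℂ) :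
    th2 t (z + t / 2) = nome t (-1 / 2) * (xvar z)⁻¹ * th3 t z := by
  rw [th2, th3, xvar_add, mul_pow, xvar_half_sq, mul_inv, xvar_half_inv]
  ring_nf

variable {t} (ht : 0 < t.im)
include ht

theorem norm_nome_two_lt : ‖nome t 2‖ < 1 := by
  have := norm_nome_lt t ht 2 (by norm_num)
  exact_mod_cast this

theorem th3_add_half_period (z : ℂ) : th3 t (z + t / 2) = (xvar z)⁻¹ * th2 t z := by
  have h := theta_mul_nome (-xvar z ^ 2) (nome t 2) (neg_ne_zero.mpr (pow_ne_zero _ (xvar_ne _)))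
    (nome_ne _ _) (norm_nome_two_lt ht)
  rw [th3, th2, xvar_add, mul_pow, xvar_half_sq]
  rw [show -(nome t 1 * (xvar z ^ 2 * nome t 1)) = nome t 2 * -xvar z ^ 2 by
    rw [← nome_one_sq]; ring, h]
  have := xvar_ne z
  field_simp

theorem th4_add_half_period (z : ℂ) : th4 t (z + t / 2) = -(xvar z)⁻¹ * th1 t z := by
  have h := theta_mul_nome (xvar z ^ 2) (nome t 2) (pow_ne_zero _ (xvar_ne _))
    (nome_ne _ _) (norm_nome_two_lt ht)
  rw [th4, th1, xvar_add, mul_pow, xvar_half_sq]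
  rw [show nome t 1 * (xvar z ^ 2 * nome t 1) = nome t 2 * xvar z ^ 2 by
    rw [← nome_one_sq]; ring, h]
  have := xvar_ne z
  field_simp

theorem differentiable_theta_comp {f : ℂ → ℂ} (hf : Differentiable ℂ f) (h0 : ∀ z, f z ≠ 0) :
    Differentiable ℂ fun z => theta (f z) (nome t 2) := by
  unfold theta
  have h := differentiable_qProd (norm_nome_two_lt ht)
  exact (h.comp hf).mul (h.comp ((differentiable_const _).div hf h0))

theorem differentiable_th1 : Differentiable ℂ (th1 t) := by
  have h := differentiable_xvar
  unfold th1
  exact (h.inv xvar_ne).mul (differentiable_theta_comp ht (h.pow 2)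
    fun z => pow_ne_zero _ (xvar_ne z))

theorem differentiable_th2 : Differentiable ℂ (th2 t) := by
  have h := differentiable_xvar
  unfold th2
  exact (h.inv xvar_ne).mul (differentiable_theta_comp ht (h.pow 2).neg
    fun z => neg_ne_zero.mpr (pow_ne_zero _ (xvar_ne z)))

theorem differentiable_th4 : Differentiable ℂ (th4 t) := by
  have h := differentiable_xvar
  unfold th4
  exact differentiable_theta_comp ht ((h.pow 2).const_mul _)
    fun z => mul_ne_zero (nome_ne _ _) (pow_ne_zero _ (xvar_ne z))

theorem differentiable_th3 : Differentiable ℂ (th3 t) := by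
  have h := differentiable_xvar
  unfold th3
  exact differentiable_theta_comp ht ((h.pow 2).const_mul _).neg
    fun z => neg_ne_zero.mpr (mul_ne_zero (nome_ne _ _) (pow_ne_zero _ (xvar_ne z)))

theorem th1_neg (z : ℂ) : th1 t (-z) = -th1 t z := by
  have := xvar_ne z
  rw [th1, th1, xvar_neg, inv_pow, theta_inv _ _ (pow_ne_zero _ this) (norm_nome_two_lt ht)]
  field_simp

theorem th2_neg (z : ℂ) : th2 t (-z) = th2 t z := by
  have := xvar_ne z
  rw [th2, th2, xvar_neg, inv_pow, neg_inv, theta_inv _ _ (neg_ne_zero.mpr (pow_ne_zero _ this))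
    (norm_nome_two_lt ht)]
  field_simp

omit ht in
theorem th3_neg (z : ℂ) : th3 t (-z) = th3 t z := by
  have := xvar_ne z
  have := nome_ne t 1
  rw [th3, th3, xvar_neg, ← theta_refl _ _ (nome_ne _ _), ← nome_one_sq]
  congr 1
  field_simp

omit ht in
theorem th4_neg (z : ℂ) : th4 t (-z) = th4 t z := by
  have := xvar_ne z
  have := nome_ne t 1
  rw [th4, th4, xvar_neg, ← theta_refl _ _ (nome_ne _ _), ← nome_one_sq]
  congr 1
  field_simp

omit ht in
theorem th1_add_one (z : ℂ) : th1 t (z + 1) = -th1 t z := by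
  rw [show z + 1 = z + 1 / 2 + 1 / 2 by ring, th1_add_half, th2_add_half]
  linear_combination th1 t z * I_sq

omit ht in
theorem th2_add_one (z : ℂ) : th2 t (z + 1) = -th2 t z := by
  rw [show z + 1 = z + 1 / 2 + 1 / 2 by ring, th2_add_half, th1_add_half]
  linear_combination th2 t z * I_sq

omit ht in
theorem th3_add_one (z : ℂ) : th3 t (z + 1) = th3 t z := by
  rw [show z + 1 = z + 1 / 2 + 1 / 2 by ring, th3_add_half, th4_add_half]

omit ht in
theorem th4_add_one (z : ℂ) : th4 t (z + 1) = th4 t z := by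
  rw [show z + 1 = z + 1 / 2 + 1 / 2 by ring, th4_add_half, th3_add_half]

omit ht in
/-- The multiplier of the theta functions for the period `t`. -/
theorem half_period_mult (z : ℂ) :
    nome t (-1 / 2) * (xvar z)⁻¹ * (xvar (z + t / 2))⁻¹ = nome t (-1) * xvar (-(2 * z)) := by
  simp only [nome_eq_xvar, ← xvar_neg, ← xvar_add]
  ring_nf

theorem th1_add_period (z : ℂ) : th1 t (z + t) = -(nome t (-1) * xvar (-(2 * z))) * th1 t z := by
  rw [← half_period_mult, show z + t = z + t / 2 + t / 2 by ring, th1_add_half_period,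
    th4_add_half_period ht, xvar_add, mul_inv, xvar_half_inv]
  ring

theorem th2_add_period (z : ℂ) : th2 t (z + t) = nome t (-1) * xvar (-(2 * z)) * th2 t z := by
  rw [← half_period_mult, show z + t = z + t / 2 + t / 2 by ring, th2_add_half_period,
    th3_add_half_period ht, xvar_add, mul_inv, xvar_half_inv]
  ring

theorem th3_add_period (z : ℂ) : th3 t (z + t) = nome t (-1) * xvar (-(2 * z)) * th3 t z := by
  rw [← half_period_mult, show z + t = z + t / 2 + t / 2 by ring, th3_add_half_period ht,
    th2_add_half_period, xvar_add, mul_inv, xvar_half_inv]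
  ring

theorem th4_add_period (z : ℂ) : th4 t (z + t) = -(nome t (-1) * xvar (-(2 * z))) * th4 t z := by
  rw [← half_period_mult, show z + t = z + t / 2 + t / 2 by ring, th4_add_half_period ht,
    th1_add_half_period, xvar_add, mul_inv, xvar_half_inv]
  ring

/-- The first infinite product vanishes only at points with l ≤ 0, the second only at points with l
≥ 1. -/
theorem th1_eq_zero {z : ℂ} (hz : th1 t z = 0) : ∃ m l : ℤ, z = m + l * t := by
  have hq := norm_nome_two_lt ht
  have h := (mul_eq_zero.mp hz).resolve_left (inv_ne_zero (xvar_ne z))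
  rcases mul_eq_zero.mp h with h | h
  · by_contra hne
    refine qProd_ne_zero hq (fun j hj => hne ?_) h
    rw [nome_eq_xvar, xvar_pow, xvar_pow, ← xvar_add, xvar_eq_one_iff] at hj
    obtain ⟨m, hm⟩ := hj
    refine ⟨m, -j, ?_⟩
    push_cast at hm ⊢
    linear_combination hm / 2
  · by_contra hne
    refine qProd_ne_zero hq (fun j hj => hne ?_) h
    rw [nome_eq_xvar, xvar_pow, xvar_pow, div_eq_mul_inv, ← xvar_neg, ← xvar_add, ← xvar_add,
      xvar_eq_one_iff] at hj
    obtain ⟨m, hm⟩ := hj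
    refine ⟨-m, j + 1, ?_⟩
    push_cast at hm ⊢
    linear_combination -hm / 2

theorem qProd_nome_ne_zero : qProd (nome t 2) (nome t 2) ≠ 0 := by
  have hq := norm_nome_two_lt ht
  refine qProd_ne_zero hq fun j hj => ?_
  have := congrArg norm hj
  rw [norm_mul, norm_pow, norm_one, ← pow_succ'] at this
  exact (pow_lt_one₀ (norm_nonneg _) hq (Nat.succ_ne_zero j)).ne this

theorem deriv_th1_zero_ne : deriv (th1 t) 0 ≠ 0 := by
  have hq := norm_nome_two_lt ht
  have hx := differentiable_xvar
  have hQ := differentiable_qProd hq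
  -- Only the split factor 1 - x² vanishes at z = 0; the rest takes the value (q; q)_∞² ≠ 0 there.
  have e : th1 t = fun z => (1 - xvar z ^ 2) * ((xvar z)⁻¹ *
      (qProd (xvar z ^ 2 * nome t 2) (nome t 2) * qProd (nome t 2 / xvar z ^ 2) (nome t 2))) := by
    funext z
    rw [th1, theta, qProd_step _ _ hq]
    ring
  have hd : Differentiable ℂ fun z => (xvar z)⁻¹ *
      (qProd (xvar z ^ 2 * nome t 2) (nome t 2) * qProd (nome t 2 / xvar z ^ 2) (nome t 2)) :=
    (hx.inv xvar_ne).mul ((hQ.comp ((hx.pow 2).mul_const _)).mul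
      (hQ.comp ((differentiable_const _).div (hx.pow 2) fun z => pow_ne_zero _ (xvar_ne z))))
  have hd1 : HasDerivAt (fun z => 1 - xvar z ^ 2) (-(2 * (Real.pi * I))) 0 := by
    have h1 : HasDerivAt xvar (Real.pi * I) 0 := by
      have := ((hasDerivAt_id (0 : ℂ)).const_mul (Real.pi * I)).cexp
      simpa [xvar] using! this
    have := (h1.pow 2).const_sub 1
    simpa [xvar_zero] using! this
  rw [e, (hd1.fun_mul (hd 0).hasDerivAt).deriv]
  simp only [xvar_zero, one_pow, one_mul, div_one, sub_self, zero_mul, add_zero, inv_one]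
  refine mul_ne_zero (neg_ne_zero.mpr (mul_ne_zero two_ne_zero (mul_ne_zero ?_ I_ne_zero)))
    (mul_ne_zero (qProd_nome_ne_zero ht) (qProd_nome_ne_zero ht))
  exact_mod_cast Real.pi_ne_zero

/-- Quasi-periodicity with nonvanishing multipliers transports the simplicity of the zero at 0 to
the whole lattice. -/
theorem deriv_th1_ne {z : ℂ} (hz : th1 t z = 0) : deriv (th1 t) z ≠ 0 := by
  have key : ∀ (ω : ℂ) (F : ℂ → ℂ), Differentiable ℂ F → (∀ z, F z ≠ 0) →
      (∀ z, th1 t (z + ω) = F z * th1 t z) →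
      Function.Periodic (fun z => th1 t z = 0 ∧ deriv (th1 t) z ≠ 0) ω := by
    intro ω F hF hF0 h z
    have hiff : th1 t (z + ω) = 0 ↔ th1 t z = 0 := by rw [h]; simp [hF0]
    refine propext ?_
    simp only [hiff]
    refine and_congr_right fun h0 => not_congr ?_
    have e1 : deriv (fun z => th1 t (z + ω)) z = deriv (fun z => F z * th1 t z) z := by
      simp only [h]
    rw [deriv_comp_add_const, deriv_fun_mul (hF z) (differentiable_th1 ht z), h0, mul_zero,
      zero_add] at e1
    rw [e1]
    simp [hF0]
  have p1 := key 1 (fun _ => -1) (by fun_prop) (by simp) fun z => by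
    rw [th1_add_one, neg_one_mul]
  have p2 := key t (fun z => -(nome t (-1) * xvar (-(2 * z)))) (by
    have := differentiable_xvar
    fun_prop) (fun z => neg_ne_zero.mpr (mul_ne_zero (nome_ne _ _) (xvar_ne _)))
    (th1_add_period ht)
  obtain ⟨m, l, rfl⟩ := th1_eq_zero ht hz
  have e1 := p2.int_mul l (m : ℂ)
  have e2 := p1.int_mul m (0 : ℂ)
  rw [zero_add, mul_one] at e2
  have h0 : th1 t 0 = 0 := by
    have := th1_neg ht 0
    rw [neg_zero] at this
    linear_combination this / 2
  exact (e1.mpr (e2.mpr ⟨h0, deriv_th1_zero_ne ht⟩)).2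

theorem th2_eq_zero {z : ℂ} (hz : th2 t z = 0) : ∃ m l : ℤ, z = 1 / 2 + m + l * t := by
  obtain ⟨m, l, h⟩ := th1_eq_zero ht (z := z + 1 / 2) (by rw [th1_add_half, hz, mul_zero])
  exact ⟨m - 1, l, by push_cast; linear_combination h⟩

theorem th4_eq_zero {z : ℂ} (hz : th4 t z = 0) : ∃ m l : ℤ, z = t / 2 + m + l * t := by
  obtain ⟨m, l, h⟩ := th1_eq_zero ht (z := z + t / 2) (by rw [th1_add_half_period, hz, mul_zero])
  exact ⟨m, l - 1, by push_cast; linear_combination h⟩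

theorem th3_eq_zero {z : ℂ} (hz : th3 t z = 0) : ∃ m l : ℤ, z = (1 + t) / 2 + m + l * t := by
  obtain ⟨m, l, h⟩ := th4_eq_zero ht (z := z + 1 / 2) (by rw [th4_add_half, hz])
  exact ⟨m - 1, l, by push_cast; linear_combination h⟩

omit ht in
theorem deriv_ne_zero_of_add {f g F : ℂ → ℂ} {ω : ℂ} (hf : Differentiable ℂ f)
    (hF : Differentiable ℂ F) (h : ∀ z, g (z + ω) = F z * f z)
    (hg : ∀ z, g z = 0 → deriv g z ≠ 0) {z : ℂ} (hz : f z = 0) : deriv f z ≠ 0 := by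
  intro h0
  have e1 : deriv (fun z => g (z + ω)) z = deriv (fun z => F z * f z) z := by
    simp only [h]
  rw [deriv_comp_add_const, deriv_fun_mul (hF z) (hf z), hz, h0, mul_zero, mul_zero,
    zero_add] at e1
  exact hg _ (by rw [h, hz, mul_zero]) e1

end theta

/-! ### Theta functions of degree three and the three-term relation -/

/-- The multiplier for the period `τ` of theta functions of degree three. -/
def cubicMult (τ z : ℂ) : ℂ := nome τ (-3) * xvar (-(6 * z))

theorem cubicMult_ne (τ z : ℂ) : cubicMult τ z ≠ 0 := mul_ne_zero (nome_ne _ _) (xvar_ne _)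

/-- Theta functions of degree three with multipliers `e₁` and `e₂`, up to the common factor. -/
structure IsCubic (τ e₁ e₂ : ℂ) (f : ℂ → ℂ) : Prop where
  diff : Differentiable ℂ f
  sq₁ : e₁ ^ 2 = 1
  sq₂ : e₂ ^ 2 = 1
  add_one : ∀ z, f (z + 1) = e₁ * f z
  add_τ : ∀ z, f (z + τ) = e₂ * cubicMult τ z * f z

/-- Four theta functions of degree three, with `ξ` of order three modulo the periods, that are
eigenfunctions of the shift by `ξ` and are exchanged by the shifts by half periods. -/
structure ThetaFrame (τ ξ κ a₁ a₂ a₃ a₄ : ℂ) (T₁ T₂ T₃ T₄ μ : ℂ → ℂ) : Prop where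
  im_pos : 0 < τ.im
  cubic₁ : IsCubic τ (-1) (-1) T₁
  cubic₂ : IsCubic τ (-1) 1 T₂
  cubic₃ : IsCubic τ 1 1 T₃
  cubic₄ : IsCubic τ 1 (-1) T₄
  neg₁ : ∀ z, T₁ (-z) = -T₁ z
  neg₂ : ∀ z, T₂ (-z) = T₂ z
  neg₃ : ∀ z, T₃ (-z) = T₃ z
  neg₄ : ∀ z, T₄ (-z) = T₄ z
  μ_diff : Differentiable ℂ μ
  μ_ne : ∀ z, μ z ≠ 0
  μ_neg : μ (-ξ) * μ 0 = 1
  μ_add_one : ∀ z, μ (z + 1) = μ z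
  μ_add_τ : ∀ z, μ (z + τ) * cubicMult τ z = cubicMult τ (z + ξ) * μ z
  -- In both cases below 3ξ is twice a basic period (2 or 2τ), so the sign of the multiplier is
  -- squared away and one rule serves all f.
  add_three_ξ : ∀ e₁ e₂ f, IsCubic τ e₁ e₂ f → ∀ z,
    f (z + ξ + ξ + ξ) = μ z * μ (z + ξ) * μ (z + ξ + ξ) * f z
  add_ξ₁ : ∀ z, T₁ (z + ξ) = μ z * T₁ z
  add_ξ₂ : ∀ z, T₂ (z + ξ) = μ z * T₂ z
  add_ξ₃ : ∀ z, T₃ (z + ξ) = μ z * T₃ z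
  add_ξ₄ : ∀ z, T₄ (z + ξ) = μ z * T₄ z
  κ_ne : κ ≠ 0
  a₁_ne : a₁ ≠ 0
  a₂_ne : a₂ ≠ 0
  a₄_ne : a₄ ≠ 0
  add_half₁ : ∀ z, T₁ (z + 1 / 2) = κ * T₂ z
  add_half₂ : ∀ z, T₂ (z + 1 / 2) = κ * T₁ z
  add_half₃ : ∀ z, T₃ (z + 1 / 2) = T₄ z
  add_half₄ : ∀ z, T₄ (z + 1 / 2) = T₃ z
  add_half_τ₁ : ∀ z, T₁ (z + τ / 2) = a₁ * xvar (-(3 * z)) * T₄ z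
  add_half_τ₂ : ∀ z, T₂ (z + τ / 2) = a₂ * xvar (-(3 * z)) * T₃ z
  add_half_τ₃ : ∀ z, T₃ (z + τ / 2) = a₃ * xvar (-(3 * z)) * T₂ z
  add_half_τ₄ : ∀ z, T₄ (z + τ / 2) = a₄ * xvar (-(3 * z)) * T₁ z
  zero₁ : ∀ z, T₁ z = 0 → ∃ k m l : ℤ, z = k * ξ + m + l * τ
  simple₁ : ∀ z, T₁ z = 0 → deriv T₁ z ≠ 0
  -- The half periods stay nontrivial modulo ξ and the periods, which separates the zeros of b and
  -- β.
  half_mem : ∀ i j k m l : ℤ, (i / 2 + j / 2 * τ : ℂ) = k * ξ + m + l * τ → Even i ∧ Even j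
  two_ξ : ∀ m l : ℤ, 2 * ξ ≠ m + l * τ

/-- The product of the theta functions number `1`, `2` and `4`. -/
def c124 (τ z : ℂ) : ℂ := th1 τ z * th2 τ z * th4 τ z

/-- The product of the theta functions number `1`, `2` and `3`. -/
def c123 (τ z : ℂ) : ℂ := th1 τ z * th2 τ z * th3 τ z

/-- The product of the theta functions number `1`, `3` and `4`. -/
def c134 (τ z : ℂ) : ℂ := th1 τ z * th3 τ z * th4 τ z

theorem cubicMult_eq (τ z : ℂ) : cubicMult τ z = (nome τ (-1) * xvar (-(2 * z))) ^ 3 := by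
  rw [cubicMult, mul_pow, nome_eq_xvar, nome_eq_xvar, xvar_pow, xvar_pow, ← xvar_add, ← xvar_add]
  congr 1
  push_cast
  ring

section numerators

variable {τ : ℂ} (hτ : 0 < τ.im)
include hτ

theorem isCubic_c124 : IsCubic τ 1 1 (c124 τ) where
  diff := ((differentiable_th1 hτ).mul (differentiable_th2 hτ)).mul (differentiable_th4 hτ)
  sq₁ := by norm_num
  sq₂ := by norm_num
  add_one z := by
    rw [c124, c124, th1_add_one, th2_add_one, th4_add_one]
    ring
  add_τ z := by
    rw [c124, c124, cubicMult_eq, th1_add_period hτ, th2_add_period hτ, th4_add_period hτ]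
    ring

theorem isCubic_c123 : IsCubic τ 1 (-1) (c123 τ) where
  diff := ((differentiable_th1 hτ).mul (differentiable_th2 hτ)).mul (differentiable_th3 hτ)
  sq₁ := by norm_num
  sq₂ := by norm_num
  add_one z := by
    rw [c123, c123, th1_add_one, th2_add_one, th3_add_one]
    ring
  add_τ z := by
    rw [c123, c123, cubicMult_eq, th1_add_period hτ, th2_add_period hτ, th3_add_period hτ]
    ring

theorem isCubic_c134 : IsCubic τ (-1) 1 (c134 τ) where
  diff := ((differentiable_th1 hτ).mul (differentiable_th3 hτ)).mul (differentiable_th4 hτ)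
  sq₁ := by norm_num
  sq₂ := by norm_num
  add_one z := by
    rw [c134, c134, th1_add_one, th3_add_one, th4_add_one]
    ring
  add_τ z := by
    rw [c134, c134, cubicMult_eq, th1_add_period hτ, th3_add_period hτ, th4_add_period hτ]
    ring

theorem c124_neg (z : ℂ) : c124 τ (-z) = -c124 τ z := by
  rw [c124, c124, th1_neg hτ, th2_neg hτ, th4_neg]
  ring

theorem c123_neg (z : ℂ) : c123 τ (-z) = -c123 τ z := by
  rw [c123, c123, th1_neg hτ, th2_neg hτ, th3_neg]
  ring

theorem c134_neg (z : ℂ) : c134 τ (-z) = -c134 τ z := by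
  rw [c134, c134, th1_neg hτ, th3_neg, th4_neg]
  ring

omit hτ in
theorem c124_add_half (z : ℂ) : c124 τ (z + 1 / 2) = -1 * 1 * c123 τ z := by
  rw [c124, c123, th1_add_half, th2_add_half, th4_add_half]
  linear_combination th1 τ z * th2 τ z * th3 τ z * I_sq

omit hτ in
theorem c123_add_half (z : ℂ) : c123 τ (z + 1 / 2) = -1 * 1 * c124 τ z := by
  rw [c124, c123, th1_add_half, th2_add_half, th3_add_half]
  linear_combination th1 τ z * th2 τ z * th4 τ z * I_sq

omit hτ in
theorem c134_add_half (z : ℂ) : c134 τ (z + 1 / 2) = -I * (th2 τ z * th3 τ z * th4 τ z) := by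
  rw [c134, th1_add_half, th3_add_half, th4_add_half]
  ring

omit hτ in
theorem xvar_inv_cube (z : ℂ) : (xvar z)⁻¹ ^ 3 = xvar (-(3 * z)) := by
  rw [← xvar_neg, xvar_pow]
  congr 1
  push_cast
  ring

omit hτ in
theorem nome_neg_half_sq : nome τ (-1 / 2) ^ 2 = nome τ (-1) := by
  rw [pow_two, nome_double]
  norm_num

theorem c124_add_half_τ (z : ℂ) :
    c124 τ (z + τ / 2) = -nome τ (-1) * xvar (-(3 * z)) * c134 τ z := by
  rw [c124, c134, th1_add_half_period, th2_add_half_period, th4_add_half_period hτ,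
    ← xvar_inv_cube, ← nome_neg_half_sq]
  ring

theorem c134_add_half_τ (z : ℂ) :
    c134 τ (z + τ / 2) = -nome τ (-1 / 2) * xvar (-(3 * z)) * c124 τ z := by
  rw [c124, c134, th1_add_half_period, th3_add_half_period hτ, th4_add_half_period hτ,
    ← xvar_inv_cube]
  ring

theorem c123_add_half_one_τ (z : ℂ) :
    c123 τ (z + (τ + 1) / 2) = nome τ (-1) * xvar (-(3 * z)) * c134 τ z := by
  rw [show z + (τ + 1) / 2 = z + τ / 2 + 1 / 2 by ring, c123_add_half, c124_add_half_τ hτ]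
  ring

theorem c134_add_half_one_τ (z : ℂ) :
    c134 τ (z + (τ + 1) / 2) = I * nome τ (-1 / 2) * xvar (-(3 * z)) * c123 τ z := by
  rw [show z + (τ + 1) / 2 = z + τ / 2 + 1 / 2 by ring, c134_add_half, th2_add_half_period,
    th3_add_half_period hτ, th4_add_half_period hτ, c123, ← xvar_inv_cube]
  ring

end numerators

namespace ThetaFrame

variable {τ ξ κ a₁ a₂ a₃ a₄ : ℂ} {T₁ T₂ T₃ T₄ μ : ℂ → ℂ}
variable (F : ThetaFrame τ ξ κ a₁ a₂ a₃ a₄ T₁ T₂ T₃ T₄ μ)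
include F

/-- The sum D of the weighted translates is an eigenfunction of the shift by ξ and vanishes at 0
because c is odd. Hence it vanishes at all zeros of T₁(z + 2ξ) and is a multiple of it. The two have
different signs for the period 1 or τ, so the multiple is zero. -/
theorem three_term {e₁ e₂ : ℂ} {c : ℂ → ℂ} (hc : IsCubic τ e₁ e₂ c) (hodd : ∀ z, c (-z) = -c z)
    (he : e₁ ≠ -1 ∨ e₂ ≠ -1) (z : ℂ) :
    c z * μ z * μ (z + ξ) + c (z + ξ) * μ (z + ξ) + c (z + ξ + ξ) = 0 := by
  set D : ℂ → ℂ := fun z => c z * μ z * μ (z + ξ) + c (z + ξ) * μ (z + ξ) + c (z + ξ + ξ) with hD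
  have dc := hc.diff
  have dμ := F.μ_diff
  have dT := F.cubic₁.diff
  have c0 : c 0 = 0 := by
    have := hodd 0
    rw [neg_zero] at this
    linear_combination this / 2
  have hD1 : ∀ z, D (z + 1) = e₁ * 1 * D z := fun z => by
    simp only [hD]
    have r : ∀ x, z + 1 + x = z + x + 1 := fun x => by ring
    rw [r, show z + ξ + 1 + ξ = z + ξ + ξ + 1 by ring, hc.add_one, hc.add_one, hc.add_one,
      F.μ_add_one, F.μ_add_one]
    ring
  have hDτ : ∀ z, D (z + τ) = e₂ * cubicMult τ (z + ξ + ξ) * D z := fun z => by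
    simp only [hD]
    have r : ∀ x, z + τ + x = z + x + τ := fun x => by ring
    rw [r, show z + ξ + τ + ξ = z + ξ + ξ + τ by ring, hc.add_τ, hc.add_τ, hc.add_τ]
    have m1 := F.μ_add_τ z
    have m2 := F.μ_add_τ (z + ξ)
    linear_combination (e₂ * c z * μ (z + ξ + τ)) * m1 + (e₂ * c z * μ z + e₂ * c (z + ξ)) * m2
  have hDξ : ∀ z, D (z + ξ) = μ (z + ξ + ξ) * D z := fun z => by
    simp only [hD]
    rw [F.add_three_ξ _ _ _ hc]
    ring
  -- Write 2ξ = -ξ + 3ξ: by oddness c(2ξ) is a multiple of c(ξ), and `μ_neg` makes it cancel the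
  -- middle term.
  have hD0 : D 0 = 0 := by
    simp only [hD, zero_add]
    have h3 := F.add_three_ξ _ _ _ hc (-ξ)
    rw [neg_add_cancel, zero_add, hodd] at h3
    rw [c0, h3]
    linear_combination (-c ξ * μ ξ) * F.μ_neg
  have p1 : Function.Periodic (fun z => D z = 0) 1 := fun z => by
    have : e₁ ≠ 0 := fun h => by simpa [h] using hc.sq₁
    simp [hD1, this]
  have p2 : Function.Periodic (fun z => D z = 0) τ := fun z => by
    have : e₂ ≠ 0 := fun h => by simpa [h] using hc.sq₂
    simp [hDτ, this, cubicMult_ne]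
  have p3 : Function.Periodic (fun z => D z = 0) ξ := fun z => by
    simp [hDξ, F.μ_ne]
  have hg1 : ∀ z, T₁ (z + ξ + ξ) = μ (z + ξ) * μ z * T₁ z := fun z => by
    rw [F.add_ξ₁, F.add_ξ₁]
    ring
  obtain ⟨K, hK⟩ := exists_eq_const_mul (f := D) (g := fun z => T₁ (z + (ξ + ξ)))
    (N₁ := fun _ => 1) (N₂ := fun z => cubicMult τ (z + ξ + ξ)) (b₁ := -1) (b₂ := -1) F.im_pos
    (by simp only [hD]; fun_prop) (by fun_prop)
    (fun z hz => by
      rw [deriv_comp_add_const]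
      exact F.simple₁ _ hz)
    (fun z hz => by
      obtain ⟨k, m, l, e⟩ := F.zero₁ _ hz
      rw [show z = 0 + ((k - 2 : ℤ) : ℂ) * ξ + (m : ℂ) * 1 + (l : ℂ) * τ by
        push_cast; linear_combination e]
      have q2 := p2.int_mul l (0 + ((k - 2 : ℤ) : ℂ) * ξ + (m : ℂ) * 1)
      have q1 := p1.int_mul m (0 + ((k - 2 : ℤ) : ℂ) * ξ)
      have q3 := p3.int_mul (k - 2) 0
      exact q2.mpr (q1.mpr (q3.mpr hD0)))
    (fun _ => one_ne_zero) (fun z => cubicMult_ne _ _)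
    (norm_eq_one_of_sq hc.sq₁) (norm_eq_one_of_sq hc.sq₂) (by simp) (by simp) hD1 hDτ
    (fun z => by
      rw [show z + 1 + (ξ + ξ) = z + (ξ + ξ) + 1 by ring, F.cubic₁.add_one]
      ring)
    (fun z => by
      rw [show z + τ + (ξ + ξ) = z + (ξ + ξ) + τ by ring, F.cubic₁.add_τ]
      ring_nf)
  have key : D z = 0 := by
    rcases he with he | he
    · have h1 := hK (z + 1)
      rw [hD1, hK z, show z + 1 + (ξ + ξ) = z + (ξ + ξ) + 1 by ring, F.cubic₁.add_one] at h1
      have h2 : (e₁ + 1) * (K * T₁ (z + (ξ + ξ))) = 0 := by linear_combination h1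
      rw [hK z]
      exact (mul_eq_zero.mp h2).resolve_left fun h => he (by linear_combination h)
    · have h1 := hK (z + τ)
      rw [hDτ, hK z, show z + τ + (ξ + ξ) = z + (ξ + ξ) + τ by ring, F.cubic₁.add_τ] at h1
      have h2 : (e₂ + 1) * cubicMult τ (z + (ξ + ξ)) * (K * T₁ (z + (ξ + ξ))) = 0 := by
        rw [show z + ξ + ξ = z + (ξ + ξ) by ring] at h1
        linear_combination h1
      rw [hK z]
      refine (mul_eq_zero.mp h2).resolve_left (mul_ne_zero (fun h => he ?_) (cubicMult_ne _ _))
      linear_combination h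
  exact key

/-- The zeros of the Jacobi functions are half periods, whereas 2ξ is not a period. The values at ξ
occur in the denominators of the constants. -/
theorem th1_ξ_ne : th1 τ ξ ≠ 0 := fun h => by
  obtain ⟨m, l, e⟩ := th1_eq_zero F.im_pos h
  exact F.two_ξ (2 * m) (2 * l) (by push_cast; linear_combination 2 * e)

theorem th2_ξ_ne : th2 τ ξ ≠ 0 := fun h => by
  obtain ⟨m, l, e⟩ := th2_eq_zero F.im_pos h
  exact F.two_ξ (2 * m + 1) (2 * l) (by push_cast; linear_combination 2 * e)

theorem th3_ξ_ne : th3 τ ξ ≠ 0 := fun h => by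
  obtain ⟨m, l, e⟩ := th3_eq_zero F.im_pos h
  exact F.two_ξ (2 * m + 1) (2 * l + 1) (by push_cast; linear_combination 2 * e)

theorem th4_ξ_ne : th4 τ ξ ≠ 0 := fun h => by
  obtain ⟨m, l, e⟩ := th4_eq_zero F.im_pos h
  exact F.two_ξ (2 * m) (2 * l + 1) (by push_cast; linear_combination 2 * e)

theorem zero₂ (z : ℂ) (hz : T₂ z = 0) : ∃ k m l : ℤ, z = 1 / 2 + k * ξ + m + l * τ := by
  obtain ⟨k, m, l, e⟩ := F.zero₁ (z + 1 / 2) (by rw [F.add_half₁, hz, mul_zero])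
  exact ⟨k, m - 1, l, by push_cast; linear_combination e⟩

theorem zero₄ (z : ℂ) (hz : T₄ z = 0) : ∃ k m l : ℤ, z = τ / 2 + k * ξ + m + l * τ := by
  obtain ⟨k, m, l, e⟩ := F.zero₁ (z + τ / 2) (by rw [F.add_half_τ₁, hz, mul_zero])
  exact ⟨k, m, l - 1, by push_cast; linear_combination e⟩

theorem zero₃ (z : ℂ) (hz : T₃ z = 0) : ∃ k m l : ℤ, z = (τ + 1) / 2 + k * ξ + m + l * τ := by
  obtain ⟨k, m, l, e⟩ := F.zero₄ (z + 1 / 2) (by rw [F.add_half₄, hz])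
  exact ⟨k, m - 1, l, by push_cast; linear_combination e⟩

theorem simple₂ (z : ℂ) (hz : T₂ z = 0) : deriv T₂ z ≠ 0 :=
  deriv_ne_zero_of_add F.cubic₂.diff (differentiable_const _) F.add_half₁ F.simple₁ hz

theorem simple₄ (z : ℂ) (hz : T₄ z = 0) : deriv T₄ z ≠ 0 :=
  deriv_ne_zero_of_add F.cubic₄.diff (by have := differentiable_xvar; fun_prop)
    F.add_half_τ₁ F.simple₁ hz

theorem simple₃ (z : ℂ) (hz : T₃ z = 0) : deriv T₃ z ≠ 0 :=
  deriv_ne_zero_of_add F.cubic₃.diff (F := fun _ => 1) (differentiable_const _)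
    (fun z => by rw [F.add_half₄, one_mul]) F.simple₄ hz

/-- The data for the shift by `1 / 2`. -/
theorem pairData_half : PairData τ (1 / 2) ξ (-1) (-1) κ κ T₂ T₁ (c124 τ) (c123 τ)
    (fun _ => 1) μ where
  b_diff := F.cubic₂.diff
  β_diff := F.cubic₁.diff
  c_diff := (isCubic_c124 F.im_pos).diff
  c'_diff := (isCubic_c123 F.im_pos).diff
  b_neg := F.neg₂
  β_neg := F.neg₁
  c_neg := c124_neg F.im_pos
  c'_neg := c123_neg F.im_pos
  u_ne _ := one_ne_zero
  u_add _ _ := (mul_one 1).symm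
  u_cont := continuous_const
  b_add_s z := by rw [F.add_half₂, mul_one]
  β_add_s z := by rw [F.add_half₁, mul_one]
  c_add_s := c124_add_half
  c'_add_s := c123_add_half
  A_ne := by norm_num
  A'_ne := by norm_num
  B₀_ne := F.κ_ne
  B₁_ne := F.κ_ne
  μ_ne := F.μ_ne
  b_add_ξ := F.add_ξ₂
  β_add_ξ := F.add_ξ₁
  c_three := F.three_term (isCubic_c124 F.im_pos) (c124_neg F.im_pos) (Or.inl (by norm_num))
  c'_three := F.three_term (isCubic_c123 F.im_pos) (c123_neg F.im_pos) (Or.inl (by norm_num))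
  c_ξ_ne := mul_ne_zero (mul_ne_zero F.th1_ξ_ne F.th2_ξ_ne) F.th4_ξ_ne
  c'_ξ_ne := mul_ne_zero (mul_ne_zero F.th1_ξ_ne F.th2_ξ_ne) F.th3_ξ_ne
  b_zero := F.zero₂
  β_zero := F.zero₁
  b_simple := F.simple₂
  β_simple := F.simple₁
  disjoint z hz hz' := by
    obtain ⟨k, m, l, e⟩ := F.zero₂ z hz
    obtain ⟨k', m', l', e'⟩ := F.zero₁ z hz'
    have := (F.half_mem 1 0 (k' - k) (m' - m) (l' - l) (by
      push_cast; linear_combination e' - e)).1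
    exact absurd this (by decide)
  mult_one := ⟨fun _ => 1, -1, -1, 1, 1, fun _ => one_ne_zero, by norm_num, by norm_num,
    by norm_num, by norm_num, by simpa using F.cubic₂.add_one, by simpa using F.cubic₁.add_one,
    by simpa using (isCubic_c124 F.im_pos).add_one, by simpa using (isCubic_c123 F.im_pos).add_one⟩
  mult_τ := ⟨cubicMult τ, 1, -1, 1, -1, cubicMult_ne τ, by norm_num, by norm_num,
    by norm_num, by norm_num, F.cubic₂.add_τ, F.cubic₁.add_τ, (isCubic_c124 F.im_pos).add_τ,
    (isCubic_c123 F.im_pos).add_τ⟩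

omit F in
theorem xvar_cube_add (z w : ℂ) :
    xvar (-(3 * (z + w))) = xvar (-(3 * z)) * xvar (-(3 * w)) := by
  rw [← xvar_add]
  ring_nf

omit F in
theorem continuous_xvar_cube : Continuous fun z => xvar (-(3 * z)) := by
  have := differentiable_xvar.continuous
  fun_prop

/-- The data for the shift by `τ / 2`. -/
theorem pairData_half_τ : PairData τ (τ / 2) ξ (-nome τ (-1)) (-nome τ (-1 / 2)) a₄ a₁ T₄ T₁
    (c124 τ) (c134 τ) (fun z => xvar (-(3 * z))) μ where
  b_diff := F.cubic₄.diff
  β_diff := F.cubic₁.diff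
  c_diff := (isCubic_c124 F.im_pos).diff
  c'_diff := (isCubic_c134 F.im_pos).diff
  b_neg := F.neg₄
  β_neg := F.neg₁
  c_neg := c124_neg F.im_pos
  c'_neg := c134_neg F.im_pos
  u_ne _ := xvar_ne _
  u_add := xvar_cube_add
  u_cont := continuous_xvar_cube
  b_add_s := F.add_half_τ₄
  β_add_s := F.add_half_τ₁
  c_add_s := c124_add_half_τ F.im_pos
  c'_add_s := c134_add_half_τ F.im_pos
  A_ne := neg_ne_zero.mpr (nome_ne _ _)
  A'_ne := neg_ne_zero.mpr (nome_ne _ _)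
  B₀_ne := F.a₄_ne
  B₁_ne := F.a₁_ne
  μ_ne := F.μ_ne
  b_add_ξ := F.add_ξ₄
  β_add_ξ := F.add_ξ₁
  c_three := F.three_term (isCubic_c124 F.im_pos) (c124_neg F.im_pos) (Or.inl (by norm_num))
  c'_three := F.three_term (isCubic_c134 F.im_pos) (c134_neg F.im_pos) (Or.inr (by norm_num))
  c_ξ_ne := mul_ne_zero (mul_ne_zero F.th1_ξ_ne F.th2_ξ_ne) F.th4_ξ_ne
  c'_ξ_ne := mul_ne_zero (mul_ne_zero F.th1_ξ_ne F.th3_ξ_ne) F.th4_ξ_ne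
  b_zero := F.zero₄
  β_zero := F.zero₁
  b_simple := F.simple₄
  β_simple := F.simple₁
  disjoint z hz hz' := by
    obtain ⟨k, m, l, e⟩ := F.zero₄ z hz
    obtain ⟨k', m', l', e'⟩ := F.zero₁ z hz'
    have := (F.half_mem 0 1 (k' - k) (m' - m) (l' - l) (by
      push_cast; linear_combination e' - e)).2
    exact absurd this (by decide)
  mult_one := ⟨fun _ => 1, 1, -1, 1, -1, fun _ => one_ne_zero, by norm_num, by norm_num,
    by norm_num, by norm_num, by simpa using F.cubic₄.add_one, by simpa using F.cubic₁.add_one,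
    by simpa using (isCubic_c124 F.im_pos).add_one, by simpa using (isCubic_c134 F.im_pos).add_one⟩
  mult_τ := ⟨cubicMult τ, -1, -1, 1, 1, cubicMult_ne τ, by norm_num, by norm_num,
    by norm_num, by norm_num, F.cubic₄.add_τ, F.cubic₁.add_τ, (isCubic_c124 F.im_pos).add_τ,
    (isCubic_c134 F.im_pos).add_τ⟩

/-- The data for the shift by `(τ + 1) / 2`. -/
theorem pairData_half_one_τ : PairData τ ((τ + 1) / 2) ξ (nome τ (-1)) (I * nome τ (-1 / 2)) a₄
    (κ * a₂) T₃ T₁ (c123 τ) (c134 τ) (fun z => xvar (-(3 * z))) μ where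
  b_diff := F.cubic₃.diff
  β_diff := F.cubic₁.diff
  c_diff := (isCubic_c123 F.im_pos).diff
  c'_diff := (isCubic_c134 F.im_pos).diff
  b_neg := F.neg₃
  β_neg := F.neg₁
  c_neg := c123_neg F.im_pos
  c'_neg := c134_neg F.im_pos
  u_ne _ := xvar_ne _
  u_add := xvar_cube_add
  u_cont := continuous_xvar_cube
  b_add_s z := by
    rw [show z + (τ + 1) / 2 = z + τ / 2 + 1 / 2 by ring, F.add_half₃, F.add_half_τ₄]
  β_add_s z := by
    rw [show z + (τ + 1) / 2 = z + τ / 2 + 1 / 2 by ring, F.add_half₁, F.add_half_τ₂]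
    ring
  c_add_s := c123_add_half_one_τ F.im_pos
  c'_add_s := c134_add_half_one_τ F.im_pos
  A_ne := nome_ne _ _
  A'_ne := mul_ne_zero I_ne_zero (nome_ne _ _)
  B₀_ne := F.a₄_ne
  B₁_ne := mul_ne_zero F.κ_ne F.a₂_ne
  μ_ne := F.μ_ne
  b_add_ξ := F.add_ξ₃
  β_add_ξ := F.add_ξ₁
  c_three := F.three_term (isCubic_c123 F.im_pos) (c123_neg F.im_pos) (Or.inl (by norm_num))
  c'_three := F.three_term (isCubic_c134 F.im_pos) (c134_neg F.im_pos) (Or.inr (by norm_num))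
  c_ξ_ne := mul_ne_zero (mul_ne_zero F.th1_ξ_ne F.th2_ξ_ne) F.th3_ξ_ne
  c'_ξ_ne := mul_ne_zero (mul_ne_zero F.th1_ξ_ne F.th3_ξ_ne) F.th4_ξ_ne
  b_zero := F.zero₃
  β_zero := F.zero₁
  b_simple := F.simple₃
  β_simple := F.simple₁
  disjoint z hz hz' := by
    obtain ⟨k, m, l, e⟩ := F.zero₃ z hz
    obtain ⟨k', m', l', e'⟩ := F.zero₁ z hz'
    have := (F.half_mem 1 1 (k' - k) (m' - m) (l' - l) (by
      push_cast; linear_combination e' - e)).2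
    exact absurd this (by decide)
  mult_one := ⟨fun _ => 1, 1, -1, 1, -1, fun _ => one_ne_zero, by norm_num, by norm_num,
    by norm_num, by norm_num, by simpa using F.cubic₃.add_one, by simpa using F.cubic₁.add_one,
    by simpa using (isCubic_c123 F.im_pos).add_one, by simpa using (isCubic_c134 F.im_pos).add_one⟩
  mult_τ := ⟨cubicMult τ, 1, -1, -1, 1, cubicMult_ne τ, by norm_num, by norm_num,
    by norm_num, by norm_num, F.cubic₃.add_τ, F.cubic₁.add_τ, (isCubic_c123 F.im_pos).add_τ,
    (isCubic_c134 F.im_pos).add_τ⟩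

end ThetaFrame

/-! ### The two frames: cubed variables and a third of the period -/

theorem eq_and_eq_of_add_mul_eq {τ : ℂ} (hτ : 0 < τ.im) {a b c d : ℝ}
    (h : (a + b * τ : ℂ) = c + d * τ) : a = c ∧ b = d := by
  have hi := congrArg Complex.im h
  have hr := congrArg Complex.re h
  simp only [add_im, mul_im, ofReal_im, ofReal_re, zero_mul, zero_add, add_zero, add_re,
    mul_re, sub_zero] at hi hr
  have hb : b = d := mul_right_cancel₀ hτ.ne' hi
  subst hb
  exact ⟨by linarith, rfl⟩

section cubed

variable {τ : ℂ} (hτ : 0 < τ.im)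
include hτ

theorem three_mul_im_pos : 0 < (3 * τ).im := by
  simpa using hτ

omit hτ in
theorem cubicMult_three_mul (z : ℂ) :
    nome (3 * τ) (-1) * xvar (-(2 * (3 * z))) = cubicMult τ z := by
  rw [cubicMult, nome_eq_xvar, nome_eq_xvar]
  congr 2 <;> ring

omit hτ in
theorem nome_three_mul_half (z : ℂ) :
    nome (3 * τ) (-1 / 2) * (xvar (3 * z))⁻¹ = nome τ (-3 / 2) * xvar (-(3 * z)) := by
  rw [nome_eq_xvar, nome_eq_xvar, ← xvar_neg]
  congr 2
  ring

/-- The theta functions in the cubes of the variables form a frame. -/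
theorem thetaFrame_cubed : ThetaFrame τ (2 / 3) I (nome τ (-3 / 2)) (nome τ (-3 / 2)) 1 (-1)
    (fun z => th1 (3 * τ) (3 * z)) (fun z => th2 (3 * τ) (3 * z)) (fun z => th3 (3 * τ) (3 * z))
    (fun z => th4 (3 * τ) (3 * z)) (fun _ => 1) := by
  have h3 := three_mul_im_pos hτ
  have d1 := differentiable_th1 h3
  have d2 := differentiable_th2 h3
  have d3 := differentiable_th3 h3
  have d4 := differentiable_th4 h3
  have r1 : ∀ z : ℂ, 3 * (z + 1) = 3 * z + 1 + 1 + 1 := fun z => by ring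
  have rτ : ∀ z : ℂ, 3 * (z + τ) = 3 * z + 3 * τ := fun z => by ring
  -- With 2/3 instead of 1/3 the argument moves by two periods, so the signs of `th1` and `th2`
  -- cancel and all four functions share one μ.
  have rξ : ∀ z : ℂ, 3 * (z + 2 / 3) = 3 * z + 1 + 1 := fun z => by ring
  have rh : ∀ z : ℂ, 3 * (z + 1 / 2) = 3 * z + 1 / 2 + 1 := fun z => by ring
  have rt : ∀ z : ℂ, 3 * (z + τ / 2) = 3 * z + 3 * τ / 2 := fun z => by ring
  refine
    { im_pos := hτ
      cubic₁ := ⟨by fun_prop, by norm_num, by norm_num, fun z => ?_, fun z => ?_⟩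
      cubic₂ := ⟨by fun_prop, by norm_num, by norm_num, fun z => ?_, fun z => ?_⟩
      cubic₃ := ⟨by fun_prop, by norm_num, by norm_num, fun z => ?_, fun z => ?_⟩
      cubic₄ := ⟨by fun_prop, by norm_num, by norm_num, fun z => ?_, fun z => ?_⟩
      neg₁ := fun z => by rw [mul_neg, th1_neg h3]
      neg₂ := fun z => by rw [mul_neg, th2_neg h3]
      neg₃ := fun z => by rw [mul_neg, th3_neg]
      neg₄ := fun z => by rw [mul_neg, th4_neg]
      μ_diff := by fun_prop
      μ_ne := by simp
      μ_neg := by simp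
      μ_add_one := by simp
      μ_add_τ := fun z => ?_
      add_three_ξ := fun e₁ e₂ f hf z => ?_
      add_ξ₁ := fun z => by rw [rξ, th1_add_one, th1_add_one, one_mul, neg_neg]
      add_ξ₂ := fun z => by rw [rξ, th2_add_one, th2_add_one, one_mul, neg_neg]
      add_ξ₃ := fun z => by rw [rξ, th3_add_one, th3_add_one, one_mul]
      add_ξ₄ := fun z => by rw [rξ, th4_add_one, th4_add_one, one_mul]
      κ_ne := I_ne_zero
      a₁_ne := nome_ne _ _
      a₂_ne := nome_ne _ _
      a₄_ne := by norm_num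
      add_half₁ := fun z => by rw [rh, th1_add_one, th1_add_half]; ring
      add_half₂ := fun z => by rw [rh, th2_add_one, th2_add_half]; ring
      add_half₃ := fun z => by rw [rh, th3_add_one, th3_add_half]
      add_half₄ := fun z => by rw [rh, th4_add_one, th4_add_half]
      add_half_τ₁ := fun z => by rw [rt, th1_add_half_period, nome_three_mul_half]
      add_half_τ₂ := fun z => by rw [rt, th2_add_half_period, nome_three_mul_half]
      add_half_τ₃ := fun z => by rw [rt, th3_add_half_period h3, xvar_neg, one_mul]
      add_half_τ₄ := fun z => by rw [rt, th4_add_half_period h3, xvar_neg, neg_one_mul]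
      zero₁ := fun z hz => ?_
      simple₁ := fun z hz => ?_
      half_mem := fun i j k m l h => ?_
      two_ξ := fun m l h => ?_ }
  · rw [r1, th1_add_one, th1_add_one, th1_add_one]; ring
  · rw [rτ, th1_add_period h3, cubicMult_three_mul]; ring
  · rw [r1, th2_add_one, th2_add_one, th2_add_one]; ring
  · rw [rτ, th2_add_period h3, cubicMult_three_mul]; ring
  · rw [r1, th3_add_one, th3_add_one, th3_add_one]; ring
  · rw [rτ, th3_add_period h3, cubicMult_three_mul]; ring
  · rw [r1, th4_add_one, th4_add_one, th4_add_one]; ring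
  · rw [rτ, th4_add_period h3, cubicMult_three_mul]; ring
  · rw [one_mul, mul_one, cubicMult, cubicMult,
      show -(6 * (z + 2 / 3)) = -(6 * z) + -1 + -1 + -1 + -1 by ring]
    simp [xvar_add, xvar_neg, xvar_one]
  · rw [show z + 2 / 3 + 2 / 3 + 2 / 3 = z + 1 + 1 by ring, hf.add_one, hf.add_one]
    linear_combination f z * hf.sq₁
  · obtain ⟨m, l, e⟩ := th1_eq_zero h3 hz
    -- m/3 = 2m · (2/3) - m.
    exact ⟨2 * m, -m, l, by push_cast; linear_combination e / 3⟩
  · have e : deriv (fun z => th1 (3 * τ) (3 * z)) z = 3 * deriv (th1 (3 * τ)) (3 * z) := by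
      have := deriv_comp_mul_left (3 : ℂ) (th1 (3 * τ)) z
      simpa using this
    rw [e]
    exact mul_ne_zero (by norm_num) (deriv_th1_ne h3 hz)
  · obtain ⟨e1, e2⟩ := eq_and_eq_of_add_mul_eq hτ (a := i / 2) (b := j / 2) (c := k * (2 / 3) + m)
      (d := l) (by push_cast; exact h)
    have e1' : 3 * i = 4 * k + 6 * m := by
      have : (3 * i : ℝ) = 4 * k + 6 * m := by linarith
      exact_mod_cast this
    have e2' : j = 2 * l := by
      have : (j : ℝ) = 2 * l := by linarith
      exact_mod_cast this
    exact ⟨by rw [Int.even_iff]; omega, by rw [Int.even_iff]; omega⟩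
  · obtain ⟨e1, -⟩ := eq_and_eq_of_add_mul_eq hτ (a := 4 / 3) (b := 0) (c := m) (d := l)
      (by push_cast; linear_combination h)
    have : (4 : ℤ) = 3 * m := by
      have : (4 : ℝ) = 3 * m := by linarith
      exact_mod_cast this
    omega

end cubed

section third

variable {τ : ℂ} (hτ : 0 < τ.im)
include hτ

theorem div_three_im_pos : 0 < (τ / 3).im := by
  have : τ / 3 = ((1 / 3 : ℝ) : ℂ) * τ := by push_cast; ring
  rw [this, im_ofReal_mul]
  positivity

/-- The theta functions with the third of the period form a frame. -/
theorem thetaFrame_third : ThetaFrame τ (2 * τ / 3) (-I) (-nome τ (-5 / 6)) (nome τ (-5 / 6))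
    (nome τ (-2 / 3)) (nome τ (-2 / 3))
    (th1 (τ / 3)) (th2 (τ / 3)) (th3 (τ / 3)) (th4 (τ / 3))
    (fun z => nome τ (-4 / 3) * xvar (-(4 * z))) := by
  have h3 := div_three_im_pos hτ
  have d1 := differentiable_th1 h3
  have d2 := differentiable_th2 h3
  have d3 := differentiable_th3 h3
  have d4 := differentiable_th4 h3
  have dx := differentiable_xvar
  have rτ : ∀ z : ℂ, z + τ = z + τ / 3 + τ / 3 + τ / 3 := fun z => by ring
  -- Again two periods τ/3, so that the signs of `th1` and `th4` cancel.
  have rξ : ∀ z : ℂ, z + 2 * τ / 3 = z + τ / 3 + τ / 3 := fun z => by ring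
  have rt : ∀ z : ℂ, z + τ / 2 = z + τ / 3 / 2 + τ / 3 := fun z => by ring
  have mτ : ∀ z : ℂ, cubicMult τ z = (nome (τ / 3) (-1) * xvar (-(2 * z))) *
      (nome (τ / 3) (-1) * xvar (-(2 * (z + τ / 3)))) *
      (nome (τ / 3) (-1) * xvar (-(2 * (z + τ / 3 + τ / 3)))) := fun z => by
    simp only [cubicMult, nome_eq_xvar, ← xvar_add]
    congr 1; ring
  have mξ : ∀ z : ℂ, nome τ (-4 / 3) * xvar (-(4 * z)) = (nome (τ / 3) (-1) * xvar (-(2 * z))) *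
      (nome (τ / 3) (-1) * xvar (-(2 * (z + τ / 3)))) := fun z => by
    simp only [nome_eq_xvar, ← xvar_add]
    congr 1; ring
  have m1 : ∀ z : ℂ, nome τ (-5 / 6) * xvar (-(3 * z)) =
      (nome (τ / 3) (-1) * xvar (-(2 * (z + τ / 3 / 2)))) *
      (nome (τ / 3) (-1 / 2) * (xvar z)⁻¹) := fun z => by
    simp only [nome_eq_xvar, ← xvar_neg, ← xvar_add]
    congr 1; ring
  have m2 : ∀ z : ℂ, nome τ (-2 / 3) * xvar (-(3 * z)) =
      (nome (τ / 3) (-1) * xvar (-(2 * (z + τ / 3 / 2)))) * (xvar z)⁻¹ := fun z => by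
    simp only [nome_eq_xvar, ← xvar_neg, ← xvar_add]
    congr 1; ring
  refine
    { im_pos := hτ
      cubic₁ := ⟨d1, by norm_num, by norm_num, fun z => ?_, fun z => ?_⟩
      cubic₂ := ⟨d2, by norm_num, by norm_num, fun z => ?_, fun z => ?_⟩
      cubic₃ := ⟨d3, by norm_num, by norm_num, fun z => ?_, fun z => ?_⟩
      cubic₄ := ⟨d4, by norm_num, by norm_num, fun z => ?_, fun z => ?_⟩
      neg₁ := th1_neg h3
      neg₂ := th2_neg h3
      neg₃ := th3_neg
      neg₄ := th4_neg
      μ_diff := by fun_prop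
      μ_ne := fun z => mul_ne_zero (nome_ne _ _) (xvar_ne _)
      μ_neg := ?_
      μ_add_one := fun z => ?_
      μ_add_τ := fun z => ?_
      add_three_ξ := fun e₁ e₂ f hf z => ?_
      add_ξ₁ := fun z => by rw [rξ, th1_add_period h3, th1_add_period h3, mξ]; ring
      add_ξ₂ := fun z => by rw [rξ, th2_add_period h3, th2_add_period h3, mξ]; ring
      add_ξ₃ := fun z => by rw [rξ, th3_add_period h3, th3_add_period h3, mξ]; ring
      add_ξ₄ := fun z => by rw [rξ, th4_add_period h3, th4_add_period h3, mξ]; ring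
      κ_ne := neg_ne_zero.mpr I_ne_zero
      a₁_ne := neg_ne_zero.mpr (nome_ne _ _)
      a₂_ne := nome_ne _ _
      a₄_ne := nome_ne _ _
      add_half₁ := th1_add_half _
      add_half₂ := th2_add_half _
      add_half₃ := th3_add_half _
      add_half₄ := th4_add_half _
      add_half_τ₁ := fun z => ?_
      add_half_τ₂ := fun z => ?_
      add_half_τ₃ := fun z => ?_
      add_half_τ₄ := fun z => ?_
      zero₁ := fun z hz => ?_
      simple₁ := fun z hz => deriv_th1_ne h3 hz
      half_mem := fun i j k m l h => ?_
      two_ξ := fun m l h => ?_ }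
  · rw [th1_add_one]; ring
  · rw [rτ, th1_add_period h3, th1_add_period h3, th1_add_period h3, mτ]; ring
  · rw [th2_add_one]; ring
  · rw [rτ, th2_add_period h3, th2_add_period h3, th2_add_period h3, mτ]; ring
  · rw [th3_add_one]; ring
  · rw [rτ, th3_add_period h3, th3_add_period h3, th3_add_period h3, mτ]; ring
  · rw [th4_add_one]; ring
  · rw [rτ, th4_add_period h3, th4_add_period h3, th4_add_period h3, mτ]; ring
  · simp only [nome_eq_xvar, ← xvar_add]
    rw [← xvar_zero]
    congr 1; ring
  · rw [show -(4 * (z + 1)) = -(4 * z) + -1 + -1 + -1 + -1 by ring]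
    simp [xvar_add, xvar_neg, xvar_one]
  · simp only [cubicMult, nome_eq_xvar, ← xvar_add]
    congr 1; ring
  · rw [show z + 2 * τ / 3 + 2 * τ / 3 + 2 * τ / 3 = z + τ + τ by ring, hf.add_τ, hf.add_τ]
    have e : cubicMult τ (z + τ) * cubicMult τ z = nome τ (-4 / 3) * xvar (-(4 * z)) *
        (nome τ (-4 / 3) * xvar (-(4 * (z + 2 * τ / 3)))) *
        (nome τ (-4 / 3) * xvar (-(4 * (z + 2 * τ / 3 + 2 * τ / 3)))) := by
      simp only [cubicMult, nome_eq_xvar, ← xvar_add]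
      congr 1; ring
    rw [← e]
    linear_combination (cubicMult τ (z + τ) * cubicMult τ z * f z) * hf.sq₂
  · rw [rt, th1_add_period h3, th1_add_half_period, neg_mul (nome τ (-5 / 6)), m1]; ring
  · rw [rt, th2_add_period h3, th2_add_half_period, m1]; ring
  · rw [rt, th3_add_period h3, th3_add_half_period h3, m2]; ring
  · rw [rt, th4_add_period h3, th4_add_half_period h3, m2]; ring
  · obtain ⟨m, l, e⟩ := th1_eq_zero h3 hz
    -- lτ/3 = 2l · (2τ/3) - lτ.
    exact ⟨2 * l, m, -l, by push_cast; linear_combination e⟩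
  · obtain ⟨e1, e2⟩ := eq_and_eq_of_add_mul_eq hτ (a := i / 2) (b := j / 2) (c := m)
      (d := k * (2 / 3) + l) (by push_cast; linear_combination h)
    have e1' : i = 2 * m := by
      have : (i : ℝ) = 2 * m := by linarith
      exact_mod_cast this
    have e2' : 3 * j = 4 * k + 6 * l := by
      have : (3 * j : ℝ) = 4 * k + 6 * l := by linarith
      exact_mod_cast this
    exact ⟨by rw [Int.even_iff]; omega, by rw [Int.even_iff]; omega⟩
  · obtain ⟨-, e1⟩ := eq_and_eq_of_add_mul_eq hτ (a := 0) (b := 4 / 3) (c := m) (d := l)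
      (by push_cast; linear_combination h)
    have : (4 : ℤ) = 3 * l := by
      have : (4 : ℝ) = 3 * l := by linarith
      exact_mod_cast this
    omega

end third

/-! ### Theta functions at cube roots of unity -/

open Filter Topology in
theorem qProd_trisection (a : ℂ) {q : ℂ} (hq : ‖q‖ < 1) :
    qProd a q = qProd a (q ^ 3) * qProd (a * q) (q ^ 3) * qProd (a * q ^ 2) (q ^ 3) := by
  have hq3 : ‖q ^ 3‖ < 1 := by
    rw [norm_pow]
    exact pow_lt_one₀ (norm_nonneg _) hq (by norm_num)
  have t0 := (multipliable_qProd a hq).hasProd.tendsto_prod_nat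
  have t1 := (multipliable_qProd a hq3).hasProd.tendsto_prod_nat
  have t2 := (multipliable_qProd (a * q) hq3).hasProd.tendsto_prod_nat
  have t3 := (multipliable_qProd (a * q ^ 2) hq3).hasProd.tendsto_prod_nat
  have h3 : Tendsto (fun n : ℕ => 3 * n) atTop atTop :=
    tendsto_id.const_mul_atTop' (by norm_num)
  refine tendsto_nhds_unique (t0.comp h3) (((t1.mul t2).mul t3).congr fun n => ?_)
  simp only [Function.comp_apply]
  induction n with
  | zero => simp
  | succ n ih =>
    rw [show 3 * (n + 1) = 3 * n + 1 + 1 + 1 by ring, Finset.prod_range_succ _ (3 * n + 1 + 1),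
      Finset.prod_range_succ _ (3 * n + 1), Finset.prod_range_succ _ (3 * n), ← ih]
    simp only [Finset.prod_range_succ]
    ring

/-- Factorwise this is (1 - x)(1 - wx)(1 - w²x) = 1 - x³. -/
theorem qProd_mul_cube_roots (a : ℂ) {q w : ℂ} (hq : ‖q‖ < 1) (hw : 1 + w + w ^ 2 = 0) :
    qProd (a * w) q * qProd (a * w ^ 2) q * qProd a q = qProd (a ^ 3) (q ^ 3) := by
  have m1 := multipliable_qProd (a * w) hq
  have m2 := multipliable_qProd (a * w ^ 2) hq
  have m3 := multipliable_qProd a hq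
  unfold qProd
  rw [← m1.tprod_mul m2, ← (m1.mul m2).tprod_mul m3]
  refine tprod_congr fun j => ?_
  have hw3 : w ^ 3 = 1 := by linear_combination (w - 1) * hw
  linear_combination (-(a * q ^ j) + (a * q ^ j) ^ 2 * w ) * hw + 
    (-(a * q ^ j) ^ 3) * hw3

theorem qProd_ne_zero_of_norm_lt {a q : ℂ} (ha : ‖a‖ < 1) (hq : ‖q‖ < 1) : qProd a q ≠ 0 := by
  refine qProd_ne_zero hq fun j hj => ?_
  have := congrArg norm hj
  rw [norm_mul, norm_pow, norm_one] at this
  have h1 : ‖q‖ ^ j ≤ 1 := pow_le_one₀ (norm_nonneg _) hq.le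
  nlinarith [norm_nonneg a]

/-- The product over cube roots gives (aw, aw², a; a²)_∞ = (a³; a⁶)_∞. Trisecting (a; a²)_∞ into
base a⁶ produces (a³; a⁶)_∞ again, which cancels, and the factors of θ(a; a⁶). -/
theorem theta_mul_cube_root {a w : ℂ} (ha0 : a ≠ 0) (ha : ‖a‖ < 1) (hw : 1 + w + w ^ 2 = 0) :
    theta (a * w ^ 2) (a ^ 2) * theta a (a ^ 6) = 1 := by
  have hpow : ∀ k : ℕ, k ≠ 0 → ‖a ^ k‖ < 1 := fun k hk => by
    rw [norm_pow]
    exact pow_lt_one₀ (norm_nonneg _) ha hk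
  have hw3 : w ^ 3 = 1 := by linear_combination (w - 1) * hw
  have hw0 : w ≠ 0 := fun h => by simp [h] at hw
  have h1 := qProd_mul_cube_roots a (hpow 2 two_ne_zero) hw
  rw [qProd_trisection a (hpow 2 two_ne_zero)] at h1
  have e1 : a ^ 2 / (a * w ^ 2) = a * w := by
    field_simp
    linear_combination -hw3
  have e2 : a ^ 6 / a = a * (a ^ 2) ^ 2 := by
    field_simp
  unfold theta
  rw [e1, e2]
  have e3 : (a ^ 2) ^ 3 = a ^ 6 := by ring
  have e4 : a * a ^ 2 = a ^ 3 := by ring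
  rw [e3, e4] at h1
  refine mul_right_cancel₀ (qProd_ne_zero_of_norm_lt (hpow 3 (by norm_num))
    (hpow 6 (by norm_num))) ?_
  linear_combination h1

/-- The same cancellation with -q in base q. The value -w = 1 + w² is the first factor of (-w²;
q)_∞, split off beforehand. -/
theorem theta_neg_cube_root {q w : ℂ} (hq0 : q ≠ 0) (hq : ‖q‖ < 1) (hw : 1 + w + w ^ 2 = 0) :
    theta (-w ^ 2) q * theta (-q) (q ^ 3) = -w := by
  have hpow : ∀ k : ℕ, k ≠ 0 → ‖q ^ k‖ < 1 := fun k hk => by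
    rw [norm_pow]
    exact pow_lt_one₀ (norm_nonneg _) hq hk
  have hw3 : w ^ 3 = 1 := by linear_combination (w - 1) * hw
  have hw0 : w ≠ 0 := fun h => by simp [h] at hw
  have h1 := qProd_mul_cube_roots (-q) hq hw
  rw [qProd_trisection (-q) hq] at h1
  have e1 : q / -w ^ 2 = -q * w := by
    field_simp
    linear_combination hw3
  have e2 : q ^ 3 / -q = -q * q := by
    field_simp
  have e3 : -w ^ 2 * q = -q * w ^ 2 := by ring
  have e4 : (-q) ^ 3 = -q * q ^ 2 := by ring
  unfold theta
  rw [e1, e2, qProd_step (-w ^ 2) q hq, e3]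
  rw [e4] at h1
  have hne : qProd (-q * q ^ 2) (q ^ 3) ≠ 0 := by
    refine qProd_ne_zero_of_norm_lt ?_ (hpow 3 (by norm_num))
    rw [show -q * q ^ 2 = -q ^ 3 by ring, norm_neg]
    exact hpow 3 (by norm_num)
  refine mul_right_cancel₀ hne ?_
  linear_combination (1 + w ^ 2) * h1 + qProd (-q * q ^ 2) (q ^ 3) * hw

/-! ### From the labels to functions of differences -/

/-- The function of `z_i - z_j` in the product over `i < j`. -/
def denFun (σ : Label) (τ : ℂ) : ℂ → ℂ :=
  match σ with
  | .s0 | .s6 => th4 (τ / 3)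
  | .h0 | .h6 => th3 (τ / 3)
  | .s1 | .h1 => fun z => th2 (3 * τ) (3 * z)
  | .s2 | .s4 => fun z => th4 (3 * τ) (3 * z)
  | .h2 | .h4 => fun z => th3 (3 * τ) (3 * z)
  | .s3 | .h3 => th2 (τ / 3)

/-- The numerator of the pfaffian as a function of `z_i - z_j`. -/
def numFun (σ : Label) (τ : ℂ) : ℂ → ℂ :=
  match σ with
  | .s0 | .s1 | .s3 | .s4 => c124 τ
  | .h0 | .h1 | .h3 | .h4 => c123 τ
  | .s2 | .s6 | .h2 | .h6 => c134 τ

theorem nome_three (τ l : ℂ) : nome (3 * τ) l = nome τ (3 * l) := by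
  rw [nome_eq_xvar, nome_eq_xvar]
  ring_nf

theorem nome_third (τ l : ℂ) : nome (τ / 3) l = nome τ (l / 3) := by
  rw [nome_eq_xvar, nome_eq_xvar]
  ring_nf

/-- The monomial supplies the factor by which `th2` differs from its theta product, so the result is
an even function of z - w. -/
theorem monom_mul_entryDen (σ : Label) (τ z w : ℂ) :
    monom σ (xvar z) (xvar w) * entryDen σ τ (xvar z) (xvar w) = denFun σ τ (z - w) := by
  have hz := xvar_ne z
  have hw := xvar_ne w
  have h3 : xvar (3 * (z - w)) = (xvar z / xvar w) ^ 3 := by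
    rw [← xvar_sub, xvar_pow]
    norm_num
  cases σ <;>
    simp only [monom, entryDen, denFun, hatSign, th2, th3, th4, h3, xvar_sub, nome_three,
      nome_third, div_pow, one_mul, neg_mul, ← pow_mul, inv_div, mul_one] <;> norm_num

theorem monom_mul_entryNum (σ : Label) (τ z w : ℂ) :
    monom σ (xvar z) (xvar w) * entryNum σ τ (xvar z) (xvar w) = numFun σ τ (z - w) := by
  have hz := xvar_ne z
  have hw := xvar_ne w
  cases σ <;>
    simp only [monom, entryNum, numFun, theta3, hatSign, c124, c123, c134, th1, th2, th3, th4,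
      xvar_sub, div_pow, one_mul, neg_mul, inv_div, neg_neg] <;> field_simp

theorem P_eq_diffPf {n : ℕ} (σ : Label) (z : Fin (2 * n) → ℂ) (τ : ℂ) :
    P σ z τ = diffPf n (denFun σ τ) (numFun σ τ) z := by
  unfold P diffPf pfProd
  simp only [monom_mul_entryDen, monom_mul_entryNum]

theorem shiftFirst_consVec {m : ℕ} (hn : 0 < m + 1) (t s : ℂ) (w : Fin (2 * m + 1) → ℂ) :
    shiftFirst hn (consVec t w) s = consVec (t + s) w := by
  have h : firstIdx (m + 1) hn = (0 : Fin (2 * m + 1 + 1)) := rfl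
  unfold shiftFirst
  rw [h]
  exact Fin.update_cons_zero _ _ _

theorem shiftMonom_consVec {m : ℕ} (hn : 0 < m + 1) (t : ℂ) (w : Fin (2 * m + 1) → ℂ) :
    shiftMonom hn (consVec t w) = ∏ j, xvar (-(3 * (t - w j))) := by
  have h : firstIdx (m + 1) hn = (0 : Fin (2 * m + 1 + 1)) := rfl
  have e : ∏ j ∈ univ.erase (0 : Fin (2 * m + 1 + 1)), xvar (consVec t w j) ^ 3 =
      ∏ j, xvar (w j) ^ 3 := by
    rw [← Finset.compl_singleton, ← Fin.image_succ_univ, Finset.prod_image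
      (Fin.succ_injective _).injOn]
    rfl
  unfold shiftMonom
  rw [h]
  refine (congrArg₂ (· / ·) e rfl).trans ?_
  -- Each of the 2m + 1 remaining variables contributes x_1⁻³.
  have h3 : 6 * (m + 1) - 3 = 3 * (2 * m + 1) := by omega
  change (∏ j, xvar (w j) ^ 3) / xvar t ^ (6 * (m + 1) - 3) = _
  have hj : ∀ j, xvar (-(3 * (t - w j))) = xvar (w j) ^ 3 / xvar t ^ 3 := fun j => by
    rw [xvar_pow, xvar_pow, ← xvar_sub]
    push_cast
    ring_nf
  simp only [hj]
  rw [Finset.prod_div_distrib, Finset.prod_const, card_univ, Fintype.card_fin, ← pow_mul, h3]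

/-- The transformation formula for labels with the same denominators. -/
theorem P_consVec_add_of_pairData {σ ρ : Label} {τ s ξ A A' B₀ B₁ : ℂ} {b β c c' u μ : ℂ → ℂ}
    (hτ : 0 < τ.im) (h : PairData τ s ξ A A' B₀ B₁ b β c c' u μ)
    (hb : denFun σ τ = b) (hb' : denFun ρ τ = b) (hc : numFun σ τ = c) (hc' : numFun ρ τ = c')
    (hA : constA σ τ = A) (hB : constB σ τ = B₀ * B₁ * (A * c' ξ) / (A' * c ξ))
    (m : ℕ) (t : ℂ) (w : Fin (2 * m + 1) → ℂ) :
    P (n := m + 1) σ (consVec (t + s) w) τ =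
      constA σ τ * constB σ τ ^ m * (∏ j, u (t - w j)) * P (n := m + 1) ρ (consVec t w) τ := by
  rw [P_eq_diffPf, P_eq_diffPf, hb, hb', hc, hc', hA, hB, ← h.diffPf_add_s hτ]

/-! ### Values of the Jacobi functions at ξ -/

section constants

variable {τ : ℂ}

theorem xvar_two_thirds : 1 + xvar (2 / 3) + xvar (2 / 3) ^ 2 = 0 := by
  have h3 : xvar (2 / 3) ^ 3 = 1 := by
    rw [xvar_pow, xvar_eq_one_iff]
    exact ⟨1, by norm_num⟩
  have h1 : xvar (2 / 3) ≠ 1 := by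
    rw [Ne, xvar_eq_one_iff]
    rintro ⟨k, hk⟩
    have : (1 : ℤ) = 3 * k := by
      have : (1 : ℂ) = 3 * k := by linear_combination 3 / 2 * hk
      exact_mod_cast this
    omega
  refine mul_left_cancel₀ (sub_ne_zero.mpr h1) ?_
  linear_combination h3

theorem norm_nome_nat_lt (hτ : 0 < τ.im) {k : ℕ} (hk : 0 < k) : ‖nome τ k‖ < 1 := by
  have := norm_nome_lt τ hτ k (by exact_mod_cast hk)
  exact_mod_cast this

theorem nome_one_pow (k : ℕ) : nome τ 1 ^ k = nome τ k := by
  rw [nome_eq_xvar, xvar_pow, nome_eq_xvar]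
  ring_nf

/-- At z = 2/3 the variable x is a primitive cube root of unity, so `theta_mul_cube_root` applies
with a = p. -/
theorem th4_two_thirds (hτ : 0 < τ.im) :
    th4 τ (2 / 3) * theta (nome τ 1) (nome τ 6) = 1 := by
  have h := theta_mul_cube_root (nome_ne τ 1)
    (by exact_mod_cast norm_nome_nat_lt hτ one_pos) xvar_two_thirds
  rw [nome_one_pow, nome_one_pow] at h
  exact_mod_cast h

theorem th3_two_thirds (hτ : 0 < τ.im) :
    th3 τ (2 / 3) * theta (-nome τ 1) (nome τ 6) = 1 := by
  have h := theta_mul_cube_root (neg_ne_zero.mpr (nome_ne τ 1))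
    (by rw [norm_neg]; exact_mod_cast norm_nome_nat_lt hτ one_pos) xvar_two_thirds
  rw [neg_pow, neg_pow _ 6, nome_one_pow, nome_one_pow, neg_mul] at h
  norm_num at h
  exact h

theorem th2_two_thirds (hτ : 0 < τ.im) :
    th2 τ (2 / 3) * theta (-nome τ 2) (nome τ 6) = -1 := by
  have h := theta_neg_cube_root (nome_ne τ 2)
    (by exact_mod_cast norm_nome_nat_lt hτ two_pos) xvar_two_thirds
  have e : nome τ 2 ^ 3 = nome τ 6 := by
    rw [nome_eq_xvar, xvar_pow, nome_eq_xvar]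
    push_cast
    ring_nf
  rw [e] at h
  have := xvar_ne (2 / 3)
  rw [th2, mul_assoc, h]
  field_simp

theorem theta_mul_nome_two (hτ : 0 < τ.im) {x : ℂ} (hx : x ≠ 0) :
    theta (nome τ 2 * x) (nome τ 2) = -x⁻¹ * theta x (nome τ 2) :=
  theta_mul_nome x _ hx (nome_ne _ _) (norm_nome_two_lt hτ)

/-- The argument is p^(7/3) = p² · p^(1/3), one quasi-period away from p^(1/3). -/
theorem th4_two_thirds_period (hτ : 0 < τ.im) :
    th4 τ (2 * τ / 3) = -nome τ (-1 / 3) * theta (nome τ (1 / 3)) (nome τ 2) := by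
  have e1 : nome τ 1 * xvar (2 * τ / 3) ^ 2 = nome τ 2 * nome τ (1 / 3) := by
    simp only [nome_eq_xvar, xvar_pow, ← xvar_add]
    push_cast
    ring_nf
  have e2 : (nome τ (1 / 3))⁻¹ = nome τ (-1 / 3) := by
    simp only [nome_eq_xvar, ← xvar_neg]
    ring_nf
  rw [th4, e1, theta_mul_nome_two hτ (nome_ne _ _), e2]

theorem th3_two_thirds_period (hτ : 0 < τ.im) :
    th3 τ (2 * τ / 3) = nome τ (-1 / 3) * theta (-nome τ (1 / 3)) (nome τ 2) := by
  have e1 : -(nome τ 1 * xvar (2 * τ / 3) ^ 2) = nome τ 2 * -nome τ (1 / 3) := by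
    rw [mul_neg]
    simp only [nome_eq_xvar, xvar_pow, ← xvar_add]
    push_cast
    ring_nf
  have e2 : (nome τ (1 / 3))⁻¹ = nome τ (-1 / 3) := by
    simp only [nome_eq_xvar, ← xvar_neg]
    ring_nf
  rw [th3, e1, theta_mul_nome_two hτ (neg_ne_zero.mpr (nome_ne _ _)), inv_neg, neg_neg, e2]

theorem th2_two_thirds_period :
    th2 τ (2 * τ / 3) = nome τ (-2 / 3) * theta (-nome τ (2 / 3)) (nome τ 2) := by
  have e1 : -xvar (2 * τ / 3) ^ 2 = nome τ 2 / -nome τ (2 / 3) := by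
    rw [div_neg, nome_eq_xvar, nome_eq_xvar, ← xvar_sub, xvar_pow]
    push_cast
    ring_nf
  have e2 : (xvar (2 * τ / 3))⁻¹ = nome τ (-2 / 3) := by
    simp only [nome_eq_xvar, ← xvar_neg]
    ring_nf
  rw [th2, e1, theta_refl _ _ (nome_ne _ _), e2]

end constants

/-! ### The twelve identities -/

section labels

variable {τ : ℂ}

/-- The fractional powers in the constants, as powers of `p^(-1/6)`. -/
theorem exists_nome_eq_pow (τ : ℂ) : ∃ g : ℂ, g ≠ 0 ∧
    nome τ (-1 / 3) = g ^ 2 ∧ nome τ (-1 / 2) = g ^ 3 ∧ nome τ (-2 / 3) = g ^ 4 ∧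
    nome τ (-5 / 6) = g ^ 5 ∧ nome τ (-1) = g ^ 6 ∧ nome τ (-4 / 3) = g ^ 8 ∧
    nome τ (-3 / 2) = g ^ 9 ∧ nome τ (-5 / 3) = g ^ 10 ∧ nome τ (-2) = g ^ 12 := by
  refine ⟨nome τ (-1 / 6), nome_ne _ _, ?_, ?_, ?_, ?_, ?_, ?_, ?_, ?_, ?_⟩ <;>
  · rw [nome_eq_xvar, nome_eq_xvar, xvar_pow]
    push_cast
    ring_nf

variable (hτ : 0 < τ.im)
include hτ

/-- The transformation formula for the labels whose denominators are theta functions in the cubes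
of the variables. -/
theorem P_consVec_cubed (m : ℕ) (t : ℂ) (w : Fin (2 * m + 1) → ℂ) {σ ρ : Label}
    {s : ℂ} {u : ℂ → ℂ}
    (h : (s = 1 / 2 ∧ u = fun _ => 1) ∧ (σ = .s1 ∧ ρ = .h1 ∨ σ = .h1 ∧ ρ = .s1) ∨
      (s = τ / 2 ∧ u = fun z => xvar (-(3 * z))) ∧ (σ = .s2 ∧ ρ = .s4 ∨ σ = .s4 ∧ ρ = .s2) ∨
      (s = (τ + 1) / 2 ∧ u = fun z => xvar (-(3 * z))) ∧
        (σ = .h2 ∧ ρ = .h4 ∨ σ = .h4 ∧ ρ = .h2)) :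
    P (n := m + 1) σ (consVec (t + s) w) τ =
      constA σ τ * constB σ τ ^ m * (∏ j, u (t - w j)) * P (n := m + 1) ρ (consVec t w) τ := by
  have F := thetaFrame_cubed hτ
  obtain ⟨g, hg, n2, n3, n4, n5, n6, n8, n9, n10, n12⟩ := exists_nome_eq_pow τ
  have h1 := F.th1_ξ_ne
  have h2 := F.th2_ξ_ne
  have h3 := F.th3_ξ_ne
  have h4 := F.th4_ξ_ne
  have e4 := eq_inv_of_mul_eq_one_right (th4_two_thirds hτ)
  have e3 := eq_inv_of_mul_eq_one_right (th3_two_thirds hτ)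
  have e2 := eq_inv_of_mul_eq_one_right (a := -th2 τ (2 / 3)) (b := theta (-nome τ 2) (nome τ 6))
    (by rw [neg_mul, th2_two_thirds hτ, neg_neg])
  rcases h with ⟨⟨rfl, rfl⟩, h⟩ | ⟨⟨rfl, rfl⟩, h⟩ | ⟨⟨rfl, rfl⟩, h⟩ <;>
    rcases h with ⟨rfl, rfl⟩ | ⟨rfl, rfl⟩
  -- Here B₀B₁ = I² = -1, and the common factors of c'(ξ)/c(ξ) cancel, leaving `th3`/`th4` at ξ.
  · refine P_consVec_add_of_pairData hτ F.pairData_half rfl rfl rfl rfl rfl ?_ m t w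
    simp only [constB, c123, c124, e3, e4]
    field_simp
    simp
  · refine P_consVec_add_of_pairData hτ F.pairData_half.symm rfl rfl rfl rfl rfl ?_ m t w
    simp only [constB, c123, c124, e3, e4]
    field_simp
    simp
  · refine P_consVec_add_of_pairData hτ F.pairData_half_τ.symm rfl rfl rfl rfl rfl ?_ m t w
    simp only [constB, c124, c134, e2, e3, n3, n6, n9]
    field_simp
  · refine P_consVec_add_of_pairData hτ F.pairData_half_τ rfl rfl rfl rfl rfl ?_ m t w
    simp only [constB, c124, c134, e2, e3, n3, n6, n9, n12]
    field_simp
  · refine P_consVec_add_of_pairData hτ F.pairData_half_one_τ.symm rfl rfl rfl rfl rfl ?_ m t w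
    simp only [constB, c123, c134, e2, e4, n3, n6, n9]
    field_simp
    rw [I_sq]
    ring
  · refine P_consVec_add_of_pairData hτ F.pairData_half_one_τ rfl rfl rfl rfl rfl ?_ m t w
    simp only [constB, c123, c134, e2, e4, n3, n6, n9, n12]
    field_simp

/-- The transformation formula for the labels whose denominators are theta functions with the
third of the period. -/
theorem P_consVec_third (m : ℕ) (t : ℂ) (w : Fin (2 * m + 1) → ℂ) {σ ρ : Label}
    {s : ℂ} {u : ℂ → ℂ}
    (h : (s = 1 / 2 ∧ u = fun _ => 1) ∧ (σ = .s3 ∧ ρ = .h3 ∨ σ = .h3 ∧ ρ = .s3) ∨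
      (s = τ / 2 ∧ u = fun z => xvar (-(3 * z))) ∧ (σ = .s0 ∧ ρ = .s6 ∨ σ = .s6 ∧ ρ = .s0) ∨
      (s = (τ + 1) / 2 ∧ u = fun z => xvar (-(3 * z))) ∧
        (σ = .h0 ∧ ρ = .h6 ∨ σ = .h6 ∧ ρ = .h0)) :
    P (n := m + 1) σ (consVec (t + s) w) τ =
      constA σ τ * constB σ τ ^ m * (∏ j, u (t - w j)) * P (n := m + 1) ρ (consVec t w) τ := by
  have F := thetaFrame_third hτ
  obtain ⟨g, hg, n2, n3, n4, n5, n6, n8, n9, n10, n12⟩ := exists_nome_eq_pow τ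
  have h1 := F.th1_ξ_ne
  have h2 := F.th2_ξ_ne
  have h3 := F.th3_ξ_ne
  have h4 := F.th4_ξ_ne
  have e4 := th4_two_thirds_period hτ
  have e3 := th3_two_thirds_period hτ
  have e2 := th2_two_thirds_period (τ := τ)
  -- The theta values in the denominators of the constants are nonzero because the Jacobi functions
  -- do not vanish at ξ.
  have k4 := right_ne_zero_of_mul (e4 ▸ h4)
  have k3 := right_ne_zero_of_mul (e3 ▸ h3)
  have k2 := right_ne_zero_of_mul (e2 ▸ h2)
  rcases h with ⟨⟨rfl, rfl⟩, h⟩ | ⟨⟨rfl, rfl⟩, h⟩ | ⟨⟨rfl, rfl⟩, h⟩ <;>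
    rcases h with ⟨rfl, rfl⟩ | ⟨rfl, rfl⟩
  · refine P_consVec_add_of_pairData hτ F.pairData_half rfl rfl rfl rfl rfl ?_ m t w
    simp only [constB, c123, c124, e3, e4, n2]
    field_simp
    simp
  · refine P_consVec_add_of_pairData hτ F.pairData_half.symm rfl rfl rfl rfl rfl ?_ m t w
    simp only [constB, c123, c124, e3, e4, n2]
    field_simp
    simp
  · refine P_consVec_add_of_pairData hτ F.pairData_half_τ rfl rfl rfl rfl rfl ?_ m t w
    simp only [constB, c124, c134, e2, e3, n2, n3, n4, n5, n6, n10]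
    field_simp
  · refine P_consVec_add_of_pairData hτ F.pairData_half_τ.symm rfl rfl rfl rfl rfl ?_ m t w
    simp only [constB, c124, c134, e2, e3, n2, n3, n4, n5, n6, n8]
    field_simp
  · refine P_consVec_add_of_pairData hτ F.pairData_half_one_τ rfl rfl rfl rfl rfl ?_ m t w
    simp only [constB, c123, c134, e2, e4, n2, n3, n4, n5, n6, n10]
    field_simp
  · refine P_consVec_add_of_pairData hτ F.pairData_half_one_τ.symm rfl rfl rfl rfl rfl ?_ m t w
    simp only [constB, c123, c134, e2, e4, n2, n3, n4, n5, n6, n8]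
    field_simp
    rw [I_sq]

end labels

end

end EllipticPfaffian

open EllipticPfaffian

theorem mainTheorem10 (n : ℕ) (hn : 0 < n) (τ : ℂ) (hτ : 0 < τ.im) (z : Fin (2 * n) → ℂ) :
    (∀ σ ρ : Label,
      s(σ, ρ) ∈ ({s(.s1, .h1), s(.s3, .h3)} : Set (Sym2 Label)) →
        P σ (shiftFirst hn z (1 / 2)) τ =
          constA σ τ * constB σ τ ^ (n - 1) * P ρ z τ) ∧
    (∀ σ ρ : Label,
      s(σ, ρ) ∈ ({s(.s0, .s6), s(.s2, .s4)} : Set (Sym2 Label)) →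
        P σ (shiftFirst hn z (τ / 2)) τ =
          constA σ τ * constB σ τ ^ (n - 1) * shiftMonom hn z * P ρ z τ) ∧
    (∀ σ ρ : Label,
      s(σ, ρ) ∈ ({s(.h0, .h6), s(.h2, .h4)} : Set (Sym2 Label)) →
        P σ (shiftFirst hn z ((τ + 1) / 2)) τ =
          constA σ τ * constB σ τ ^ (n - 1) * shiftMonom hn z * P ρ z τ) := by
  obtain ⟨m, rfl⟩ : ∃ m, n = m + 1 := ⟨n - 1, by omega⟩
  obtain ⟨t, w, rfl⟩ : ∃ t w, z = consVec (m := 2 * m + 1) t w :=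
    ⟨z (0 : Fin (2 * m + 1 + 1)), Fin.tail (n := 2 * m + 1) z, (Fin.cons_self_tail _).symm⟩
  simp only [shiftFirst_consVec, shiftMonom_consVec, Nat.add_sub_cancel, Set.mem_insert_iff,
    Set.mem_singleton_iff, Sym2.eq_iff]
  refine ⟨fun σ ρ h => ?_, fun σ ρ h => ?_, fun σ ρ h => ?_⟩ <;> rcases h with h | h
  · have := P_consVec_cubed hτ m t w (Or.inl ⟨⟨rfl, rfl⟩, h⟩)
    rwa [Finset.prod_const_one, mul_one] at this
  · have := P_consVec_third hτ m t w (Or.inl ⟨⟨rfl, rfl⟩, h⟩)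
    rwa [Finset.prod_const_one, mul_one] at this
  · have := P_consVec_third hτ m t w (Or.inr (Or.inl ⟨⟨rfl, rfl⟩, h⟩))
    exact this
  · have := P_consVec_cubed hτ m t w (Or.inr (Or.inl ⟨⟨rfl, rfl⟩, h⟩))
    exact this
  · have := P_consVec_third hτ m t w (Or.inr (Or.inr ⟨⟨rfl, rfl⟩, h⟩))
    exact this
  · have := P_consVec_cubed hτ m t w (Or.inr (Or.inr ⟨⟨rfl, rfl⟩, h⟩))
    exact this
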